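/- Let $\frac12 < s < 1$, let $n$ be an integer with $n > 2s$ (that is, $n \ge 2$), and let $\Omega \subset \mathbb{R}^n$ be a bounded Lipschitz domain with surface measure $dQ$ on $\partial\Omega$. For $0<\alpha<1$ let $H^{\alpha}(\partial\Omega)$ be the space of $f \in L^2(\partial\Omega)$ with $$\|f\|_{H^\alpha(\partial\Omega)}^2 = \|f\|_{L^2(\partial\Omega)}^2 + \int_{\partial\Omega}\int_{\partial\Omega} \frac{|f(P)-f(Q)|^2}{|P-Q|^{n-1+2\alpha}}\,dP\,dQ < \infty ,$$ and let $H^{-\alpha}(\partial\Omega)$ be its dual space, with the dual norm and the duality pairing $\langle\cdot,\cdot\rangle$. Let $\Gamma_{2s}(x) = c(n,2s)\,|x|^{2s-n}$ be the Riesz kernel of order $2s$, where $c(n,\beta) = \pi^{\beta-n/2}\,\Gamma(\frac{n-\beta}2)/\Gamma(\frac{\beta}2)$, and for $\varphi \in H^{-s+\frac12}(\partial\Omega)$ let $$\mathcal{S}_s\varphi(x) = \langle \varphi, \Gamma_{2s}(x-\cdot)\rangle , \qquad x \in \mathbb{R}^n\setminus\partial\Omega,$$ be its layer potential. Let $\dot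 H^s(\mathbb{R}^n)$ be the space of $v \in L^2_{loc}(\mathbb{R}^n)$ that are tempered distributions whose Fourier transform $\hat v$ is a locally integrable function with $\int_{\mathbb{R}^n} |\xi|^{2s}|\hat v(\xi)|^2\,d\xi < \infty$. Theorem. For every $x \in \mathbb{R}^n\setminus\partial\Omega$ the function $\Gamma_{2s}(x-\cdot)$ lies in $H^{s-\frac12}(\partial\Omega)$, so that $\mathcal{S}_s\varphi(x)$ is well defined. Moreover, there is a constant $c > 0$, depending only on $n$, $s$ and $\Omega$, such that for every $\varphi \in H^{-s+\frac12}(\partial\Omega)$ the function $u = \mathcal{S}_s\varphi$ (defined off the Lebesgue null set $\partial\Omega$) belongs to $\dot H^s(\mathbb{R}^n)$ and $$\int_{\mathbb{R}^n}\int_{\mathbb{R}^n} \frac{|u(x)-u(y)|^2}{|x-y|^{n+2s}}\,dy\,dx \le c\,\|\varphi\|^2_{H^{-s+\frac12}(\partial\Omega)} .$$ -/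

import Mathlib

open MeasureTheory
open scoped ENNReal NNReal SchwartzMap FourierTransform

noncomputable section

/-- A bounded Lipschitz domain in `ℝⁿ`: a bounded connected open set which, near each of its
boundary points and in suitable orthonormal coordinates `x = (x', t)` with `t = ⟪e, x⟫` and
`x'` in the hyperplane orthogonal to the unit vector `e`, is the set of points lying above the
graph of a Lipschitz function `g`. -/
structure IsBoundedLipschitzDomain {n : ℕ} (Ω : Set (EuclideanSpace ℝ (Fin n))) : Prop where
  isOpen : IsOpen Ω
  isConnected : IsConnected Ω
  isBounded : Bornology.IsBounded Ω
  locally_graph : ∀ p ∈ frontier Ω, ∃ e : EuclideanSpace ℝ (Fin n), ‖e‖ = 1 ∧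
    ∃ (K : ℝ≥0) (g : (ℝ ∙ e)ᗮ → ℝ), LipschitzWith K g ∧
      ∃ r : ℝ, 0 < r ∧ ∀ x ∈ Metric.ball p r,
        (x ∈ Ω ↔ g ((ℝ ∙ e)ᗮ.orthogonalProjectionOnto x) < inner ℝ e x)

/-- The surface measure `dQ` on the boundary of `Ω`: the `(n-1)`-dimensional Hausdorff measure
(normalised as in Euclidean geometry) restricted to `∂Ω`. -/
def surfaceMeasure {n : ℕ} (Ω : Set (EuclideanSpace ℝ (Fin n))) :
    Measure (EuclideanSpace ℝ (Fin n)) :=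
  (μHE[n - 1] : Measure (EuclideanSpace ℝ (Fin n))).restrict (frontier Ω)

/-- The weighted difference `(f P - f Q) / |P - Q| ^ ((n - 1 + 2α) / 2)`. Its squared modulus is
the integrand of the double integral that defines the Sobolev space of order `α` on `∂Ω`. -/
def weightedDiff {n : ℕ} (α : ℝ) (f : EuclideanSpace ℝ (Fin n) → ℂ)
    (z : EuclideanSpace ℝ (Fin n) × EuclideanSpace ℝ (Fin n)) : ℂ :=
  ((‖z.1 - z.2‖ ^ (((n : ℝ) - 1 + 2 * α) / 2))⁻¹ : ℝ) * (f z.1 - f z.2)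

/-- The function `f` belongs to `H^α(∂Ω)`: it is square integrable on `∂Ω` and
`∫_{∂Ω} ∫_{∂Ω} |f P - f Q|² / |P - Q| ^ (n - 1 + 2α) dP dQ < ∞`. -/
def MemBoundarySobolev {n : ℕ} (Ω : Set (EuclideanSpace ℝ (Fin n))) (α : ℝ)
    (f : EuclideanSpace ℝ (Fin n) → ℂ) : Prop :=
  MemLp f 2 (surfaceMeasure Ω) ∧
    MemLp (weightedDiff α f) 2 ((surfaceMeasure Ω).prod (surfaceMeasure Ω))

theorem weightedDiff_add {n : ℕ} (α : ℝ) (f g : EuclideanSpace ℝ (Fin n) → ℂ) :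
    weightedDiff α (f + g) = weightedDiff α f + weightedDiff α g := by
  funext z
  simp only [weightedDiff, Pi.add_apply]
  ring

theorem weightedDiff_smul {n : ℕ} (α : ℝ) (a : ℂ) (f : EuclideanSpace ℝ (Fin n) → ℂ) :
    weightedDiff α (a • f) = a • weightedDiff α f := by
  funext z
  simp only [weightedDiff, Pi.smul_apply, smul_eq_mul]
  ring

theorem weightedDiff_congr_ae {n : ℕ} (α : ℝ) {μ : Measure (EuclideanSpace ℝ (Fin n))}
    {f g : EuclideanSpace ℝ (Fin n) → ℂ} (h : f =ᵐ[μ] g) :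
    weightedDiff α f =ᵐ[μ.prod μ] weightedDiff α g := by
  have h1 := (Measure.quasiMeasurePreserving_fst (μ := μ) (ν := μ)).ae h
  have h2 := (Measure.quasiMeasurePreserving_snd (μ := μ) (ν := μ)).ae h
  filter_upwards [h1, h2] with z hz1 hz2
  simp only [weightedDiff, hz1, hz2]

/-- `MemBoundarySobolev` is exactly the finiteness of the two integrals in the usual definition. -/
theorem memBoundarySobolev_iff {n : ℕ} (Ω : Set (EuclideanSpace ℝ (Fin n))) (α : ℝ)
    (f : EuclideanSpace ℝ (Fin n) → ℂ) :
    MemBoundarySobolev Ω α f ↔ MemLp f 2 (surfaceMeasure Ω) ∧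
      ∫⁻ z, ENNReal.ofReal (‖f z.1 - f z.2‖ ^ 2 / ‖z.1 - z.2‖ ^ ((n : ℝ) - 1 + 2 * α))
        ∂((surfaceMeasure Ω).prod (surfaceMeasure Ω)) < ∞ := by
  refine and_congr_right fun hf => ?_
  have hm : AEStronglyMeasurable (weightedDiff α f)
      ((surfaceMeasure Ω).prod (surfaceMeasure Ω)) := by
    have h1 := hf.1.comp_quasiMeasurePreserving
      (Measure.quasiMeasurePreserving_fst (μ := surfaceMeasure Ω) (ν := surfaceMeasure Ω))
    have h2 := hf.1.comp_quasiMeasurePreserving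
      (Measure.quasiMeasurePreserving_snd (μ := surfaceMeasure Ω) (ν := surfaceMeasure Ω))
    refine AEStronglyMeasurable.mul (Measurable.aestronglyMeasurable ?_) (h1.sub h2)
    fun_prop
  have hE : ∀ z : EuclideanSpace ℝ (Fin n) × EuclideanSpace ℝ (Fin n),
      ‖weightedDiff α f z‖ₑ ^ (2 : ℝ) =
      ENNReal.ofReal (‖f z.1 - f z.2‖ ^ 2 / ‖z.1 - z.2‖ ^ ((n : ℝ) - 1 + 2 * α)) := by
    intro z
    have h0 : 0 ≤ ‖z.1 - z.2‖ := norm_nonneg _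
    have hp : (‖z.1 - z.2‖ ^ (((n : ℝ) - 1 + 2 * α) / 2)) ^ 2
        = ‖z.1 - z.2‖ ^ ((n : ℝ) - 1 + 2 * α) := by
      rw [← Real.rpow_natCast, ← Real.rpow_mul h0]
      congr 1
      push_cast
      ring
    rw [← ofReal_norm, ENNReal.ofReal_rpow_of_nonneg (norm_nonneg _) (by norm_num)]
    congr 1
    rw [weightedDiff, norm_mul, Complex.norm_real, Real.norm_eq_abs,
      abs_of_nonneg (inv_nonneg.2 (Real.rpow_nonneg h0 _)), Real.rpow_two, mul_pow, inv_pow, hp]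
    ring
  rw [MemLp, and_iff_right hm, eLpNorm_lt_top_iff_lintegral_rpow_enorm_lt_top (by norm_num)
    (by norm_num)]
  simp [← hE]

/-- `H^α(∂Ω)` as a linear subspace of `L²(∂Ω)`. -/
def boundarySobolevSubmodule {n : ℕ} (Ω : Set (EuclideanSpace ℝ (Fin n))) (α : ℝ) :
    Submodule ℂ (Lp ℂ 2 (surfaceMeasure Ω)) where
  carrier := {f | MemLp (weightedDiff α f) 2 ((surfaceMeasure Ω).prod (surfaceMeasure Ω))}
  zero_mem' := by
    have h := weightedDiff_congr_ae α (Lp.coeFn_zero ℂ 2 (surfaceMeasure Ω))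
    refine (memLp_congr_ae h).2 ?_
    have h0 : weightedDiff α (0 : EuclideanSpace ℝ (Fin n) → ℂ) = 0 := by
      funext z
      simp [weightedDiff]
    rw [h0]
    exact MemLp.zero
  add_mem' := by
    intro f g hf hg
    refine (memLp_congr_ae (weightedDiff_congr_ae α (Lp.coeFn_add f g))).2 ?_
    rw [weightedDiff_add]
    exact hf.add hg
  smul_mem' := by
    intro a f hf
    refine (memLp_congr_ae (weightedDiff_congr_ae α (Lp.coeFn_smul a f))).2 ?_
    rw [weightedDiff_smul]
    exact hf.const_smul a

/-- The Sobolev space `H^α(∂Ω)`, as a type of its own: it carries the Sobolev norm and not the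
norm of `L²(∂Ω)`. -/
def BoundarySobolev {n : ℕ} (Ω : Set (EuclideanSpace ℝ (Fin n))) (α : ℝ) : Type :=
  ↥(boundarySobolevSubmodule Ω α)

instance instAddCommGroupBoundarySobolev {n : ℕ} (Ω : Set (EuclideanSpace ℝ (Fin n))) (α : ℝ) :
    AddCommGroup (BoundarySobolev Ω α) :=
  inferInstanceAs (AddCommGroup ↥(boundarySobolevSubmodule Ω α))

instance instModuleBoundarySobolev {n : ℕ} (Ω : Set (EuclideanSpace ℝ (Fin n))) (α : ℝ) :
    Module ℂ (BoundarySobolev Ω α) :=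
  inferInstanceAs (Module ℂ ↥(boundarySobolevSubmodule Ω α))

/-- The inclusion of `H^α(∂Ω)` into `L²(∂Ω)`. -/
def BoundarySobolev.toL2 {n : ℕ} (Ω : Set (EuclideanSpace ℝ (Fin n))) (α : ℝ) :
    BoundarySobolev Ω α →ₗ[ℂ] Lp ℂ 2 (surfaceMeasure Ω) :=
  (boundarySobolevSubmodule Ω α).subtype

theorem BoundarySobolev.memLp_weightedDiff {n : ℕ} {Ω : Set (EuclideanSpace ℝ (Fin n))} {α : ℝ}
    (f : BoundarySobolev Ω α) :
    MemLp (weightedDiff α (BoundarySobolev.toL2 Ω α f)) 2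
      ((surfaceMeasure Ω).prod (surfaceMeasure Ω)) :=
  f.2

/-- The map `f ↦ (f, weightedDiff α f)` from `H^α(∂Ω)` into the Hilbert sum of `L²(∂Ω)` and
`L²(∂Ω × ∂Ω)`. -/
def BoundarySobolev.embed {n : ℕ} (Ω : Set (EuclideanSpace ℝ (Fin n))) (α : ℝ) :
    BoundarySobolev Ω α →ₗ[ℂ] WithLp 2 (Lp ℂ 2 (surfaceMeasure Ω) ×
      Lp ℂ 2 ((surfaceMeasure Ω).prod (surfaceMeasure Ω))) where
  toFun f := WithLp.toLp 2 (BoundarySobolev.toL2 Ω α f, f.memLp_weightedDiff.toLp _)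
  map_add' f g := by
    have h : (f + g).memLp_weightedDiff.toLp _
        = f.memLp_weightedDiff.toLp _ + g.memLp_weightedDiff.toLp _ := by
      rw [← MemLp.toLp_add, MemLp.toLp_eq_toLp_iff, ← weightedDiff_add, map_add]
      exact weightedDiff_congr_ae α (Lp.coeFn_add _ _)
    rw [h, map_add]
    rfl
  map_smul' a f := by
    have h : (a • f).memLp_weightedDiff.toLp _ = a • f.memLp_weightedDiff.toLp _ := by
      rw [← MemLp.toLp_const_smul, MemLp.toLp_eq_toLp_iff, ← weightedDiff_smul, map_smul]
      exact weightedDiff_congr_ae α (Lp.coeFn_smul _ _)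
    rw [h, map_smul]
    rfl

theorem BoundarySobolev.embed_injective {n : ℕ} (Ω : Set (EuclideanSpace ℝ (Fin n))) (α : ℝ) :
    Function.Injective (BoundarySobolev.embed Ω α) := by
  intro f g h
  have h1 : (BoundarySobolev.embed Ω α f).fst = (BoundarySobolev.embed Ω α g).fst := by rw [h]
  exact Subtype.ext h1

/-- The norm of `H^α(∂Ω)`, see `BoundarySobolev.norm_sq_eq`. -/
instance instNormedAddCommGroupBoundarySobolev {n : ℕ} (Ω : Set (EuclideanSpace ℝ (Fin n)))
    (α : ℝ) : NormedAddCommGroup (BoundarySobolev Ω α) :=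
  NormedAddCommGroup.induced _ _ (BoundarySobolev.embed Ω α)
    (BoundarySobolev.embed_injective Ω α)

instance instNormedSpaceBoundarySobolev {n : ℕ} (Ω : Set (EuclideanSpace ℝ (Fin n))) (α : ℝ) :
    NormedSpace ℂ (BoundarySobolev Ω α) :=
  NormedSpace.induced ℂ _ _ (BoundarySobolev.embed Ω α)

/-- The square of the norm of `H^α(∂Ω)` is the sum of the square of the norm of `L²(∂Ω)` and of
the integral of `|f P - f Q|² / |P - Q| ^ (n - 1 + 2α)` over `∂Ω × ∂Ω`. -/
theorem BoundarySobolev.norm_sq_eq {n : ℕ} {Ω : Set (EuclideanSpace ℝ (Fin n))} {α : ℝ}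
    (f : BoundarySobolev Ω α) :
    ‖f‖ ^ 2 = ‖BoundarySobolev.toL2 Ω α f‖ ^ 2 +
      ‖f.memLp_weightedDiff.toLp (weightedDiff α (BoundarySobolev.toL2 Ω α f))‖ ^ 2 := by
  have h : ‖f‖ = ‖BoundarySobolev.embed Ω α f‖ := rfl
  rw [h, WithLp.prod_norm_sq_eq_of_L2]
  rfl

/-- The element of `H^α(∂Ω)` given by a function. -/
def BoundarySobolev.mk {n : ℕ} {Ω : Set (EuclideanSpace ℝ (Fin n))} {α : ℝ}
    {f : EuclideanSpace ℝ (Fin n) → ℂ} (hf : MemBoundarySobolev Ω α f) : BoundarySobolev Ω α :=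
  ⟨hf.1.toLp f, (memLp_congr_ae (weightedDiff_congr_ae α hf.1.coeFn_toLp)).2 hf.2⟩

/-- `H^{-α}(∂Ω)`, the dual space of `H^α(∂Ω)`, with the dual norm. -/
abbrev BoundarySobolevDual {n : ℕ} (Ω : Set (EuclideanSpace ℝ (Fin n))) (α : ℝ) : Type :=
  StrongDual ℂ (BoundarySobolev Ω α)

/-- The constant `c(n, β)` of the Riesz kernel of order `β`, for which the Fourier transform of
`c(n, β) |x| ^ (β - n)` is `|ξ| ^ (-β)` (with the convention
`f̂ ξ = ∫ f x exp (-2πi ⟪x, ξ⟫) dx`). -/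
def rieszConstant (n : ℕ) (β : ℝ) : ℝ :=
  Real.pi ^ (β - n / 2) * Real.Gamma ((n - β) / 2) / Real.Gamma (β / 2)

/-- The Riesz kernel of order `β`. -/
def rieszKernel {n : ℕ} (β : ℝ) (x : EuclideanSpace ℝ (Fin n)) : ℝ :=
  rieszConstant n β * (1 / ‖x‖ ^ ((n : ℝ) - β))

open Classical in
/-- The layer potential `𝒮_s φ (x) = ⟨φ, Γ_{2s}(x - ·)⟩` of `φ ∈ H^{-α}(∂Ω)`. It is meant for
`x ∉ ∂Ω`, where `Γ_{2s}(x - ·)` lies in `H^α(∂Ω)`. -/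
def layerPotential {n : ℕ} {Ω : Set (EuclideanSpace ℝ (Fin n))} (s : ℝ) {α : ℝ}
    (φ : BoundarySobolevDual Ω α) (x : EuclideanSpace ℝ (Fin n)) : ℂ :=
  if h : MemBoundarySobolev Ω α (fun Q => (rieszKernel (2 * s) (x - Q) : ℂ)) then
    φ (BoundarySobolev.mk h) else 0

/-- The function `v` is in the homogeneous Sobolev space `Ḣ^s(ℝⁿ)`: it is locally square
integrable, it is (as a distribution) a tempered distribution `T`, and the Fourier transform of
`T` is a locally integrable function `g` with `∫ |ξ|^{2s} |g ξ|² dξ < ∞`. -/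
def MemHomogeneousSobolev {n : ℕ} (s : ℝ) (v : EuclideanSpace ℝ (Fin n) → ℂ) : Prop :=
  (∀ K : Set (EuclideanSpace ℝ (Fin n)), IsCompact K → MemLp v 2 (volume.restrict K)) ∧
  ∃ T : 𝓢'(EuclideanSpace ℝ (Fin n), ℂ),
    (∀ ψ : 𝓢(EuclideanSpace ℝ (Fin n), ℂ), HasCompactSupport ψ → T ψ = ∫ x, ψ x * v x) ∧
    ∃ g : EuclideanSpace ℝ (Fin n) → ℂ, LocallyIntegrable g volume ∧
      (∀ ψ : 𝓢(EuclideanSpace ℝ (Fin n), ℂ), HasCompactSupport ψ →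
        (𝓕 T) ψ = ∫ ξ, ψ ξ * g ξ) ∧
      ∫⁻ ξ, ENNReal.ofReal (‖ξ‖ ^ (2 * s) * ‖g ξ‖ ^ 2) < ∞

/-- The Gagliardo double integral `∫ ∫ |v x - v y|² / |x - y| ^ (n + 2s) dy dx` over `ℝⁿ × ℝⁿ`. -/
def gagliardoIntegral {n : ℕ} (s : ℝ) (v : EuclideanSpace ℝ (Fin n) → ℂ) : ℝ≥0∞ :=
  ∫⁻ x, ∫⁻ y, ENNReal.ofReal (‖v x - v y‖ ^ 2 / ‖x - y‖ ^ ((n : ℝ) + 2 * s))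

end

/-!
Write `α = s - 1/2`, `m = n - s` and `k z = |z| ^ (-m)`, the kernel of the Riesz potential of order
`s`. The proof factors the layer potential through `L²(ℝⁿ)`: every functional `φ` on `H^α(∂Ω)` has a
density `f ∈ L²(ℝⁿ)`, with `‖f‖ ≤ C ‖φ‖`, such that `𝒮_s φ` is a constant multiple of `k * f` almost
everywhere. Both assertions about `𝒮_s φ` are then facts about the Riesz potential of a square
integrable function. That `Γ_{2s}(x - ·)` lies in `H^α(∂Ω)` for `x ∉ ∂Ω` holds because it is bounded
and Lipschitz on `∂Ω` (`IsBoundedLipschitzDomain.memBoundarySobolev_kernel`).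

*Density.* The trace estimate says that `h ↦ (k * h)|_∂Ω` is bounded from `L²(ℝⁿ)` to `H^α(∂Ω)`; its
transpose takes `φ` to `f` (`IsBoundedLipschitzDomain.exists_density`). Of the geometry of `∂Ω` it
uses only that the surface measure `σ` of a ball of radius `r` is `O(r ^ (n - 1))`
(`IsBoundedLipschitzDomain.upperRegular`). The `L²(∂Ω)` part of the norm is bounded by
Cauchy--Schwarz (`UpperRegular.lintegral_riesz_sq_le`). For the seminorm
(`UpperRegular.trace_seminorm_le`) the difference `k (P - x) - k (Q - x)` is bounded by the sizes of
its terms when `x` is close to the poles, and by the mean value theorem otherwise; each piece is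
handled by a Schur test (`lintegral_sq_le_of_weight`) whose weight is a potential of `σ` itself.

*Evaluation.* By scaling and rotation, `k * k` is a multiple of `|z| ^ (2 s - n)`, that is, of the
kernel of `𝒮_s` (`exists_lintegral_rpow_mul_rpow_eq`). So, up to a constant, `Γ_{2s}(x - ·)` is the
trace of the Riesz potential of `k (x - ·)`, and pairing it with `φ` formally gives `(k * f) x`.
Since `k (x - ·)` is not square integrable near `x`, it is first truncated there; the error tends to
`0` in `H^α(∂Ω)` because `x` is at a positive distance from `∂Ω`
(`IsBoundedLipschitzDomain.apply_mk_eq_of_tendsto_truncated`,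
`IsBoundedLipschitzDomain.exists_layerPotential_ae_eq`).

*Energy.* On the Fourier side `k * ·` is multiplication by `c |ξ| ^ (-s)`: for Schwartz functions by
writing both powers as superpositions of Gaussians (`exists_rieszPotential_schwartz_eq`), and for
square integrable functions by density (`exists_integral_rieszPotential_mul_eq`). This gives
membership in the homogeneous Sobolev space (`memHomogeneousSobolev_rieszPotential`). It also turns
the Gagliardo integral, through Plancherel's theorem for the differences `w (· + h) - w`, into the
integral of `|exp (2πi ⟪ξ, h⟫) - 1| ^ 2 |h| ^ (-n - 2s)`, which is at most `C |ξ| ^ (2s)` after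
integration in `h` (`exists_gagliardoIntegral_rieszPotential_le`).

Estimates are made in `[0, ∞]` with the powers `‖z‖ₑ ^ (-b)`, which are `∞` at `z = 0`; the real
powers `‖z‖ ^ (-b)` in the definitions are `0` there, so that passing from the real powers to the
extended ones costs an inequality at most.
-/

/-! ### Upper regular measures and integrals of radial powers -/

/-- Upper Ahlfors regularity of dimension `d`: balls of radius `r` have measure `O(r ^ d)`,
uniformly in the centre and for all radii. -/
def UpperRegular {E : Type*} [NormedAddCommGroup E] [MeasurableSpace E] (μ : Measure E)
    (d : ℝ) : Prop :=
  ∃ C : ℝ≥0, ∀ (x : E) (r : ℝ), 0 < r →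
    μ (Metric.closedBall x r) ≤ C * ENNReal.ofReal (r ^ d)

theorem ennreal_rpow_neg_anti {x y : ℝ≥0∞} {b : ℝ} (hb : 0 ≤ b) (h : x ≤ y) :
    y ^ (-b) ≤ x ^ (-b) := by
  rw [ENNReal.rpow_neg, ENNReal.rpow_neg]
  exact ENNReal.inv_le_inv.2 (ENNReal.rpow_le_rpow h hb)

section Radial

variable {E : Type*} [NormedAddCommGroup E] [MeasurableSpace E] [BorelSpace E] {μ : Measure E}
  {d b : ℝ}

omit [MeasurableSpace E] [BorelSpace E] in
theorem enorm_rpow_eq_ofReal {x : E} (hx : x ≠ 0) (b : ℝ) :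
    ‖x‖ₑ ^ b = ENNReal.ofReal (‖x‖ ^ b) := by
  rw [← ofReal_norm, ENNReal.ofReal_rpow_of_pos (norm_pos_iff.2 hx)]

omit [MeasurableSpace E] [BorelSpace E] in
theorem enorm_rpow_neg_le {x : E} {t : ℝ} (ht : 0 < t) (hx : t ≤ ‖x‖) (hb : 0 ≤ b) :
    ‖x‖ₑ ^ (-b) ≤ ENNReal.ofReal (t ^ (-b)) := by
  have hx0 : x ≠ 0 := norm_pos_iff.1 (ht.trans_le hx)
  rw [enorm_rpow_eq_ofReal hx0]
  exact ENNReal.ofReal_le_ofReal (Real.rpow_le_rpow_of_nonpos ht hx (by linarith))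

/-- The integral over one dyadic annulus: the integrand is of size `t ^ (-b)`, the annulus of
measure `O(t ^ d)`. -/
theorem lintegral_annulus_le {C : ℝ≥0} (hC : ∀ (x : E) (r : ℝ), 0 < r →
      μ (Metric.closedBall x r) ≤ C * ENNReal.ofReal (r ^ d)) (hb : 0 ≤ b) (x : E) {t : ℝ}
    (ht : 0 < t) :
    ∫⁻ y in Metric.closedBall x (2 * t) \ Metric.ball x t, ‖x - y‖ₑ ^ (-b) ∂μ ≤
      C * ENNReal.ofReal (2 ^ d * t ^ (d - b)) := by
  calc _ ≤ ∫⁻ _ in Metric.closedBall x (2 * t) \ Metric.ball x t,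
        ENNReal.ofReal (t ^ (-b)) ∂μ := by
        refine setLIntegral_mono' (Metric.isClosed_closedBall.measurableSet.diff
          Metric.isOpen_ball.measurableSet) fun y hy => ?_
        refine enorm_rpow_neg_le ht ?_ hb
        have := hy.2
        rwa [Metric.mem_ball, not_lt, dist_comm, dist_eq_norm] at this
    _ = ENNReal.ofReal (t ^ (-b)) * μ (Metric.closedBall x (2 * t) \ Metric.ball x t) := by
        simp
    _ ≤ ENNReal.ofReal (t ^ (-b)) * (C * ENNReal.ofReal ((2 * t) ^ d)) := by
        gcongr
        exact (measure_mono Set.sdiff_subset).trans (hC x _ (by positivity))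
    _ = C * ENNReal.ofReal (2 ^ d * t ^ (d - b)) := by
        rw [mul_left_comm, ← ENNReal.ofReal_mul (by positivity), Real.mul_rpow (by norm_num) ht.le,
          sub_eq_add_neg, Real.rpow_add ht]
        congr 2
        ring

/-- Summation of the bounds for the annuli of radii `r * u ^ k`, a geometric series. -/
theorem tsum_dyadic_le {C : ℝ≥0} {u e : ℝ} (hu : 0 < u) (hue : u ^ e < 1) :
    ∃ K : ℝ≥0, ∀ r : ℝ, 0 < r →
      ∑' k : ℕ, C * ENNReal.ofReal (2 ^ d * (r * u ^ k) ^ e) ≤ K * ENNReal.ofReal (r ^ e) := by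
  refine ⟨C * (2 ^ d * (1 - u ^ e)⁻¹ : ℝ).toNNReal, fun r hr => le_of_eq ?_⟩
  have h0 : 0 ≤ u ^ e := Real.rpow_nonneg hu.le _
  have h1 : ∀ k : ℕ, (C : ℝ≥0∞) * ENNReal.ofReal (2 ^ d * (r * u ^ k) ^ e) =
      C * ENNReal.ofReal (2 ^ d * r ^ e) * ENNReal.ofReal ((u ^ e) ^ k) := by
    intro k
    rw [mul_assoc, ← ENNReal.ofReal_mul (by positivity), Real.mul_rpow hr.le (by positivity),
      ← Real.rpow_natCast, ← Real.rpow_natCast, ← Real.rpow_mul hu.le, ← Real.rpow_mul hu.le,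
      mul_comm e, mul_assoc]
  simp_rw [h1]
  rw [ENNReal.tsum_mul_left, ← ENNReal.ofReal_tsum_of_nonneg (fun k => by positivity)
    (summable_geometric_of_lt_one h0 hue), tsum_geometric_of_lt_one h0 hue, ENNReal.coe_mul,
    mul_assoc, mul_assoc, ← ENNReal.ofReal_mul (by positivity)]
  congr 1
  rw [show ((2 ^ d * (1 - u ^ e)⁻¹ : ℝ).toNNReal : ℝ≥0∞) = ENNReal.ofReal (2 ^ d * (1 - u ^ e)⁻¹)
    from rfl, ← ENNReal.ofReal_mul (mul_nonneg (by positivity)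
    (inv_nonneg.2 (by linarith)))]
  congr 1
  ring

omit [BorelSpace E] in
theorem UpperRegular.measure_singleton (h : UpperRegular μ d) (hd : 0 < d) (x : E) :
    μ {x} = 0 := by
  obtain ⟨C, hC⟩ := h
  have hlim : Filter.Tendsto (fun r : ℝ => (C : ℝ≥0∞) * ENNReal.ofReal (r ^ d))
      (nhdsWithin 0 (Set.Ioi 0)) (nhds 0) := by
    have h1 : Filter.Tendsto (fun r : ℝ => r ^ d) (nhdsWithin 0 (Set.Ioi 0)) (nhds 0) := by
      have := (Real.continuousAt_rpow_const 0 d (Or.inr hd.le)).tendsto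
      rw [Real.zero_rpow hd.ne'] at this
      exact this.mono_left nhdsWithin_le_nhds
    have h2 := ENNReal.Tendsto.const_mul (a := (C : ℝ≥0∞)) (ENNReal.tendsto_ofReal h1)
      (Or.inr ENNReal.coe_ne_top)
    simpa using h2
  refine le_antisymm (ge_of_tendsto hlim ?_) zero_le
  filter_upwards [self_mem_nhdsWithin] with r hr
  refine (measure_mono ?_).trans (hC x r hr)
  simpa using le_of_lt hr

/-- Negative powers `|x - y| ^ (-b)` with `b < d` are integrable near their singularity, with the
bound that scaling predicts. -/
theorem UpperRegular.lintegral_near (h : UpperRegular μ d) (hb : 0 ≤ b) (hbd : b < d) :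
    ∃ K : ℝ≥0, ∀ (x : E) (r : ℝ), 0 < r →
      ∫⁻ y in Metric.closedBall x r, ‖x - y‖ₑ ^ (-b) ∂μ ≤ K * ENNReal.ofReal (r ^ (d - b)) := by
  have hsing := h.measure_singleton (hb.trans_lt hbd)
  obtain ⟨C, hC⟩ := h
  obtain ⟨K, hK⟩ := tsum_dyadic_le (C := C) (d := d) (u := 1 / 2) (e := d - b) (by norm_num)
    (Real.rpow_lt_one (by norm_num) (by norm_num) (by linarith))
  refine ⟨K * ((1 / 2 : ℝ) ^ (d - b)).toNNReal, fun x r hr => ?_⟩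
  -- Dyadic annuli shrinking to `x`; the centre, where the integrand is `∞`, is a null set.
  have hsub : Metric.closedBall x r ⊆ {x} ∪ ⋃ k : ℕ,
      (Metric.closedBall x (2 * (r / 2 * (1 / 2) ^ k)) \
        Metric.ball x (r / 2 * (1 / 2) ^ k)) := by
    intro y hy
    by_cases hxy : y = x
    · exact Or.inl hxy
    right
    have h0 : 0 < dist y x / r := div_pos (dist_pos.2 hxy) hr
    have h1 : dist y x / r ≤ 1 := (div_le_one hr).2 hy
    obtain ⟨k, hk1, hk2⟩ := exists_nat_pow_near_of_lt_one h0 h1 (y := (1 / 2 : ℝ)) (by norm_num)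
      (by norm_num)
    rw [lt_div_iff₀ hr] at hk1
    rw [div_le_iff₀ hr] at hk2
    refine Set.mem_iUnion.2 ⟨k, ?_, ?_⟩
    · rw [Metric.mem_closedBall]
      linarith
    · rw [Metric.mem_ball, not_lt]
      rw [pow_succ] at hk1
      linarith
  calc _ ≤ ∫⁻ y in {x} ∪ ⋃ k : ℕ, (Metric.closedBall x (2 * (r / 2 * (1 / 2) ^ k)) \
        Metric.ball x (r / 2 * (1 / 2) ^ k)), ‖x - y‖ₑ ^ (-b) ∂μ :=
        lintegral_mono_set hsub
    _ ≤ 0 + ∑' k : ℕ, ∫⁻ y in (Metric.closedBall x (2 * (r / 2 * (1 / 2) ^ k)) \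
        Metric.ball x (r / 2 * (1 / 2) ^ k)), ‖x - y‖ₑ ^ (-b) ∂μ := by
        refine (lintegral_union_le _ _ _).trans (add_le_add ?_ (lintegral_iUnion_le _ _))
        rw [Measure.restrict_eq_zero.2 (hsing x)]
        simp
    _ ≤ ∑' k : ℕ, C * ENNReal.ofReal (2 ^ d * (r / 2 * (1 / 2) ^ k) ^ (d - b)) := by
        rw [zero_add]
        exact ENNReal.tsum_le_tsum fun k => lintegral_annulus_le hC hb x (by positivity)
    _ ≤ K * ENNReal.ofReal ((r / 2) ^ (d - b)) := hK _ (by positivity)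
    _ = _ := by
        rw [ENNReal.coe_mul, mul_assoc, show (((1 / 2 : ℝ) ^ (d - b)).toNNReal : ℝ≥0∞) =
          ENNReal.ofReal ((1 / 2 : ℝ) ^ (d - b)) from rfl, ← ENNReal.ofReal_mul (by positivity),
          ← Real.mul_rpow (by norm_num) hr.le]
        congr 3
        ring

/-- Negative powers `|x - y| ^ (-b)` with `b > d` are integrable at infinity, with the
bound that scaling predicts. -/
theorem UpperRegular.lintegral_far (h : UpperRegular μ d) (hb : 0 ≤ b) (hbd : d < b) :
    ∃ K : ℝ≥0, ∀ (x : E) (r : ℝ), 0 < r →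
      ∫⁻ y in (Metric.closedBall x r)ᶜ, ‖x - y‖ₑ ^ (-b) ∂μ ≤
        K * ENNReal.ofReal (r ^ (d - b)) := by
  obtain ⟨C, hC⟩ := h
  obtain ⟨K, hK⟩ := tsum_dyadic_le (C := C) (d := d) (u := 2) (e := d - b) (by norm_num)
    (Real.rpow_lt_one_of_one_lt_of_neg (by norm_num) (by linarith))
  refine ⟨K, fun x r hr => ?_⟩
  have hsub : (Metric.closedBall x r)ᶜ ⊆ ⋃ k : ℕ,
      (Metric.closedBall x (2 * (r * 2 ^ k)) \ Metric.ball x (r * 2 ^ k)) := by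
    intro y hy
    rw [Set.mem_compl_iff, Metric.mem_closedBall, not_le] at hy
    obtain ⟨k, hk1, hk2⟩ := exists_nat_pow_near (x := dist y x / r) (y := 2)
      ((one_le_div hr).2 hy.le) (by norm_num)
    rw [le_div_iff₀ hr] at hk1
    rw [div_lt_iff₀ hr] at hk2
    refine Set.mem_iUnion.2 ⟨k, ?_, ?_⟩
    · rw [Metric.mem_closedBall]
      rw [pow_succ] at hk2
      linarith
    · rw [Metric.mem_ball, not_lt]
      linarith
  calc _ ≤ ∫⁻ y in ⋃ k : ℕ, (Metric.closedBall x (2 * (r * 2 ^ k)) \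
        Metric.ball x (r * 2 ^ k)), ‖x - y‖ₑ ^ (-b) ∂μ := lintegral_mono_set hsub
    _ ≤ ∑' k : ℕ, ∫⁻ y in (Metric.closedBall x (2 * (r * 2 ^ k)) \
        Metric.ball x (r * 2 ^ k)), ‖x - y‖ₑ ^ (-b) ∂μ := lintegral_iUnion_le _ _
    _ ≤ ∑' k : ℕ, C * ENNReal.ofReal (2 ^ d * (r * 2 ^ k) ^ (d - b)) :=
        ENNReal.tsum_le_tsum fun k => lintegral_annulus_le hC hb x
          (mul_pos hr (pow_pos two_pos k))
    _ ≤ _ := hK _ hr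

end Radial

/-! ### Composition of Riesz kernels -/

section RieszComposition

variable {E : Type*} [NormedAddCommGroup E] [InnerProductSpace ℝ E] [FiniteDimensional ℝ E]
  [MeasurableSpace E] [BorelSpace E] {a b : ℝ}

theorem upperRegular_volume : UpperRegular (volume : Measure E) (Module.finrank ℝ E) := by
  refine ⟨(volume (Metric.ball (0 : E) 1)).toNNReal, fun x r hr => le_of_eq ?_⟩
  rw [Measure.addHaar_closedBall _ _ hr.le, ENNReal.coe_toNNReal measure_ball_lt_top.ne, mul_comm,
    Real.rpow_natCast]

/-- Change of variables under a dilation. -/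
theorem lintegral_comp_smul (f : E → ℝ≥0∞) {t : ℝ} (ht : 0 < t) :
    ∫⁻ z, f z = ENNReal.ofReal (t ^ Module.finrank ℝ E) * ∫⁻ z, f (t • z) := by
  have h := lintegral_map_equiv (μ := (volume : Measure E)) f
    (Homeomorph.smulOfNeZero t ht.ne').toMeasurableEquiv
  have h2 : Measure.map (Homeomorph.smulOfNeZero t ht.ne').toMeasurableEquiv (volume : Measure E) =
    ENNReal.ofReal |(t ^ Module.finrank ℝ E)⁻¹| • volume :=
    Measure.map_addHaar_smul volume ht.ne'
  rw [h2, lintegral_smul_measure] at h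
  change _ = ∫⁻ z, f (t • z) at h
  rw [← h, smul_eq_mul, ← mul_assoc, ← ENNReal.ofReal_mul (by positivity),
    abs_of_pos (by positivity), mul_inv_cancel₀ (by positivity)]
  simp

theorem lintegral_rpow_mul_rpow_lt_top (ha : 0 < a) (ha' : a < Module.finrank ℝ E) (hb : 0 < b)
    (hb' : b < Module.finrank ℝ E) (hab : Module.finrank ℝ E < a + b) {v : E} (hv : v ≠ 0) :
    ∫⁻ z, ‖v - z‖ₑ ^ (-a) * ‖z‖ₑ ^ (-b) < ∞ := by
  have hv0 : 0 < ‖v‖ / 2 := by positivity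
  obtain ⟨K₁, hK₁⟩ := (upperRegular_volume (E := E)).lintegral_near ha.le ha'
  obtain ⟨K₂, hK₂⟩ := (upperRegular_volume (E := E)).lintegral_near hb.le hb'
  obtain ⟨K₃, hK₃⟩ := (upperRegular_volume (E := E)).lintegral_far (add_pos ha hb).le hab
  have hz : ∀ z : E, ‖(0 : E) - z‖ₑ = ‖z‖ₑ := fun z => by rw [zero_sub, enorm_neg]
  have h1 : ∫⁻ z in Metric.closedBall v (‖v‖ / 2), ‖v - z‖ₑ ^ (-a) * ‖z‖ₑ ^ (-b) < ∞ := by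
    refine lt_of_le_of_lt (b := ∫⁻ z in Metric.closedBall v (‖v‖ / 2),
      ‖v - z‖ₑ ^ (-a) * ENNReal.ofReal ((‖v‖ / 2) ^ (-b))) ?_ ?_
    · refine setLIntegral_mono' Metric.isClosed_closedBall.measurableSet fun z hz => ?_
      gcongr
      refine enorm_rpow_neg_le hv0 ?_ hb.le
      rw [Metric.mem_closedBall, dist_comm, dist_eq_norm] at hz
      have := norm_sub_norm_le v (v - z)
      rw [sub_sub_cancel] at this
      linarith
    · rw [lintegral_mul_const' _ _ ENNReal.ofReal_ne_top]
      exact ENNReal.mul_lt_top ((hK₁ v _ hv0).trans_lt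
        (ENNReal.mul_lt_top ENNReal.coe_lt_top ENNReal.ofReal_lt_top)) ENNReal.ofReal_lt_top
  have h2 : ∫⁻ z in Metric.closedBall 0 (‖v‖ / 2), ‖v - z‖ₑ ^ (-a) * ‖z‖ₑ ^ (-b) < ∞ := by
    refine lt_of_le_of_lt (b := ∫⁻ z in Metric.closedBall (0 : E) (‖v‖ / 2),
      ENNReal.ofReal ((‖v‖ / 2) ^ (-a)) * ‖(0 : E) - z‖ₑ ^ (-b)) ?_ ?_
    · refine setLIntegral_mono' Metric.isClosed_closedBall.measurableSet fun z hz' => ?_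
      rw [hz]
      gcongr
      refine enorm_rpow_neg_le hv0 ?_ ha.le
      rw [mem_closedBall_zero_iff] at hz'
      have := norm_sub_norm_le v z
      linarith
    · rw [lintegral_const_mul' _ _ ENNReal.ofReal_ne_top]
      exact ENNReal.mul_lt_top ENNReal.ofReal_lt_top ((hK₂ 0 _ hv0).trans_lt
        (ENNReal.mul_lt_top ENNReal.coe_lt_top ENNReal.ofReal_lt_top))
  -- Away from both singularities the integrand is dominated by the power `-(a + b)` of the
  -- distance to the nearer one, which is integrable at infinity.
  have h3 : ∫⁻ z in (Metric.closedBall v (‖v‖ / 2) ∪ Metric.closedBall 0 (‖v‖ / 2))ᶜ,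
      ‖v - z‖ₑ ^ (-a) * ‖z‖ₑ ^ (-b) < ∞ := by
    refine lt_of_le_of_lt (b := (∫⁻ z in (Metric.closedBall v (‖v‖ / 2))ᶜ, ‖v - z‖ₑ ^ (-(a + b))) +
      ∫⁻ z in (Metric.closedBall (0 : E) (‖v‖ / 2))ᶜ, ‖(0 : E) - z‖ₑ ^ (-(a + b))) ?_ ?_
    · refine (setLIntegral_mono' (g := fun z => ‖v - z‖ₑ ^ (-(a + b)) + ‖(0 : E) - z‖ₑ ^ (-(a + b)))
        (Metric.isClosed_closedBall.union Metric.isClosed_closedBall).measurableSet.compl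
        fun z hz' => ?_).trans ?_
      · rw [Set.mem_compl_iff, Set.mem_union, not_or, mem_closedBall_zero_iff, not_le,
          Metric.mem_closedBall, not_le, dist_comm, dist_eq_norm] at hz'
        have hz1 : ‖v - z‖ₑ ≠ 0 := enorm_ne_zero.2 (norm_pos_iff.1 (hv0.trans hz'.1))
        have hz2 : ‖z‖ₑ ≠ 0 := enorm_ne_zero.2 (norm_pos_iff.1 (hv0.trans hz'.2))
        rw [hz]
        rcases le_total ‖v - z‖ₑ ‖z‖ₑ with h | h
        · refine le_trans ?_ le_self_add
          rw [neg_add, ENNReal.rpow_add _ _ hz1 enorm_ne_top]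
          refine mul_le_mul_right ?_ _
          exact ennreal_rpow_neg_anti hb.le h
        · refine le_trans ?_ le_add_self
          rw [neg_add, ENNReal.rpow_add _ _ hz2 enorm_ne_top]
          refine mul_le_mul_left ?_ _
          exact ennreal_rpow_neg_anti ha.le h
      · rw [lintegral_add_left (by fun_prop)]
        gcongr
        · exact Set.subset_union_left
        · exact Set.subset_union_right
    · exact ENNReal.add_lt_top.2 ⟨(hK₃ v _ hv0).trans_lt
        (ENNReal.mul_lt_top ENNReal.coe_lt_top ENNReal.ofReal_lt_top), (hK₃ 0 _ hv0).trans_lt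
        (ENNReal.mul_lt_top ENNReal.coe_lt_top ENNReal.ofReal_lt_top)⟩
  rw [← lintegral_add_compl _ (Metric.isClosed_closedBall.union
    Metric.isClosed_closedBall).measurableSet (A := Metric.closedBall v (‖v‖ / 2) ∪
    Metric.closedBall 0 (‖v‖ / 2))]
  exact ENNReal.add_lt_top.2 ⟨(lintegral_union_le _ _ _).trans_lt (ENNReal.add_lt_top.2 ⟨h1, h2⟩),
    h3⟩

/-- The convolution of two Riesz kernels is a multiple of a Riesz kernel. The value of the constant
is irrelevant: the formula follows from invariance under translations, rotations and dilations. -/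
theorem exists_lintegral_rpow_mul_rpow_eq (ha : 0 < a) (ha' : a < Module.finrank ℝ E) (hb : 0 < b)
    (hb' : b < Module.finrank ℝ E) (hab : Module.finrank ℝ E < a + b) :
    ∃ K : ℝ≥0, 0 < K ∧ ∀ x y : E, x ≠ y →
      ∫⁻ z, ‖x - z‖ₑ ^ (-a) * ‖z - y‖ₑ ^ (-b) =
        K * ‖x - y‖ₑ ^ (-(a + b - Module.finrank ℝ E)) := by
  have hnt : Nontrivial E := Module.nontrivial_of_finrank_pos (R := ℝ) (by
    have := ha.trans ha'
    exact_mod_cast this)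
  obtain ⟨e, he⟩ := exists_norm_eq E (c := 1) zero_le_one
  have he0 : e ≠ 0 := norm_pos_iff.1 (by rw [he]; exact one_pos)
  have hfin := lintegral_rpow_mul_rpow_lt_top ha ha' hb hb' hab he0
  refine ⟨(∫⁻ z, ‖e - z‖ₑ ^ (-a) * ‖z‖ₑ ^ (-b)).toNNReal, ?_, fun x y hxy => ?_⟩
  · refine ENNReal.toNNReal_pos (fun h0 => ?_) hfin.ne
    rw [lintegral_eq_zero_iff (by fun_prop)] at h0
    have : ∀ z : E, ‖e - z‖ₑ ^ (-a) * ‖z‖ₑ ^ (-b) ≠ 0 := by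
      intro z
      refine mul_ne_zero ?_ ?_ <;> simp [ENNReal.rpow_eq_zero_iff, ha, hb, ha.le, hb.le, not_lt]
    obtain ⟨z, hz⟩ := h0.exists
    exact this z hz
  rw [ENNReal.coe_toNNReal hfin.ne]
  set t := ‖x - y‖ with ht
  have ht0 : 0 < t := norm_pos_iff.2 (sub_ne_zero.2 hxy)
  have hte : ‖t • e‖ = ‖x - y‖ := by rw [norm_smul, he, mul_one, Real.norm_of_nonneg ht0.le]
  -- A reflection that takes `t • e` to `x - y`, which has the same norm.
  let A := Submodule.reflection (ℝ ∙ (t • e - (x - y)))ᗮ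
  have hA : A (t • e) = x - y := Submodule.reflection_sub hte
  have htE : ‖t‖ₑ ≠ 0 := enorm_ne_zero.2 ht0.ne'
  calc ∫⁻ z, ‖x - z‖ₑ ^ (-a) * ‖z - y‖ₑ ^ (-b)
      = ∫⁻ z, ‖x - (z + y)‖ₑ ^ (-a) * ‖(z + y) - y‖ₑ ^ (-b) :=
        (lintegral_add_right_eq_self (fun z => ‖x - z‖ₑ ^ (-a) * ‖z - y‖ₑ ^ (-b)) y).symm
    _ = ∫⁻ z, ‖(x - y) - z‖ₑ ^ (-a) * ‖z‖ₑ ^ (-b) := by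
        simp_rw [add_sub_cancel_right, sub_add_eq_sub_sub_swap]
    _ = ∫⁻ z, ‖(x - y) - A z‖ₑ ^ (-a) * ‖A z‖ₑ ^ (-b) :=
        (A.measurePreserving.lintegral_comp
          (f := fun z => ‖(x - y) - z‖ₑ ^ (-a) * ‖z‖ₑ ^ (-b)) (by fun_prop)).symm
    _ = ∫⁻ z, ‖t • e - z‖ₑ ^ (-a) * ‖z‖ₑ ^ (-b) := by
        simp_rw [← hA, ← map_sub, LinearIsometryEquiv.enorm_map]
    _ = ENNReal.ofReal (t ^ Module.finrank ℝ E) *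
          ∫⁻ z, ‖t‖ₑ ^ (-a) * ‖t‖ₑ ^ (-b) * (‖e - z‖ₑ ^ (-a) * ‖z‖ₑ ^ (-b)) := by
        rw [lintegral_comp_smul _ ht0]
        congr 2 with z
        rw [← smul_sub, enorm_smul, enorm_smul,
          ENNReal.mul_rpow_of_ne_top enorm_ne_top enorm_ne_top,
          ENNReal.mul_rpow_of_ne_top enorm_ne_top enorm_ne_top]
        ring
    _ = _ := by
        rw [lintegral_const_mul' _ _ (ENNReal.mul_ne_top
          (ENNReal.rpow_ne_top_of_ne_zero htE enorm_ne_top)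
          (ENNReal.rpow_ne_top_of_ne_zero htE enorm_ne_top)), mul_comm _ (‖x - y‖ₑ ^ _),
          ← mul_assoc]
        congr 1
        rw [enorm_rpow_eq_ofReal ht0.ne', enorm_rpow_eq_ofReal ht0.ne',
          enorm_rpow_eq_ofReal (sub_ne_zero.2 hxy), Real.norm_of_nonneg ht0.le,
          ← ENNReal.ofReal_mul (by positivity), ← ENNReal.ofReal_mul (by positivity), ← ht,
          ← Real.rpow_natCast, ← Real.rpow_add ht0, ← Real.rpow_add ht0]
        congr 2
        ring

end RieszComposition

/-! ### Cauchy--Schwarz and Tonelli for integrals with values in `[0, ∞]` -/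

section CauchySchwarz

variable {X Y : Type*} [MeasurableSpace X] [MeasurableSpace Y] {μ : Measure X} {ν : Measure Y}

theorem ennreal_add_sq_le (a b : ℝ≥0∞) : (a + b) ^ 2 ≤ 2 * (a ^ 2 + b ^ 2) := by
  have h := ENNReal.rpow_add_le_mul_rpow_add_rpow a b (p := 2) (by norm_num)
  norm_num at h
  exact h

/-- Negative exponents add up also at `0`, where all the powers are `∞`. -/
theorem ennreal_rpow_neg_mul_rpow_neg {x : ℝ≥0∞} (hx : x ≠ ∞) {a b : ℝ} (ha : 0 < a)
    (hb : 0 < b) : x ^ (-a) * x ^ (-b) = x ^ (-(a + b)) := by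
  rcases eq_or_ne x 0 with rfl | h0
  · rw [ENNReal.zero_rpow_of_neg (by linarith), ENNReal.zero_rpow_of_neg (by linarith),
      ENNReal.zero_rpow_of_neg (by linarith), ENNReal.top_mul_top]
  · rw [neg_add, ENNReal.rpow_add _ _ h0 hx]

/-- The Cauchy--Schwarz inequality, with the factors of the integrand replaced by a bound for its
square. -/
theorem sq_lintegral_le_of_sq_le {N W V : X → ℝ≥0∞} (hW : AEMeasurable W μ)
    (hV : AEMeasurable V μ) (h : ∀ᵐ x ∂μ, N x ^ 2 ≤ W x * V x) :
    (∫⁻ x, N x ∂μ) ^ 2 ≤ (∫⁻ x, W x ∂μ) * ∫⁻ x, V x ∂μ := by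
  have h1 : ∫⁻ x, N x ∂μ ≤ ∫⁻ x, W x ^ (1 / 2 : ℝ) * V x ^ (1 / 2 : ℝ) ∂μ := by
    refine lintegral_mono_ae (h.mono fun x hx => ?_)
    rw [← ENNReal.mul_rpow_of_nonneg _ _ (by norm_num)]
    calc N x = (N x ^ 2) ^ (1 / 2 : ℝ) := by
          rw [← ENNReal.rpow_natCast, ← ENNReal.rpow_mul]
          norm_num
      _ ≤ _ := ENNReal.rpow_le_rpow hx (by norm_num)
  have h2 := ENNReal.lintegral_mul_le_Lp_mul_Lq μ Real.HolderConjugate.two_two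
    (hW.pow_const (1 / 2 : ℝ)) (hV.pow_const (1 / 2 : ℝ))
  have h3 : ∀ y : ℝ≥0∞, (y ^ (1 / 2 : ℝ)) ^ (2 : ℝ) = y := fun y => by
    rw [← ENNReal.rpow_mul]
    norm_num
  simp only [Pi.mul_apply, h3] at h2
  calc _ ≤ ((∫⁻ x, W x ∂μ) ^ (1 / 2 : ℝ) * (∫⁻ x, V x ∂μ) ^ (1 / 2 : ℝ)) ^ 2 := by
        gcongr
        exact h1.trans h2
    _ = _ := by
        rw [← ENNReal.mul_rpow_of_nonneg _ _ (by norm_num), ← ENNReal.rpow_natCast,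
          ← ENNReal.rpow_mul]
        norm_num

/-- Tonelli's theorem for a double integral over a measurable subset of the product. -/
theorem lintegral_setLIntegral_swap [SFinite μ] [SFinite ν] {S : Set (X × Y)}
    (hS : MeasurableSet S) {F : X → Y → ℝ≥0∞} (hF : Measurable (Function.uncurry F)) :
    ∫⁻ x, ∫⁻ y in {y | (x, y) ∈ S}, F x y ∂ν ∂μ = ∫⁻ y, ∫⁻ x in {x | (x, y) ∈ S}, F x y ∂μ ∂ν := by
  have h1 : ∀ x, ∫⁻ y in {y | (x, y) ∈ S}, F x y ∂ν =
      ∫⁻ y, S.indicator (Function.uncurry F) (x, y) ∂ν :=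
    fun x => (lintegral_indicator (measurable_prodMk_left hS) _).symm
  have h2 : ∀ y, ∫⁻ x in {x | (x, y) ∈ S}, F x y ∂μ =
      ∫⁻ x, S.indicator (Function.uncurry F) (x, y) ∂μ :=
    fun y => (lintegral_indicator (measurable_prodMk_right hS) _).symm
  simp_rw [h1, h2]
  exact lintegral_lintegral_swap (hF.indicator hS).aemeasurable

end CauchySchwarz

/-! ### Square integrability of Riesz potentials -/

section Potential

variable {n : ℕ}

local notation "ℝⁿ" => EuclideanSpace ℝ (Fin n)

theorem upperRegular_volume_euclidean : UpperRegular (volume : Measure ℝⁿ) n := by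
  have := upperRegular_volume (E := ℝⁿ)
  rwa [finrank_euclideanSpace_fin] at this

/-- The Riesz potential `∫ |P - x| ^ (-m) H x dx` of a square integrable function is square
integrable with respect to every finite measure whose dimension exceeds `2 m - n`. -/
theorem UpperRegular.lintegral_riesz_sq_le {σ : Measure ℝⁿ} [IsFiniteMeasure σ] {d m : ℝ}
    (h : UpperRegular σ d) (hm : n < 2 * m) (hmn : m < n) (hd : 2 * m - n < d) :
    ∃ K : ℝ≥0, ∀ H : ℝⁿ → ℝ≥0∞, Measurable H →
      ∫⁻ P, (∫⁻ x, ‖P - x‖ₑ ^ (-m) * H x) ^ 2 ∂σ ≤ K * ∫⁻ x, H x ^ 2 := by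
  have hn0 : (0 : ℝ) ≤ n := n.cast_nonneg
  -- For `|P - x| ≤ 1` the kernel is split as `|P - x| ^ (-2m) = |P - x| ^ (-a) |P - x| ^ (a - 2m)`.
  -- The exponent `a` is such that the first factor is integrable in `dx` and the second in `dσ(P)`.
  obtain ⟨a, ha1, ha2⟩ := exists_between (show max 0 (2 * m - d) < min (n : ℝ) (2 * m) by
    rw [lt_min_iff, max_lt_iff, max_lt_iff]
    refine ⟨⟨?_, ?_⟩, ?_, ?_⟩ <;> linarith)
  rw [max_lt_iff] at ha1
  rw [lt_min_iff] at ha2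
  obtain ⟨K₁, hK₁⟩ := (upperRegular_volume_euclidean (n := n)).lintegral_near ha1.1.le ha2.1
  obtain ⟨K₂, hK₂⟩ := h.lintegral_near (b := 2 * m - a) (by linarith) (by linarith)
  obtain ⟨K₃, hK₃⟩ := (upperRegular_volume_euclidean (n := n)).lintegral_far (b := 2 * m)
    (by linarith) hm
  refine ⟨2 * (K₁ * K₂ + K₃ * (σ Set.univ).toNNReal), fun H hH => ?_⟩
  have hnear : ∫⁻ P, (∫⁻ x in Metric.closedBall P 1, ‖P - x‖ₑ ^ (-m) * H x) ^ 2 ∂σ ≤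
      K₁ * K₂ * ∫⁻ x, H x ^ 2 := by
    calc _ ≤ ∫⁻ P, (K₁ * ∫⁻ x in Metric.closedBall P 1,
          ‖P - x‖ₑ ^ (-(2 * m - a)) * H x ^ 2) ∂σ := by
          refine lintegral_mono fun P => ?_
          refine (sq_lintegral_le_of_sq_le (W := fun x => ‖P - x‖ₑ ^ (-a))
            (V := fun x => ‖P - x‖ₑ ^ (-(2 * m - a)) * H x ^ 2) (by fun_prop) (by fun_prop)
            (Filter.Eventually.of_forall fun x => ?_)).trans ?_
          · rw [← mul_assoc, ennreal_rpow_neg_mul_rpow_neg enorm_ne_top ha1.1 (by linarith),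
              mul_pow, ← ENNReal.rpow_mul_natCast]
            refine le_of_eq ?_
            congr 2
            push_cast
            ring
          · refine mul_le_mul_left ((hK₁ P 1 one_pos).trans ?_) _
            simp
      _ = K₁ * ∫⁻ x, (∫⁻ P in Metric.closedBall x 1,
          ‖P - x‖ₑ ^ (-(2 * m - a)) * H x ^ 2 ∂σ) := by
          rw [lintegral_const_mul' _ _ ENNReal.coe_ne_top]
          congr 1
          have := lintegral_setLIntegral_swap (μ := σ) (ν := (volume : Measure ℝⁿ))
            (S := {p : ℝⁿ × ℝⁿ | dist p.2 p.1 ≤ 1})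
            (measurableSet_le (by fun_prop) (by fun_prop))
            (F := fun P x => ‖P - x‖ₑ ^ (-(2 * m - a)) * H x ^ 2) (by
              unfold Function.uncurry
              fun_prop)
          refine this.trans (lintegral_congr fun x => ?_)
          congr 2
          ext P
          simp [dist_comm]
      _ ≤ K₁ * ∫⁻ x, K₂ * H x ^ 2 := by
          gcongr with x
          rw [lintegral_mul_const _ (by fun_prop)]
          gcongr
          simp_rw [enorm_sub_rev _ x]
          refine (hK₂ x 1 one_pos).trans ?_
          simp
      _ = _ := by rw [lintegral_const_mul' _ _ ENNReal.coe_ne_top, mul_assoc]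
  -- For `|P - x| > 1` the function `|P - x| ^ (-2m)` itself is integrable in `dx`.
  have hfar : ∫⁻ P, (∫⁻ x in (Metric.closedBall P 1)ᶜ, ‖P - x‖ₑ ^ (-m) * H x) ^ 2 ∂σ ≤
      K₃ * (σ Set.univ) * ∫⁻ x, H x ^ 2 := by
    calc _ ≤ ∫⁻ _, (K₃ * ∫⁻ x, H x ^ 2) ∂σ := by
          refine lintegral_mono fun P => ?_
          refine (sq_lintegral_le_of_sq_le (W := fun x => ‖P - x‖ₑ ^ (-(2 * m)))
            (V := fun x => H x ^ 2) (by fun_prop) (by fun_prop)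
            (Filter.Eventually.of_forall fun x => ?_)).trans ?_
          · rw [mul_pow, ← ENNReal.rpow_mul_natCast]
            refine le_of_eq ?_
            congr 2
            push_cast
            ring
          · refine mul_le_mul' ((hK₃ P 1 one_pos).trans ?_) (setLIntegral_le_lintegral _ _)
            simp
      _ = _ := by
          rw [lintegral_const]
          ring
  calc _ ≤ ∫⁻ P, 2 * ((∫⁻ x in Metric.closedBall P 1, ‖P - x‖ₑ ^ (-m) * H x) ^ 2 +
        (∫⁻ x in (Metric.closedBall P 1)ᶜ, ‖P - x‖ₑ ^ (-m) * H x) ^ 2) ∂σ := by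
        refine lintegral_mono fun P => ?_
        rw [← lintegral_add_compl _ (Metric.isClosed_closedBall (x := P) (ε := 1)).measurableSet]
        exact ennreal_add_sq_le _ _
    _ ≤ 2 * (K₁ * K₂ * (∫⁻ x, H x ^ 2) + K₃ * (σ Set.univ) * ∫⁻ x, H x ^ 2) := by
        rw [lintegral_const_mul' _ _ (by simp), lintegral_add_left']
        · gcongr
        · have : Measurable fun P : ℝⁿ => ∫⁻ x, {p : ℝⁿ × ℝⁿ | dist p.2 p.1 ≤ 1}.indicator
              (fun p => ‖p.1 - p.2‖ₑ ^ (-m) * H p.2) (P, x) := by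
            refine Measurable.lintegral_prod_right' (f := {p : ℝⁿ × ℝⁿ | dist p.2 p.1 ≤ 1}.indicator
              (fun p => ‖p.1 - p.2‖ₑ ^ (-m) * H p.2)) ?_
            exact Measurable.indicator (by fun_prop) (measurableSet_le (by fun_prop) (by fun_prop))
          have h2 : ∀ P : ℝⁿ, ∫⁻ x in Metric.closedBall P 1, ‖P - x‖ₑ ^ (-m) * H x =
              ∫⁻ x, {p : ℝⁿ × ℝⁿ | dist p.2 p.1 ≤ 1}.indicator
                (fun p => ‖p.1 - p.2‖ₑ ^ (-m) * H p.2) (P, x) := fun P => by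
            rw [← lintegral_indicator Metric.isClosed_closedBall.measurableSet]
            rfl
          simp_rw [h2]
          exact (this.pow_const 2).aemeasurable
    _ = _ := by
        push_cast
        rw [ENNReal.coe_toNNReal (measure_ne_top _ _)]
        ring

end Potential

/-! ### A weighted Schur test -/

section WeightedSchur

variable {n : ℕ}

local notation "ℝⁿ" => EuclideanSpace ℝ (Fin n)

/-- The potential `∫ |x - R| ^ (-e) dσ(R)` of a measure, used as a weight in the Cauchy--Schwarz
inequality. -/
noncomputable def weightPotential (σ : Measure ℝⁿ) (e : ℝ) (x : ℝⁿ) : ℝ≥0∞ :=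
  ∫⁻ R, ‖x - R‖ₑ ^ (-e) ∂σ

theorem measurable_weightPotential (σ : Measure ℝⁿ) [SFinite σ] (e : ℝ) :
    Measurable (weightPotential σ e) :=
  Measurable.lintegral_prod_right' (f := fun p : ℝⁿ × ℝⁿ => ‖p.1 - p.2‖ₑ ^ (-e)) (by fun_prop)

theorem weightPotential_pos {σ : Measure ℝⁿ} (hσ : σ ≠ 0) {e : ℝ} (he : 0 < e)
    (x : ℝⁿ) : weightPotential σ e x ≠ 0 := by
  intro h0
  rw [weightPotential, lintegral_eq_zero_iff (by fun_prop)] at h0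
  have : NeZero σ := ⟨hσ⟩
  obtain ⟨z, hz⟩ := h0.exists
  simp [ENNReal.rpow_eq_zero_iff, he] at hz
  exact lt_asymm he hz.2

/-- The weight is finite almost everywhere, as its integral over every ball is finite. The exponent
`e` may exceed the dimension of `σ`, in which case the weight can be infinite on the support of `σ`.
-/
theorem weightPotential_lt_top {σ : Measure ℝⁿ} [IsFiniteMeasure σ] {e : ℝ} (he : 0 ≤ e)
    (hen : e < n) : ∀ᵐ x, weightPotential σ e x < ∞ := by
  obtain ⟨K, hK⟩ := (upperRegular_volume_euclidean (n := n)).lintegral_near he hen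
  have hball : ∀ k : ℕ, ∀ᵐ x ∂(volume.restrict (Metric.closedBall (0 : ℝⁿ) k)),
      weightPotential σ e x < ∞ := by
    intro k
    refine ae_lt_top (measurable_weightPotential σ e) (ne_of_lt ?_)
    simp_rw [weightPotential]
    rw [lintegral_lintegral_swap (by fun_prop)]
    refine lt_of_le_of_lt (b := ∫⁻ _, (K + volume (Metric.closedBall (0 : ℝⁿ) k)) ∂σ)
      (lintegral_mono fun R => ?_) ?_
    · calc ∫⁻ x in Metric.closedBall (0 : ℝⁿ) k, ‖x - R‖ₑ ^ (-e)
          ≤ ∫⁻ x in Metric.closedBall R 1 ∪ (Metric.closedBall (0 : ℝⁿ) k \ Metric.closedBall R 1),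
            ‖x - R‖ₑ ^ (-e) := lintegral_mono_set (fun x hx => by
              by_cases h : x ∈ Metric.closedBall R 1
              · exact Or.inl h
              · exact Or.inr ⟨hx, h⟩)
        _ ≤ _ := lintegral_union_le _ _ _
        _ ≤ K + ∫⁻ x in (Metric.closedBall (0 : ℝⁿ) k \ Metric.closedBall R 1), 1 := by
            refine add_le_add ?_ ?_
            · simp_rw [enorm_sub_rev _ R]
              refine (hK R 1 one_pos).trans ?_
              simp
            · refine setLIntegral_mono' (Metric.isClosed_closedBall.measurableSet.diff
                Metric.isClosed_closedBall.measurableSet) fun x hx => ?_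
              have h2 := hx.2
              rw [Metric.mem_closedBall, not_le, dist_eq_norm] at h2
              refine (enorm_rpow_neg_le one_pos h2.le he).trans ?_
              simp
        _ ≤ _ := by
            rw [setLIntegral_one]
            gcongr
            exact Set.sdiff_subset
    · rw [lintegral_const]
      exact ENNReal.mul_lt_top (ENNReal.add_lt_top.2 ⟨ENNReal.coe_lt_top,
        measure_closedBall_lt_top⟩) (measure_lt_top _ _)
  rw [← Measure.restrict_univ (μ := (volume : Measure ℝⁿ)), ← Metric.iUnion_closedBall_nat 0,
    ae_restrict_iUnion_iff]
  exact hball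

/-- A Schur test, uniform in a family of kernels `N (P, Q)` with weights `ω (P, Q)`. The kernel is
split as `N ^ 2 ≤ W V`, and the potential of `σ` itself serves as weight: the bound
`K |x - P| ^ (-e)` assumed of the remaining integral is, after integration in `dσ(P)`, exactly `K`
times that weight, which cancels. -/
theorem lintegral_sq_le_of_weight {σ : Measure ℝⁿ} [IsFiniteMeasure σ] {e : ℝ} (he : 0 < e)
    (hen : e < n) {N W V : (ℝⁿ × ℝⁿ) × ℝⁿ → ℝ≥0∞} (hW : Measurable W)
    (hV : Measurable V) {ω : ℝⁿ × ℝⁿ → ℝ≥0∞} (hω : Measurable ω)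
    (hNWV : ∀ p, N p ^ 2 ≤ W p * V p) {K : ℝ≥0}
    (hK : ∀ P x : ℝⁿ, x ≠ P → ∫⁻ Q, ω (P, Q) * (∫⁻ y, W ((P, Q), y) * weightPotential σ e y) *
      V ((P, Q), x) ∂σ ≤ K * ‖x - P‖ₑ ^ (-e)) {H : ℝⁿ → ℝ≥0∞} (hH : Measurable H) :
    ∫⁻ P, ∫⁻ Q, ω (P, Q) * (∫⁻ x, N ((P, Q), x) * H x) ^ 2 ∂σ ∂σ ≤ K * ∫⁻ x, H x ^ 2 := by
  rcases eq_or_ne σ 0 with rfl | hσ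
  · simp
  set U := weightPotential σ e with hUdef
  have hU : Measurable U := measurable_weightPotential σ e
  have hU0 : ∀ x, U x ≠ 0 := weightPotential_pos hσ he
  have hUt : ∀ᵐ x, U x < ∞ := weightPotential_lt_top he.le hen
  have hn : (0 : ℝ) < n := he.trans hen
  have hM : Measurable fun p : ℝⁿ × ℝⁿ => ∫⁻ y, W (p, y) * U y :=
    Measurable.lintegral_prod_right' (f := fun q : (ℝⁿ × ℝⁿ) × ℝⁿ => W q * U q.2) (by fun_prop)
  set M := fun p : ℝⁿ × ℝⁿ => ∫⁻ y, W (p, y) * U y with hMdef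
  calc _ ≤ ∫⁻ P, ∫⁻ Q, ∫⁻ x, ω (P, Q) * M (P, Q) * V ((P, Q), x) * ((U x)⁻¹ * H x ^ 2) ∂volume
        ∂σ ∂σ := by
        refine lintegral_mono fun P => lintegral_mono fun Q => ?_
        have h1 := sq_lintegral_le_of_sq_le (μ := (volume : Measure ℝⁿ))
          (N := fun x => N ((P, Q), x) * H x)
          (W := fun y => W ((P, Q), y) * U y)
          (V := fun x => V ((P, Q), x) * ((U x)⁻¹ * H x ^ 2)) (by fun_prop) (by fun_prop) (by
            filter_upwards [hUt] with x hx
            rw [mul_pow]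
            calc _ ≤ W ((P, Q), x) * V ((P, Q), x) * H x ^ 2 := by
                  gcongr
                  exact hNWV _
              _ = W ((P, Q), x) * V ((P, Q), x) * H x ^ 2 * (U x * (U x)⁻¹) := by
                  rw [ENNReal.mul_inv_cancel (hU0 x) hx.ne, mul_one]
              _ = _ := by ring)
        calc _ ≤ ω (P, Q) * (M (P, Q) * ∫⁻ x, V ((P, Q), x) * ((U x)⁻¹ * H x ^ 2)) :=
              mul_le_mul_right h1 _
          _ = _ := by
              rw [← mul_assoc, ← lintegral_const_mul _ (by fun_prop)]
              exact lintegral_congr fun x => by ring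
    _ = ∫⁻ P, ∫⁻ x, (∫⁻ Q, ω (P, Q) * M (P, Q) * V ((P, Q), x) ∂σ) * ((U x)⁻¹ * H x ^ 2) ∂volume
        ∂σ := by
        refine lintegral_congr fun P => ?_
        rw [lintegral_lintegral_swap (by fun_prop)]
        exact lintegral_congr fun x => lintegral_mul_const _ (by fun_prop)
    _ ≤ ∫⁻ P, ∫⁻ x, (K * ‖x - P‖ₑ ^ (-e)) * ((U x)⁻¹ * H x ^ 2) ∂volume ∂σ := by
        refine lintegral_mono fun P => lintegral_mono_ae ?_
        have h0 : ∀ᵐ x : ℝⁿ, x ≠ P :=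
          measure_eq_zero_iff_ae_notMem.1 (upperRegular_volume_euclidean.measure_singleton hn P)
        filter_upwards [h0] with x hx
        exact mul_le_mul_left (hK P x hx) _
    _ = ∫⁻ x, K * (U x * (U x)⁻¹ * H x ^ 2) := by
        rw [lintegral_lintegral_swap (by fun_prop)]
        refine lintegral_congr fun x => ?_
        rw [lintegral_mul_const _ (by fun_prop), lintegral_const_mul _ (by fun_prop)]
        change K * U x * _ = _
        ring
    _ ≤ ∫⁻ x, K * H x ^ 2 := by
        refine lintegral_mono fun x => ?_
        gcongr
        calc _ ≤ 1 * H x ^ 2 := mul_le_mul_left (ENNReal.mul_inv_le_one _) _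
          _ = _ := one_mul _
    _ = _ := lintegral_const_mul' _ _ ENNReal.coe_ne_top

variable {σ : Measure (EuclideanSpace ℝ (Fin n))} {γ a : ℝ}

/-- The double integral in `y ∈ S` and `dσ(R)` that results from the definition of the weight is
split according to whether `R ∈ B(P, ρ)`. -/
theorem setLIntegral_mul_weightPotential_eq [IsFiniteMeasure σ] {e : ℝ} (S : Set ℝⁿ)
    (P : ℝⁿ) (ρ : ℝ) :
    ∫⁻ y in S, ‖P - y‖ₑ ^ (-a) * weightPotential σ e y =
      (∫⁻ R in Metric.closedBall P ρ, (∫⁻ y in S, ‖P - y‖ₑ ^ (-a) * ‖y - R‖ₑ ^ (-e)) ∂σ) +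
      ∫⁻ R in (Metric.closedBall P ρ)ᶜ, (∫⁻ y in S, ‖P - y‖ₑ ^ (-a) * ‖y - R‖ₑ ^ (-e)) ∂σ := by
  rw [lintegral_add_compl _ Metric.isClosed_closedBall.measurableSet,
    ← lintegral_lintegral_swap (by fun_prop)]
  exact lintegral_congr fun y => (lintegral_const_mul _ (by fun_prop)).symm

/-- The integral of the weight against a power of the distance to `P`, over a ball about `P`. The
contribution to the weight of the points `R` with `|P - R| ≤ 2 r` is computed by composing the
kernels; for the other `R` the factor `|y - R| ^ (-(n - 1 + γ))` is comparable to its value at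
`y = P`. -/
theorem UpperRegular.weightPotential_near [IsFiniteMeasure σ] (hσ : UpperRegular σ (n - 1))
    (hγ : 0 < γ) (hγ1 : γ < 1) (ha : 0 < a) (haγ : a + γ < n)
    (haγ' : 1 < a + γ) :
    ∃ K : ℝ≥0, ∀ (P : ℝⁿ) (r : ℝ), 0 < r →
      ∫⁻ y in Metric.closedBall P r, ‖P - y‖ₑ ^ (-a) * weightPotential σ (n - 1 + γ) y ≤
        K * ENNReal.ofReal (r ^ (n - a - γ)) := by
  have hdim : (Module.finrank ℝ ℝⁿ : ℝ) = n := by rw [finrank_euclideanSpace_fin]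
  obtain ⟨K₁, -, hK₁⟩ := exists_lintegral_rpow_mul_rpow_eq (E := ℝⁿ) (a := a)
    (b := n - 1 + γ) ha (by linarith) (by linarith) (by linarith) (by linarith)
  obtain ⟨K₂, hK₂⟩ := hσ.lintegral_near (b := a + (n - 1 + γ) - n) (by linarith) (by linarith)
  obtain ⟨K₃, hK₃⟩ := (upperRegular_volume_euclidean (n := n)).lintegral_near ha.le (by linarith)
  obtain ⟨K₄, hK₄⟩ := hσ.lintegral_far (b := n - 1 + γ) (by linarith) (by linarith)
  refine ⟨K₁ * K₂ * ((2 : ℝ) ^ (n - a - γ)).toNNReal + K₃ * ((2 : ℝ) ^ (n - 1 + γ)).toNNReal * K₄ *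
    ((2 : ℝ) ^ (-γ)).toNNReal, fun P r hr => ?_⟩
  rw [setLIntegral_mul_weightPotential_eq _ P (2 * r), ENNReal.coe_add, add_mul]
  refine add_le_add ?_ ?_
  · calc _ ≤ ∫⁻ R in Metric.closedBall P (2 * r), K₁ * ‖P - R‖ₑ ^ (-(a + (n - 1 + γ) - n)) ∂σ := by
          have h0 : ∀ᵐ R ∂(σ.restrict (Metric.closedBall P (2 * r))), R ≠ P := ae_restrict_of_ae
            (measure_eq_zero_iff_ae_notMem.1 (hσ.measure_singleton (by linarith) P))
          refine lintegral_mono_ae (h0.mono fun R hR => ?_)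
          refine (setLIntegral_le_lintegral _ _).trans ?_
          rw [hK₁ P R hR.symm, hdim]
      _ ≤ K₁ * (K₂ * ENNReal.ofReal ((2 * r) ^ ((n : ℝ) - 1 - (a + (n - 1 + γ) - n)))) := by
          rw [lintegral_const_mul' _ _ ENNReal.coe_ne_top]
          gcongr
          exact hK₂ P _ (by positivity)
      _ = _ := by
          push_cast
          rw [show (((2 : ℝ) ^ (n - a - γ)).toNNReal : ℝ≥0∞) = ENNReal.ofReal (2 ^ (n - a - γ))
            from rfl, mul_assoc, mul_assoc, ← ENNReal.ofReal_mul (by positivity),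
            ← Real.mul_rpow (by norm_num) hr.le]
          congr 4
          ring
  · calc _ ≤ ∫⁻ R in (Metric.closedBall P (2 * r))ᶜ, K₃ * ENNReal.ofReal (r ^ (n - a)) *
          ENNReal.ofReal (2 ^ (n - 1 + γ)) * ‖P - R‖ₑ ^ (-(n - 1 + γ)) ∂σ := by
          refine setLIntegral_mono' Metric.isClosed_closedBall.measurableSet.compl fun R hR => ?_
          rw [Set.mem_compl_iff, Metric.mem_closedBall, not_le, dist_comm, dist_eq_norm] at hR
          have hPR : P - R ≠ 0 := norm_pos_iff.1 (by linarith)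
          calc _ ≤ ∫⁻ y in Metric.closedBall P r, ‖P - y‖ₑ ^ (-a) *
                ENNReal.ofReal ((‖P - R‖ / 2) ^ (-(n - 1 + γ))) := by
                refine setLIntegral_mono' Metric.isClosed_closedBall.measurableSet fun y hy => ?_
                gcongr
                refine enorm_rpow_neg_le (by positivity) ?_ (by linarith)
                rw [Metric.mem_closedBall, dist_comm, dist_eq_norm] at hy
                have := norm_add_le (P - y) (y - R)
                rw [sub_add_sub_cancel] at this
                linarith
            _ ≤ K₃ * ENNReal.ofReal (r ^ (n - a)) *
                ENNReal.ofReal ((‖P - R‖ / 2) ^ (-(n - 1 + γ))) := by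
                rw [lintegral_mul_const' _ _ ENNReal.ofReal_ne_top]
                gcongr
                exact hK₃ P r hr
            _ = _ := by
                rw [enorm_rpow_eq_ofReal hPR, mul_assoc _ (ENNReal.ofReal (2 ^ _)),
                  ← ENNReal.ofReal_mul (by positivity), Real.div_rpow (by positivity) (by norm_num),
                  Real.rpow_neg (by norm_num : (0 : ℝ) ≤ 2), div_inv_eq_mul,
                  mul_comm (_ ^ _) (2 ^ _)]
      _ ≤ K₃ * ENNReal.ofReal (r ^ (n - a)) * ENNReal.ofReal (2 ^ (n - 1 + γ)) *
          (K₄ * ENNReal.ofReal ((2 * r) ^ ((n : ℝ) - 1 - (n - 1 + γ)))) := by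
          rw [lintegral_const_mul _ (by fun_prop)]
          gcongr
          exact hK₄ P _ (by positivity)
      _ = _ := by
          push_cast
          rw [show (((2 : ℝ) ^ (n - 1 + γ)).toNNReal : ℝ≥0∞) = ENNReal.ofReal (2 ^ (n - 1 + γ))
            from rfl, show (((2 : ℝ) ^ (-γ)).toNNReal : ℝ≥0∞) = ENNReal.ofReal (2 ^ (-γ)) from rfl,
            show (n : ℝ) - a - γ = (n - a) + (-γ) by ring, Real.rpow_add hr,
            ENNReal.ofReal_mul (by positivity), show (n : ℝ) - 1 - (n - 1 + γ) = -γ by ring,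
            Real.mul_rpow (by norm_num) hr.le, ENNReal.ofReal_mul (by positivity)]
          ring

/-- The integral of the weight against a power of the distance to `P`, off a ball about `P`. The
contribution to the weight of the points `R` with `|P - R| > r / 2` is computed by composing the
kernels; for the other `R` one has `|y - R| ≥ |P - y| / 2`. -/
theorem UpperRegular.weightPotential_far [IsFiniteMeasure σ] (hσ : UpperRegular σ (n - 1))
    (hγ1 : γ < 1) (hn : 1 < (n : ℝ)) (ha : 0 < a) (han : a < n) (haγ : n < a + γ) :
    ∃ K : ℝ≥0, ∀ (P : ℝⁿ) (r : ℝ), 0 < r →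
      ∫⁻ y in (Metric.closedBall P r)ᶜ, ‖P - y‖ₑ ^ (-a) * weightPotential σ (n - 1 + γ) y ≤
        K * ENNReal.ofReal (r ^ (n - a - γ)) := by
  have hdim : (Module.finrank ℝ ℝⁿ : ℝ) = n := by rw [finrank_euclideanSpace_fin]
  obtain ⟨K₁, -, hK₁⟩ := exists_lintegral_rpow_mul_rpow_eq (E := ℝⁿ) (a := a)
    (b := n - 1 + γ) ha (by linarith) (by linarith) (by linarith) (by linarith)
  obtain ⟨K₂, hK₂⟩ := hσ.lintegral_far (b := a + (n - 1 + γ) - n) (by linarith) (by linarith)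
  obtain ⟨K₃, hK₃⟩ := (upperRegular_volume_euclidean (n := n)).lintegral_far
    (b := a + (n - 1 + γ)) (by linarith) (by linarith)
  obtain ⟨C, hC⟩ := id hσ
  refine ⟨((2 : ℝ) ^ (n - 1 + γ)).toNNReal * K₃ * (C * ((1 / 2 : ℝ) ^ ((n : ℝ) - 1)).toNNReal) +
    K₁ * K₂ * ((1 / 2 : ℝ) ^ (n - a - γ)).toNNReal, fun P r hr => ?_⟩
  rw [setLIntegral_mul_weightPotential_eq _ P (1 / 2 * r), ENNReal.coe_add, add_mul]
  refine add_le_add ?_ ?_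
  · calc _ ≤ ∫⁻ R in Metric.closedBall P (1 / 2 * r), (ENNReal.ofReal (2 ^ (n - 1 + γ)) *
          (K₃ * ENNReal.ofReal (r ^ ((n : ℝ) - (a + (n - 1 + γ)))))) ∂σ := by
          refine setLIntegral_mono' Metric.isClosed_closedBall.measurableSet fun R hR => ?_
          rw [Metric.mem_closedBall, dist_comm, dist_eq_norm] at hR
          refine le_trans ?_ (mul_le_mul_right (hK₃ P r hr) _)
          rw [← lintegral_const_mul _ (by fun_prop)]
          refine setLIntegral_mono' Metric.isClosed_closedBall.measurableSet.compl fun y hy => ?_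
          rw [Set.mem_compl_iff, Metric.mem_closedBall, not_le, dist_comm, dist_eq_norm] at hy
          have hPy : P - y ≠ 0 := norm_pos_iff.1 (by linarith)
          rw [← ennreal_rpow_neg_mul_rpow_neg enorm_ne_top ha (by linarith), mul_left_comm]
          gcongr
          rw [enorm_rpow_eq_ofReal hPy, ← ENNReal.ofReal_mul (by positivity)]
          refine (enorm_rpow_neg_le (t := ‖P - y‖ / 2) (by positivity) ?_ (by linarith)).trans
            (le_of_eq ?_)
          · have := norm_sub_le (P - R) (y - R)
            rw [sub_sub_sub_cancel_right] at this
            linarith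
          · rw [Real.div_rpow (by positivity) (by norm_num),
              Real.rpow_neg (by norm_num : (0 : ℝ) ≤ 2), div_inv_eq_mul, mul_comm (_ ^ _) (2 ^ _)]
      _ ≤ ENNReal.ofReal (2 ^ (n - 1 + γ)) * (K₃ * ENNReal.ofReal (r ^ ((n : ℝ) -
          (a + (n - 1 + γ))))) * (C * ENNReal.ofReal ((1 / 2 * r) ^ ((n : ℝ) - 1))) := by
          rw [setLIntegral_const]
          gcongr
          exact hC P _ (by positivity)
      _ = _ := by
          push_cast
          rw [show (((2 : ℝ) ^ (n - 1 + γ)).toNNReal : ℝ≥0∞) = ENNReal.ofReal (2 ^ (n - 1 + γ))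
            from rfl, show (((1 / 2 : ℝ) ^ ((n : ℝ) - 1)).toNNReal : ℝ≥0∞) =
            ENNReal.ofReal ((1 / 2) ^ ((n : ℝ) - 1)) from rfl,
            show (n : ℝ) - a - γ = ((n : ℝ) - (a + (n - 1 + γ))) + (n - 1) by ring,
            Real.rpow_add hr, ENNReal.ofReal_mul (by positivity),
            Real.mul_rpow (by norm_num) hr.le, ENNReal.ofReal_mul (by positivity)]
          ring
  · calc _ ≤ ∫⁻ R in (Metric.closedBall P (1 / 2 * r))ᶜ,
          K₁ * ‖P - R‖ₑ ^ (-(a + (n - 1 + γ) - n)) ∂σ := by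
          refine setLIntegral_mono' Metric.isClosed_closedBall.measurableSet.compl fun R hR => ?_
          rw [Set.mem_compl_iff, Metric.mem_closedBall, not_le, dist_comm, dist_eq_norm] at hR
          have hPR : P - R ≠ 0 := norm_pos_iff.1 (by linarith)
          refine (setLIntegral_le_lintegral _ _).trans ?_
          rw [hK₁ P R (sub_ne_zero.1 hPR), hdim]
      _ ≤ K₁ * (K₂ * ENNReal.ofReal ((1 / 2 * r) ^ ((n : ℝ) - 1 - (a + (n - 1 + γ) - n)))) := by
          rw [lintegral_const_mul' _ _ ENNReal.coe_ne_top]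
          gcongr
          exact hK₂ P _ (by positivity)
      _ = _ := by
          push_cast
          rw [show (((1 / 2 : ℝ) ^ (n - a - γ)).toNNReal : ℝ≥0∞) =
            ENNReal.ofReal ((1 / 2) ^ (n - a - γ)) from rfl, mul_assoc, mul_assoc,
            ← ENNReal.ofReal_mul (by positivity), ← Real.mul_rpow (by norm_num) hr.le]
          congr 4
          ring

end WeightedSchur

/-! ### Differences of Riesz kernels -/

section PowerDifference

/-- The mean value estimate for negative powers. -/
theorem abs_rpow_neg_sub_rpow_neg_le {m t a b : ℝ} (hm : 0 ≤ m) (ht : 0 < t) (ha : t ≤ a)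
    (hb : t ≤ b) : |a ^ (-m) - b ^ (-m)| ≤ m * t ^ (-(m + 1)) * |a - b| := by
  have h := (convex_Ici t).norm_image_sub_le_of_norm_hasDerivWithin_le
    (f := fun x : ℝ => x ^ (-m)) (f' := fun x => -m * x ^ (-m - 1))
    (C := m * t ^ (-(m + 1)))
    (fun x hx => (Real.hasDerivAt_rpow_const (Or.inl (ht.trans_le hx).ne')).hasDerivWithinAt)
    (fun x hx => ?_) hb ha
  · simpa only [Real.norm_eq_abs] using h
  · have hx0 : 0 < x := ht.trans_le hx
    rw [norm_mul, norm_neg, Real.norm_of_nonneg hm, Real.norm_of_nonneg (by positivity),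
      neg_add']
    gcongr 1
    exact Real.rpow_le_rpow_of_nonpos ht hx (by linarith)

variable {E : Type*} [NormedAddCommGroup E] {m : ℝ}

/-- The Riesz kernels with poles `P` and `Q` differ at `x` by at most their sizes if `x` is near
the poles, and by the mean value bound if `x` is far from the poles. -/
theorem enorm_rpow_neg_sub_le (hm : 0 < m) (P Q x : E) :
    ‖‖P - x‖ ^ (-m) - ‖Q - x‖ ^ (-m)‖ₑ ≤
      (if ‖P - x‖ ≤ 3 * ‖P - Q‖ then ‖P - x‖ₑ ^ (-m) else 0) +
      (if ‖Q - x‖ ≤ 3 * ‖Q - P‖ then ‖Q - x‖ₑ ^ (-m) else 0) +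
      ENNReal.ofReal (m * 2 ^ (m + 1)) *
        (if 2 * ‖P - Q‖ < ‖P - x‖ then ‖P - Q‖ₑ * ‖P - x‖ₑ ^ (-(m + 1)) else 0) := by
  have hle : ∀ z : E, ‖‖z‖ ^ (-m)‖ₑ ≤ ‖z‖ₑ ^ (-m) := by
    intro z
    rcases eq_or_ne z 0 with rfl | hz
    · simp [ENNReal.zero_rpow_of_neg, hm]
    · rw [enorm_rpow_eq_ofReal hz, Real.enorm_of_nonneg (by positivity)]
  by_cases h : 2 * ‖P - Q‖ < ‖P - x‖
  · refine le_trans ?_ le_add_self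
    rw [if_pos h]
    have h1 : 0 < ‖P - x‖ := lt_of_le_of_lt (by positivity) h
    have h2 : ‖P - x‖ / 2 ≤ ‖Q - x‖ := by
      have := norm_add_le (P - Q) (Q - x)
      rw [sub_add_sub_cancel] at this
      linarith
    have h3 := abs_rpow_neg_sub_rpow_neg_le hm.le (half_pos h1) (half_le_self h1.le) h2
    have h4 : |‖P - x‖ - ‖Q - x‖| ≤ ‖P - Q‖ := by
      have := abs_norm_sub_norm_le (P - x) (Q - x)
      rwa [sub_sub_sub_cancel_right] at this
    rw [enorm_rpow_eq_ofReal (norm_pos_iff.1 h1), ← ofReal_norm (P - Q), ← ofReal_norm,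
      ← ENNReal.ofReal_mul (by positivity), ← ENNReal.ofReal_mul (by positivity), Real.norm_eq_abs]
    refine ENNReal.ofReal_le_ofReal (h3.trans ?_)
    rw [Real.div_rpow h1.le (by norm_num), Real.rpow_neg (by norm_num : (0 : ℝ) ≤ 2),
      div_inv_eq_mul]
    calc _ ≤ m * (‖P - x‖ ^ (-(m + 1)) * 2 ^ (m + 1)) * ‖P - Q‖ := by gcongr
      _ = _ := by ring
  · refine le_trans ?_ le_self_add
    rw [not_lt] at h
    have h0 := norm_nonneg (P - Q)
    rw [if_pos (by linarith), if_pos]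
    · exact (enorm_sub_le).trans (add_le_add (hle _) (hle _))
    · have := norm_add_le (Q - P) (P - x)
      rw [sub_add_sub_cancel] at this
      rw [norm_sub_rev Q P] at *
      linarith

end PowerDifference

/-! ### The trace estimate -/

section Trace

variable {n : ℕ} {σ : Measure (EuclideanSpace ℝ (Fin n))} {α : ℝ}

local notation "ℝⁿ" => EuclideanSpace ℝ (Fin n)

theorem ofReal_toNNReal_coe (x : ℝ) : ((x.toNNReal : ℝ≥0) : ℝ≥0∞) = ENNReal.ofReal x := rfl

/-- The part of the trace estimate where `|P - x| ≤ 3 |P - Q|`. The Schur test applies with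
`e = n - α / 2`. The power `|P - x| ^ (-2m)` is split into factors with the exponents
`-(n - 1 - α / 2)` and `-(n - 3α / 2)`, so that the first is integrable against the weight near `P`,
with result `O(|P - Q| ^ α)`, and the remaining integral in `dσ(Q)`, over `|P - Q| ≥ |P - x| / 3`,
converges. -/
theorem UpperRegular.trace_near [IsFiniteMeasure σ] (hσ : UpperRegular σ (n - 1))
    (hα : 0 < α) (hα1 : α < 1 / 2) (hn : 2 ≤ (n : ℝ)) :
    ∃ K : ℝ≥0, ∀ H : ℝⁿ → ℝ≥0∞, Measurable H →
      ∫⁻ P, ∫⁻ Q, ‖P - Q‖ₑ ^ (-(n - 1 + 2 * α)) * (∫⁻ x,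
        (if ‖P - x‖ ≤ 3 * ‖P - Q‖ then ‖P - x‖ₑ ^ (-(n - 1 / 2 - α)) else 0) * H x) ^ 2 ∂σ ∂σ ≤
        K * ∫⁻ x, H x ^ 2 := by
  obtain ⟨K₁, hK₁⟩ := hσ.weightPotential_near (γ := 1 - α / 2) (a := n - 1 - α / 2) (by linarith)
    (by linarith) (by linarith) (by linarith) (by linarith)
  obtain ⟨K₂, hK₂⟩ := hσ.lintegral_far (b := n - 1 + α) (by linarith) (by linarith)
  set e : ℝ := n - 1 + (1 - α / 2) with he
  set m : ℝ := n - 1 / 2 - α with hm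
  refine ⟨K₁ * (3 ^ α : ℝ).toNNReal * K₂ * (4 ^ α : ℝ).toNNReal, fun H hH => ?_⟩
  have hS : MeasurableSet {p : (ℝⁿ × ℝⁿ) × ℝⁿ | ‖p.1.1 - p.2‖ ≤ 3 * ‖p.1.1 - p.1.2‖} :=
    measurableSet_le (by fun_prop) (by fun_prop)
  refine lintegral_sq_le_of_weight (e := e) (by linarith) (by linarith)
    (N := fun p => if ‖p.1.1 - p.2‖ ≤ 3 * ‖p.1.1 - p.1.2‖ then ‖p.1.1 - p.2‖ₑ ^ (-m) else 0)
    (W := fun p => if ‖p.1.1 - p.2‖ ≤ 3 * ‖p.1.1 - p.1.2‖ then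
      ‖p.1.1 - p.2‖ₑ ^ (-(n - 1 - α / 2)) else 0)
    (V := fun p => if ‖p.1.1 - p.2‖ ≤ 3 * ‖p.1.1 - p.1.2‖ then
      ‖p.1.1 - p.2‖ₑ ^ (-(n - 3 * α / 2)) else 0)
    (Measurable.ite hS (by fun_prop) (by fun_prop)) (Measurable.ite hS (by fun_prop) (by fun_prop))
    (ω := fun p => ‖p.1 - p.2‖ₑ ^ (-(n - 1 + 2 * α))) (by fun_prop) (fun p => ?_)
    (fun P x hx => ?_) hH
  · split_ifs
    · rw [ennreal_rpow_neg_mul_rpow_neg enorm_ne_top (by linarith) (by linarith),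
        ← ENNReal.rpow_mul_natCast]
      refine le_of_eq ?_
      congr 1
      push_cast
      ring
    · simp
  · classical
    have hW : ∀ Q, Q ≠ P → ∫⁻ y, (if ‖P - y‖ ≤ 3 * ‖P - Q‖ then
        ‖P - y‖ₑ ^ (-(n - 1 - α / 2)) else 0) * weightPotential σ e y ≤
        K₁ * ENNReal.ofReal ((3 * ‖P - Q‖) ^ α) := by
      intro Q hQ
      have hPQ : 0 < ‖P - Q‖ := norm_pos_iff.2 (sub_ne_zero.2 hQ.symm)
      have h1 := hK₁ P (3 * ‖P - Q‖) (by positivity)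
      rw [show (n : ℝ) - (n - 1 - α / 2) - (1 - α / 2) = α by ring,
        ← lintegral_indicator Metric.isClosed_closedBall.measurableSet] at h1
      refine le_trans (le_of_eq (lintegral_congr fun y => ?_)) h1
      rw [Set.indicator_apply, Metric.mem_closedBall, dist_comm, dist_eq_norm, ite_mul, zero_mul]
    have hPx : 0 < ‖P - x‖ := norm_pos_iff.2 (sub_ne_zero.2 hx.symm)
    calc _ ≤ ∫⁻ Q, (Metric.closedBall P (‖P - x‖ / 4))ᶜ.indicator (fun Q =>
          (K₁ * ENNReal.ofReal (3 ^ α) * ‖P - x‖ₑ ^ (-(n - 3 * α / 2))) *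
            ‖P - Q‖ₑ ^ (-(n - 1 + α))) Q ∂σ := by
          have h0 : ∀ᵐ Q ∂σ, Q ≠ P :=
            measure_eq_zero_iff_ae_notMem.1 (hσ.measure_singleton (by linarith) P)
          refine lintegral_mono_ae (h0.mono fun Q hQ => ?_)
          have hPQ : 0 < ‖P - Q‖ := norm_pos_iff.2 (sub_ne_zero.2 hQ.symm)
          by_cases hle : ‖P - x‖ ≤ 3 * ‖P - Q‖
          · rw [Set.indicator_of_mem (by
              rw [Set.mem_compl_iff, Metric.mem_closedBall, not_le, dist_comm, dist_eq_norm]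
              linarith)]
            simp only [if_pos hle]
            calc _ ≤ ‖P - Q‖ₑ ^ (-(n - 1 + 2 * α)) * (K₁ * ENNReal.ofReal ((3 * ‖P - Q‖) ^ α)) *
                  ‖P - x‖ₑ ^ (-(n - 3 * α / 2)) := by
                  gcongr
                  exact hW Q hQ
              _ = _ := by
                  rw [Real.mul_rpow (by norm_num) hPQ.le, ENNReal.ofReal_mul (by positivity),
                    ← enorm_rpow_eq_ofReal (norm_pos_iff.1 hPQ) α,
                    show (-(n - 1 + α) : ℝ) = -(n - 1 + 2 * α) + α by ring,
                    ENNReal.rpow_add _ _ (enorm_ne_zero.2 (norm_pos_iff.1 hPQ)) enorm_ne_top]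
                  ring
          · simp [hle]
      _ ≤ (K₁ * ENNReal.ofReal (3 ^ α) * ‖P - x‖ₑ ^ (-(n - 3 * α / 2))) *
          (K₂ * ENNReal.ofReal ((‖P - x‖ / 4) ^ ((n : ℝ) - 1 - (n - 1 + α)))) := by
          rw [lintegral_indicator Metric.isClosed_closedBall.measurableSet.compl,
            lintegral_const_mul _ (by fun_prop)]
          gcongr
          exact hK₂ P _ (by positivity)
      _ = _ := by
          push_cast
          simp_rw [ofReal_toNNReal_coe]
          rw [show (n : ℝ) - 1 - (n - 1 + α) = -α by ring, Real.div_rpow hPx.le (by norm_num),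
            Real.rpow_neg (by norm_num : (0 : ℝ) ≤ 4), div_inv_eq_mul,
            ENNReal.ofReal_mul (by positivity), ← enorm_rpow_eq_ofReal (norm_pos_iff.1 hPx),
            enorm_sub_rev x P, show -e = -(n - 3 * α / 2) + (-α) by rw [he]; ring,
            ENNReal.rpow_add _ _ (enorm_ne_zero.2 (norm_pos_iff.1 hPx)) enorm_ne_top]
          ring

/-- The part of the trace estimate where `|P - x| > 2 |P - Q|`, with the kernel that the mean value
bound provides. The Schur test applies with `e = n - α / 2`. The power `|P - x| ^ (-2(m + 1))` is
split into factors with the exponents `-(n - α / 2)` and `-(n + 1 - 3α / 2)`, so that the first is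
integrable against the weight at infinity, with result `O(|P - Q| ^ (α - 1))`, and the remaining
integral in `dσ(Q)`, over `|P - Q| < |P - x| / 2`, converges. -/
theorem UpperRegular.trace_far [IsFiniteMeasure σ] (hσ : UpperRegular σ (n - 1))
    (hα : 0 < α) (hα1 : α < 1 / 2) (hn : 2 ≤ (n : ℝ)) :
    ∃ K : ℝ≥0, ∀ H : ℝⁿ → ℝ≥0∞, Measurable H →
      ∫⁻ P, ∫⁻ Q, ‖P - Q‖ₑ ^ (-(n - 1 + 2 * α)) * (∫⁻ x, (if 2 * ‖P - Q‖ < ‖P - x‖ then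
        ‖P - Q‖ₑ * ‖P - x‖ₑ ^ (-(n - 1 / 2 - α + 1)) else 0) * H x) ^ 2 ∂σ ∂σ ≤
        K * ∫⁻ x, H x ^ 2 := by
  obtain ⟨K₁, hK₁⟩ := hσ.weightPotential_far (γ := 1 - α / 2) (a := n - α / 2)
    (by linarith) (by linarith) (by linarith) (by linarith) (by linarith)
  obtain ⟨K₂, hK₂⟩ := hσ.lintegral_near (b := n - 2 + α) (by linarith) (by linarith)
  set e : ℝ := n - 1 + (1 - α / 2) with he
  set m : ℝ := n - 1 / 2 - α with hm
  refine ⟨K₁ * (2 ^ (α - 1) : ℝ).toNNReal * K₂, fun H hH => ?_⟩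
  have hS : MeasurableSet {p : (ℝⁿ × ℝⁿ) × ℝⁿ | 2 * ‖p.1.1 - p.1.2‖ < ‖p.1.1 - p.2‖} :=
    measurableSet_lt (by fun_prop) (by fun_prop)
  refine lintegral_sq_le_of_weight (e := e) (by linarith) (by linarith)
    (N := fun p => if 2 * ‖p.1.1 - p.1.2‖ < ‖p.1.1 - p.2‖ then
      ‖p.1.1 - p.1.2‖ₑ * ‖p.1.1 - p.2‖ₑ ^ (-(m + 1)) else 0)
    (W := fun p => if 2 * ‖p.1.1 - p.1.2‖ < ‖p.1.1 - p.2‖ then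
      ‖p.1.1 - p.2‖ₑ ^ (-(n - α / 2)) else 0)
    (V := fun p => if 2 * ‖p.1.1 - p.1.2‖ < ‖p.1.1 - p.2‖ then
      ‖p.1.1 - p.1.2‖ₑ ^ 2 * ‖p.1.1 - p.2‖ₑ ^ (-(n + 1 - 3 * α / 2)) else 0)
    (Measurable.ite hS (by fun_prop) (by fun_prop)) (Measurable.ite hS (by fun_prop) (by fun_prop))
    (ω := fun p => ‖p.1 - p.2‖ₑ ^ (-(n - 1 + 2 * α))) (by fun_prop) (fun p => ?_)
    (fun P x hx => ?_) hH
  · split_ifs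
    · rw [mul_left_comm, ennreal_rpow_neg_mul_rpow_neg enorm_ne_top (by linarith) (by linarith),
        mul_pow, ← ENNReal.rpow_mul_natCast]
      refine le_of_eq ?_
      congr 2
      push_cast
      ring
    · simp
  · classical
    have hW : ∀ Q, Q ≠ P → ∫⁻ y, (if 2 * ‖P - Q‖ < ‖P - y‖ then
        ‖P - y‖ₑ ^ (-(n - α / 2)) else 0) * weightPotential σ e y ≤
        K₁ * ENNReal.ofReal ((2 * ‖P - Q‖) ^ (α - 1)) := by
      intro Q hQ
      have hPQ : 0 < ‖P - Q‖ := norm_pos_iff.2 (sub_ne_zero.2 hQ.symm)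
      have h1 := hK₁ P (2 * ‖P - Q‖) (by positivity)
      rw [show (n : ℝ) - (n - α / 2) - (1 - α / 2) = α - 1 by ring,
        ← lintegral_indicator Metric.isClosed_closedBall.measurableSet.compl] at h1
      refine le_trans (le_of_eq (lintegral_congr fun y => ?_)) h1
      simp_rw [Set.indicator_apply, Set.mem_compl_iff, Metric.mem_closedBall, not_le, dist_comm y,
        dist_eq_norm, ite_mul, zero_mul]
    have hPx : 0 < ‖P - x‖ := norm_pos_iff.2 (sub_ne_zero.2 hx.symm)
    calc _ ≤ ∫⁻ Q, (Metric.closedBall P ‖P - x‖).indicator (fun Q =>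
          (K₁ * ENNReal.ofReal (2 ^ (α - 1)) * ‖P - x‖ₑ ^ (-(n + 1 - 3 * α / 2))) *
            ‖P - Q‖ₑ ^ (-(n - 2 + α))) Q ∂σ := by
          have h0 : ∀ᵐ Q ∂σ, Q ≠ P :=
            measure_eq_zero_iff_ae_notMem.1 (hσ.measure_singleton (by linarith) P)
          refine lintegral_mono_ae (h0.mono fun Q hQ => ?_)
          have hPQ : 0 < ‖P - Q‖ := norm_pos_iff.2 (sub_ne_zero.2 hQ.symm)
          by_cases hlt : 2 * ‖P - Q‖ < ‖P - x‖
          · rw [Set.indicator_of_mem (by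
              rw [Metric.mem_closedBall, dist_comm, dist_eq_norm]
              linarith)]
            simp only [if_pos hlt]
            calc _ ≤ ‖P - Q‖ₑ ^ (-(n - 1 + 2 * α)) * (K₁ *
                  ENNReal.ofReal ((2 * ‖P - Q‖) ^ (α - 1))) *
                  (‖P - Q‖ₑ ^ 2 * ‖P - x‖ₑ ^ (-(n + 1 - 3 * α / 2))) := by
                  gcongr
                  exact hW Q hQ
              _ = _ := by
                  rw [Real.mul_rpow (by norm_num) hPQ.le, ENNReal.ofReal_mul (by positivity),
                    ← enorm_rpow_eq_ofReal (norm_pos_iff.1 hPQ) (α - 1), ← ENNReal.rpow_natCast,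
                    show (-(n - 2 + α) : ℝ) = -(n - 1 + 2 * α) + (α - 1) + (2 : ℕ) by
                      push_cast
                      ring,
                    ENNReal.rpow_add _ _ (enorm_ne_zero.2 (norm_pos_iff.1 hPQ)) enorm_ne_top,
                    ENNReal.rpow_add _ _ (enorm_ne_zero.2 (norm_pos_iff.1 hPQ)) enorm_ne_top]
                  ring
          · simp [hlt]
      _ ≤ (K₁ * ENNReal.ofReal (2 ^ (α - 1)) * ‖P - x‖ₑ ^ (-(n + 1 - 3 * α / 2))) *
          (K₂ * ENNReal.ofReal (‖P - x‖ ^ ((n : ℝ) - 1 - (n - 2 + α)))) := by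
          rw [lintegral_indicator Metric.isClosed_closedBall.measurableSet,
            lintegral_const_mul _ (by fun_prop)]
          gcongr
          exact hK₂ P _ hPx
      _ = _ := by
          push_cast
          simp_rw [ofReal_toNNReal_coe]
          rw [show (n : ℝ) - 1 - (n - 2 + α) = 1 - α by ring,
            ← enorm_rpow_eq_ofReal (norm_pos_iff.1 hPx),
            enorm_sub_rev x P, show -e = -(n + 1 - 3 * α / 2) + (1 - α) by rw [he]; ring,
            ENNReal.rpow_add _ _ (enorm_ne_zero.2 (norm_pos_iff.1 hPx)) enorm_ne_top]
          ring

/-- The trace estimate: the Riesz potential of order `α + 1 / 2` maps `L²(ℝⁿ)` into the Sobolev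
space of order `α` of a finite upper regular measure of dimension `n - 1`. Only the seminorm is
estimated here. -/
theorem UpperRegular.trace_seminorm_le [IsFiniteMeasure σ] (hσ : UpperRegular σ (n - 1))
    (hα : 0 < α) (hα1 : α < 1 / 2) (hn : 2 ≤ (n : ℝ)) :
    ∃ K : ℝ≥0, ∀ H : ℝⁿ → ℝ≥0∞, Measurable H →
      ∫⁻ P, ∫⁻ Q, ‖P - Q‖ₑ ^ (-(n - 1 + 2 * α)) * (∫⁻ x,
        ‖‖P - x‖ ^ (-(n - 1 / 2 - α) : ℝ) - ‖Q - x‖ ^ (-(n - 1 / 2 - α) : ℝ)‖ₑ * H x) ^ 2 ∂σ ∂σ ≤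
        K * ∫⁻ x, H x ^ 2 := by
  obtain ⟨K₁, hK₁⟩ := hσ.trace_near hα hα1 hn
  obtain ⟨K₂, hK₂⟩ := hσ.trace_far hα hα1 hn
  set m : ℝ := n - 1 / 2 - α with hm
  set c : ℝ≥0 := (m * 2 ^ (m + 1)).toNNReal with hc
  refine ⟨4 * K₁ + 4 * K₁ + 2 * c ^ 2 * K₂, fun H hH => ?_⟩
  have hm0 : 0 < m := by linarith
  have hS : MeasurableSet {p : (ℝⁿ × ℝⁿ) × ℝⁿ | ‖p.1.1 - p.2‖ ≤ 3 * ‖p.1.1 - p.1.2‖} :=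
    measurableSet_le (by fun_prop) (by fun_prop)
  have hS' : MeasurableSet {p : (ℝⁿ × ℝⁿ) × ℝⁿ | 2 * ‖p.1.1 - p.1.2‖ < ‖p.1.1 - p.2‖} :=
    measurableSet_lt (by fun_prop) (by fun_prop)
  set A : ℝⁿ × ℝⁿ → ℝ≥0∞ := fun p => ∫⁻ x,
    (if ‖p.1 - x‖ ≤ 3 * ‖p.1 - p.2‖ then ‖p.1 - x‖ₑ ^ (-m) else 0) * H x with hA
  set B : ℝⁿ × ℝⁿ → ℝ≥0∞ := fun p => ∫⁻ x, (if 2 * ‖p.1 - p.2‖ < ‖p.1 - x‖ then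
    ‖p.1 - p.2‖ₑ * ‖p.1 - x‖ₑ ^ (-(m + 1)) else 0) * H x with hB
  have hAm : Measurable A := Measurable.lintegral_prod_right' (f := fun q : (ℝⁿ × ℝⁿ) × ℝⁿ =>
    (if ‖q.1.1 - q.2‖ ≤ 3 * ‖q.1.1 - q.1.2‖ then ‖q.1.1 - q.2‖ₑ ^ (-m) else 0) * H q.2)
    ((Measurable.ite hS (by fun_prop) (by fun_prop)).mul (by fun_prop))
  have hBm : Measurable B := Measurable.lintegral_prod_right' (f := fun q : (ℝⁿ × ℝⁿ) × ℝⁿ =>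
    (if 2 * ‖q.1.1 - q.1.2‖ < ‖q.1.1 - q.2‖ then
      ‖q.1.1 - q.1.2‖ₑ * ‖q.1.1 - q.2‖ₑ ^ (-(m + 1)) else 0) * H q.2)
    ((Measurable.ite hS' (by fun_prop) (by fun_prop)).mul (by fun_prop))
  -- The near region of `enorm_rpow_neg_sub_le` contributes once for each of the two poles.
  have hpt : ∀ P Q : ℝⁿ, ∫⁻ x, ‖‖P - x‖ ^ (-m) - ‖Q - x‖ ^ (-m)‖ₑ * H x ≤
      A (P, Q) + A (Q, P) + c * B (P, Q) := by
    intro P Q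
    have hS1 : ∀ P Q : ℝⁿ, Measurable fun x : ℝⁿ =>
        (if ‖P - x‖ ≤ 3 * ‖P - Q‖ then ‖P - x‖ₑ ^ (-m) else 0) * H x := fun P Q =>
      (Measurable.ite (measurableSet_le (by fun_prop) (by fun_prop)) (by fun_prop)
        (by fun_prop)).mul hH
    have hS2 : Measurable fun x : ℝⁿ =>
        (if ‖P - x‖ ≤ 3 * ‖P - Q‖ then ‖P - x‖ₑ ^ (-m) else 0) * H x +
        (if ‖Q - x‖ ≤ 3 * ‖Q - P‖ then ‖Q - x‖ₑ ^ (-m) else 0) * H x := (hS1 P Q).add (hS1 Q P)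
    rw [hA, hB, ← lintegral_const_mul' _ _ ENNReal.coe_ne_top, ← lintegral_add_left (hS1 P Q),
      ← lintegral_add_left hS2]
    refine lintegral_mono fun x => ?_
    refine (mul_le_mul_left (enorm_rpow_neg_sub_le hm0 P Q x) (H x)).trans (le_of_eq ?_)
    rw [add_mul, add_mul, mul_assoc]
    rfl
  have hsq : ∀ a b d : ℝ≥0∞, (a + b + c * d) ^ 2 ≤ 4 * a ^ 2 + 4 * b ^ 2 + 2 * c ^ 2 * d ^ 2 := by
    intro a b d
    calc _ ≤ 2 * ((a + b) ^ 2 + (c * d) ^ 2) := ennreal_add_sq_le _ _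
      _ ≤ 2 * (2 * (a ^ 2 + b ^ 2) + (c * d) ^ 2) := by
          gcongr
          exact ennreal_add_sq_le _ _
      _ = _ := by ring
  set ω : ℝⁿ × ℝⁿ → ℝ≥0∞ := fun p => ‖p.1 - p.2‖ₑ ^ (-(n - 1 + 2 * α)) with hω
  have hωm : Measurable ω := by fun_prop
  calc _ ≤ ∫⁻ P, ∫⁻ Q, 4 * (ω (P, Q) * A (P, Q) ^ 2) + 4 * (ω (P, Q) * A (Q, P) ^ 2) +
        2 * c ^ 2 * (ω (P, Q) * B (P, Q) ^ 2) ∂σ ∂σ := by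
        refine lintegral_mono fun P => lintegral_mono fun Q => ?_
        calc _ ≤ ω (P, Q) * (4 * A (P, Q) ^ 2 + 4 * A (Q, P) ^ 2 + 2 * c ^ 2 * B (P, Q) ^ 2) := by
              refine mul_le_mul_right (le_trans ?_ (hsq _ _ _)) _
              gcongr
              exact hpt P Q
          _ = _ := by ring
    _ = 4 * (∫⁻ P, ∫⁻ Q, ω (P, Q) * A (P, Q) ^ 2 ∂σ ∂σ) +
        4 * (∫⁻ P, ∫⁻ Q, ω (P, Q) * A (Q, P) ^ 2 ∂σ ∂σ) +
        2 * c ^ 2 * (∫⁻ P, ∫⁻ Q, ω (P, Q) * B (P, Q) ^ 2 ∂σ ∂σ) := by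
        have hm1 : Measurable fun p : ℝⁿ × ℝⁿ => ω p * A p ^ 2 := by fun_prop
        have hm2 : Measurable fun p : ℝⁿ × ℝⁿ => ω p * A p.swap ^ 2 :=
          hωm.mul ((hAm.comp measurable_swap).pow_const 2)
        have hm3 : Measurable fun p : ℝⁿ × ℝⁿ => ω p * B p ^ 2 := by fun_prop
        have hm4 : Measurable fun p : ℝⁿ × ℝⁿ => 4 * (ω p * A p ^ 2) + 4 * (ω p * A p.swap ^ 2) :=
          (hm1.const_mul 4).add (hm2.const_mul 4)
        have e1 := lintegral_prod (μ := σ) (ν := σ) _ hm1.aemeasurable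
        have e2 := lintegral_prod (μ := σ) (ν := σ) _ hm2.aemeasurable
        have e3 := lintegral_prod (μ := σ) (ν := σ) _ hm3.aemeasurable
        have e4 := lintegral_prod (μ := σ) (ν := σ) (fun p : ℝⁿ × ℝⁿ => 4 * (ω p * A p ^ 2) +
          4 * (ω p * A p.swap ^ 2) + 2 * c ^ 2 * (ω p * B p ^ 2))
          (hm4.add (hm3.const_mul _)).aemeasurable
        simp only [Prod.swap_prod_mk] at e2 e4
        rw [← e1, ← e2, ← e3, ← e4, lintegral_add_left hm4,
          lintegral_add_left (hm1.const_mul 4), lintegral_const_mul _ hm1,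
          lintegral_const_mul _ hm2, lintegral_const_mul _ hm3]
    _ ≤ 4 * (K₁ * ∫⁻ x, H x ^ 2) + 4 * (K₁ * ∫⁻ x, H x ^ 2) +
        2 * c ^ 2 * (K₂ * ∫⁻ x, H x ^ 2) := by
        gcongr
        · exact hK₁ H hH
        · refine le_trans (le_of_eq ?_) (hK₁ H hH)
          rw [lintegral_lintegral_swap (by
            exact (hωm.mul ((hAm.comp measurable_swap).pow_const 2)).aemeasurable)]
          refine lintegral_congr fun P => lintegral_congr fun Q => ?_
          simp only [hω, enorm_sub_rev Q P]
          rfl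
        · exact hK₂ H hH
    _ = _ := by
        push_cast
        ring

end Trace

/-! ### Surface measure of a Lipschitz domain -/

section Surface

variable {n : ℕ}

local notation "ℝⁿ" => EuclideanSpace ℝ (Fin n)

/-- Near a boundary point the boundary lies on the graph of the Lipschitz function. -/
theorem eq_of_mem_frontier_of_locally_graph {Ω : Set ℝⁿ} {e p : ℝⁿ} {g : (ℝ ∙ e)ᗮ → ℝ}
    (hg : Continuous g) {r : ℝ} (h : ∀ x ∈ Metric.ball p r,
      (x ∈ Ω ↔ g ((ℝ ∙ e)ᗮ.orthogonalProjectionOnto x) < inner ℝ e x))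
    {z : ℝⁿ} (hz : z ∈ frontier Ω) (hzr : z ∈ Metric.ball p r) :
    g ((ℝ ∙ e)ᗮ.orthogonalProjectionOnto z) = inner ℝ e z := by
  have hc1 : Continuous fun x : ℝⁿ => g ((ℝ ∙ e)ᗮ.orthogonalProjectionOnto x) :=
    hg.comp (ContinuousLinearMap.continuous _)
  have hc2 : Continuous fun x : ℝⁿ => inner ℝ e x := by fun_prop
  have hb : Metric.ball p r ∈ nhds z := Metric.isOpen_ball.mem_nhds hzr
  rcases lt_trichotomy (g ((ℝ ∙ e)ᗮ.orthogonalProjectionOnto z)) (inner ℝ e z) with hlt | heq | hgt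
  · refine absurd ?_ hz.2
    rw [mem_interior_iff_mem_nhds]
    filter_upwards [hb, (isOpen_lt hc1 hc2).mem_nhds hlt] with x hx1 hx2
    exact (h x hx1).2 hx2
  · exact heq
  · have := mem_closure_iff_nhds.1 hz.1 _ (Filter.inter_mem hb ((isOpen_lt hc2 hc1).mem_nhds hgt))
    obtain ⟨x, ⟨hx1, hx2⟩, hx3⟩ := this
    exact absurd ((h x hx1).1 hx3) (lt_asymm hx2)

/-- A Lipschitz graph over a hyperplane is upper regular of dimension `n - 1`: the part of it in a
ball is the image, under a Lipschitz map, of a part of a ball of the same radius in the hyperplane.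
-/
theorem exists_euclideanHausdorffMeasure_graph_le {e : ℝⁿ} (he : ‖e‖ = 1) {K : ℝ≥0}
    {g : (ℝ ∙ e)ᗮ → ℝ} (hg : LipschitzWith K g) {S : Set ℝⁿ}
    (hS : ∀ z ∈ S, g ((ℝ ∙ e)ᗮ.orthogonalProjectionOnto z) = inner ℝ e z) :
    ∃ C : ℝ≥0, ∀ (x : ℝⁿ) (ρ : ℝ), 0 < ρ →
      μHE[n - 1] (S ∩ Metric.closedBall x ρ) ≤ C * ENNReal.ofReal (ρ ^ ((n : ℝ) - 1)) := by
  have he0 : e ≠ 0 := norm_pos_iff.1 (by rw [he]; exact one_pos)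
  have hrank : Module.finrank ℝ (ℝ ∙ e)ᗮ = n - 1 := by
    have h1 := (ℝ ∙ e).finrank_add_finrank_orthogonal
    rw [finrank_span_singleton he0, finrank_euclideanSpace_fin] at h1
    omega
  have hn : 1 ≤ n := by
    by_contra h0
    have : n = 0 := by omega
    subst this
    exact he0 (Subsingleton.elim _ _)
  obtain ⟨C, hC⟩ := upperRegular_volume (E := (ℝ ∙ e)ᗮ)
  rw [hrank, Nat.cast_sub hn, Nat.cast_one] at hC
  have hvol : (μHE[n - 1] : Measure (ℝ ∙ e)ᗮ) = volume := by
    rw [← hrank]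
    exact InnerProductSpace.euclideanHausdorffMeasure_eq_volume
  set G : (ℝ ∙ e)ᗮ → ℝⁿ := fun y => (y : ℝⁿ) + g y • e with hG
  have hGL : LipschitzWith (1 + K) G := by
    refine LipschitzWith.add (LipschitzWith.subtype_val _) ?_
    refine LipschitzWith.of_dist_le_mul fun y y' => ?_
    rw [dist_eq_norm, ← sub_smul, norm_smul, he, mul_one, ← dist_eq_norm]
    exact hg.dist_le_mul y y'
  refine ⟨(1 + K) ^ ((n - 1 : ℕ) : ℝ) * C, fun x ρ hρ => ?_⟩
  have hsub : S ∩ Metric.closedBall x ρ ⊆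
      G '' Metric.closedBall ((ℝ ∙ e)ᗮ.orthogonalProjectionOnto x) ρ := by
    rintro z ⟨hzS, hzρ⟩
    refine ⟨(ℝ ∙ e)ᗮ.orthogonalProjectionOnto z, ?_, ?_⟩
    · rw [Metric.mem_closedBall, dist_eq_norm, ← map_sub]
      refine ((ℝ ∙ e)ᗮ.norm_orthogonalProjectionOnto_apply_le _).trans ?_
      rwa [← dist_eq_norm]
    · have h1 := (ℝ ∙ e).starProjection_add_starProjection_orthogonal z
      rw [Submodule.starProjection_unit_singleton ℝ he z, add_comm] at h1
      simp only [hG, hS z hzS]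
      exact h1
  calc μHE[n - 1] (S ∩ Metric.closedBall x ρ)
      ≤ μHE[n - 1] (G '' Metric.closedBall ((ℝ ∙ e)ᗮ.orthogonalProjectionOnto x) ρ) :=
        measure_mono hsub
    _ ≤ (((1 + K : ℝ≥0) : ℝ≥0∞) ^ ((n - 1 : ℕ) : ℝ)) *
        μHE[n - 1] (Metric.closedBall ((ℝ ∙ e)ᗮ.orthogonalProjectionOnto x) ρ) := by
        rw [Measure.euclideanHausdorffMeasure_def, Measure.euclideanHausdorffMeasure_def,
          Measure.smul_apply, Measure.smul_apply, ENNReal.smul_def, ENNReal.smul_def, smul_eq_mul,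
          smul_eq_mul, mul_left_comm]
        exact mul_le_mul_right (hGL.hausdorffMeasure_image_le (Nat.cast_nonneg _) _) _
    _ ≤ (((1 + K : ℝ≥0) : ℝ≥0∞) ^ ((n - 1 : ℕ) : ℝ)) *
        (C * ENNReal.ofReal (ρ ^ ((n : ℝ) - 1))) := by
        rw [hvol]
        gcongr
        exact hC _ _ hρ
    _ = _ := by
        rw [ENNReal.coe_mul, ← ENNReal.coe_rpow_of_nonneg _ (Nat.cast_nonneg _), mul_assoc]

variable {Ω : Set (EuclideanSpace ℝ (Fin n))}

theorem IsBoundedLipschitzDomain.isCompact_frontier (hΩ : IsBoundedLipschitzDomain Ω) :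
    IsCompact (frontier Ω) :=
  Metric.isCompact_of_isClosed_isBounded isClosed_frontier
    (hΩ.isBounded.closure.subset frontier_subset_closure)

/-- The surface measure of a bounded Lipschitz domain is upper regular of dimension `n - 1`, since
its compact boundary is covered by finitely many Lipschitz graphs. -/
theorem IsBoundedLipschitzDomain.upperRegular (hΩ : IsBoundedLipschitzDomain Ω) :
    UpperRegular (surfaceMeasure Ω) (n - 1) := by
  suffices h : ∃ C : ℝ≥0, ∀ (x : ℝⁿ) (ρ : ℝ), 0 < ρ →
      μHE[n - 1] (frontier Ω ∩ Metric.closedBall x ρ) ≤ C * ENNReal.ofReal (ρ ^ ((n : ℝ) - 1)) by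
    obtain ⟨C, hC⟩ := h
    refine ⟨C, fun x ρ hρ => ?_⟩
    rw [surfaceMeasure, Measure.restrict_apply Metric.isClosed_closedBall.measurableSet,
      Set.inter_comm]
    exact hC x ρ hρ
  refine hΩ.isCompact_frontier.induction_on (p := fun S => ∃ C : ℝ≥0, ∀ (x : ℝⁿ) (ρ : ℝ), 0 < ρ →
      μHE[n - 1] (S ∩ Metric.closedBall x ρ) ≤ C * ENNReal.ofReal (ρ ^ ((n : ℝ) - 1))) ?_ ?_ ?_ ?_
  · exact ⟨0, fun x ρ _ => by simp⟩
  · rintro S T hST ⟨C, hC⟩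
    exact ⟨C, fun x ρ hρ => (measure_mono (Set.inter_subset_inter_left _ hST)).trans (hC x ρ hρ)⟩
  · rintro S T ⟨C, hC⟩ ⟨C', hC'⟩
    refine ⟨C + C', fun x ρ hρ => ?_⟩
    rw [Set.union_inter_distrib_right, ENNReal.coe_add, add_mul]
    exact (measure_union_le _ _).trans (add_le_add (hC x ρ hρ) (hC' x ρ hρ))
  · intro p hp
    obtain ⟨e, he, K, g, hg, r, hr, h⟩ := hΩ.locally_graph p hp
    refine ⟨frontier Ω ∩ Metric.ball p r, inter_mem_nhdsWithin _ (Metric.ball_mem_nhds p hr), ?_⟩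
    exact exists_euclideanHausdorffMeasure_graph_le he hg fun z hz =>
      eq_of_mem_frontier_of_locally_graph hg.continuous h hz.1 hz.2

theorem IsBoundedLipschitzDomain.isFiniteMeasure (hΩ : IsBoundedLipschitzDomain Ω) :
    IsFiniteMeasure (surfaceMeasure Ω) := by
  obtain ⟨C, hC⟩ := hΩ.upperRegular
  obtain ⟨R, hR, hsub⟩ := hΩ.isCompact_frontier.isBounded.subset_closedBall_lt 0 0
  refine ⟨?_⟩
  have h1 : surfaceMeasure Ω Set.univ = surfaceMeasure Ω (Metric.closedBall 0 R) := by
    rw [surfaceMeasure, Measure.restrict_apply MeasurableSet.univ, Measure.restrict_apply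
      Metric.isClosed_closedBall.measurableSet, Set.univ_inter, Set.inter_eq_right.2 hsub]
  rw [h1]
  exact (hC 0 R hR).trans_lt (ENNReal.mul_lt_top ENNReal.coe_lt_top ENNReal.ofReal_lt_top)

/-- The boundary is a Lebesgue null set, because its Hausdorff measure of dimension `n - 1` is
finite. -/
theorem IsBoundedLipschitzDomain.volume_frontier (hΩ : IsBoundedLipschitzDomain Ω) (hn : 1 ≤ n) :
    volume (frontier Ω) = 0 := by
  have := hΩ.isFiniteMeasure
  have h1 := Measure.euclideanHausdorffMeasure_zero_or_top (show n - 1 < n by omega) (frontier Ω)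
  rw [EuclideanSpace.euclideanHausdorffMeasure_eq_volume] at h1
  refine h1.resolve_right fun h2 => ?_
  have h3 := measure_lt_top (surfaceMeasure Ω) Set.univ
  rw [surfaceMeasure, Measure.restrict_apply MeasurableSet.univ, Set.univ_inter, h2] at h3
  exact lt_irrefl _ h3

theorem ae_mem_frontier_surfaceMeasure (Ω : Set ℝⁿ) : ∀ᵐ P ∂(surfaceMeasure Ω), P ∈ frontier Ω :=
  ae_restrict_mem isClosed_frontier.measurableSet

end Surface

/-! ### The Sobolev norm on the boundary -/

section SobolevEnergy

variable {n : ℕ} {Ω : Set (EuclideanSpace ℝ (Fin n))} {α : ℝ}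

local notation "ℝⁿ" => EuclideanSpace ℝ (Fin n)

/-- The square of the norm of `H^α(∂Ω)`, as an iterated integral with values in `[0, ∞]`. -/
noncomputable def sobolevEnergy (Ω : Set ℝⁿ) (α : ℝ) (f : ℝⁿ → ℂ) : ℝ≥0∞ :=
  (∫⁻ P, ‖f P‖ₑ ^ 2 ∂(surfaceMeasure Ω)) +
    ∫⁻ P, ∫⁻ Q, ‖P - Q‖ₑ ^ (-(n - 1 + 2 * α)) * ‖f P - f Q‖ₑ ^ 2
      ∂(surfaceMeasure Ω) ∂(surfaceMeasure Ω)

theorem enorm_weightedDiff_sq_le (f : ℝⁿ → ℂ) (z : ℝⁿ × ℝⁿ) :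
    ‖weightedDiff α f z‖ₑ ^ 2 ≤
      ‖z.1 - z.2‖ₑ ^ (-(n - 1 + 2 * α)) * ‖f z.1 - f z.2‖ₑ ^ 2 := by
  rcases eq_or_ne z.1 z.2 with h | h
  · simp [weightedDiff, h]
  · have h0 : 0 < ‖z.1 - z.2‖ := norm_pos_iff.2 (sub_ne_zero.2 h)
    rw [weightedDiff, enorm_mul, mul_pow, enorm_rpow_eq_ofReal (sub_ne_zero.2 h)]
    refine le_of_eq ?_
    congr 1
    rw [← ofReal_norm, Complex.norm_real, Real.norm_of_nonneg (by positivity),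
      ← ENNReal.ofReal_pow (by positivity), ← Real.rpow_neg h0.le, ← Real.rpow_mul_natCast h0.le]
    congr 2
    push_cast
    ring

theorem lintegral_weightedDiff_sq_le (f : ℝⁿ → ℂ) :
    ∫⁻ z, ‖weightedDiff α f z‖ₑ ^ 2 ∂((surfaceMeasure Ω).prod (surfaceMeasure Ω)) ≤
      ∫⁻ P, ∫⁻ Q, ‖P - Q‖ₑ ^ (-(n - 1 + 2 * α)) * ‖f P - f Q‖ₑ ^ 2
        ∂(surfaceMeasure Ω) ∂(surfaceMeasure Ω) :=
  (lintegral_mono fun z => enorm_weightedDiff_sq_le f z).trans (lintegral_prod_le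
    (fun z : ℝⁿ × ℝⁿ => ‖z.1 - z.2‖ₑ ^ (-(n - 1 + 2 * α)) * ‖f z.1 - f z.2‖ₑ ^ 2))

theorem memLp_two_of_lintegral_sq_lt_top {X F : Type*} [MeasurableSpace X] {μ : Measure X}
    [NormedAddCommGroup F] {f : X → F}
    (hf : AEStronglyMeasurable f μ) (h : ∫⁻ x, ‖f x‖ₑ ^ 2 ∂μ < ∞) : MemLp f 2 μ := by
  refine ⟨hf, ?_⟩
  rw [eLpNorm_lt_top_iff_lintegral_rpow_enorm_lt_top (by norm_num) (by norm_num)]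
  simpa using h

theorem lintegral_enorm_sq_eq_eLpNorm_sq {X F : Type*} [MeasurableSpace X] {μ : Measure X}
    [NormedAddCommGroup F] (f : X → F) : ∫⁻ x, ‖f x‖ₑ ^ 2 ∂μ = eLpNorm f 2 μ ^ 2 := by
  have := eLpNorm_nnreal_pow_eq_lintegral (f := f) (μ := μ) (p := 2) (by norm_num)
  norm_num at this
  exact_mod_cast this.symm

theorem memBoundarySobolev_of_sobolevEnergy_lt_top [SFinite (surfaceMeasure Ω)] {f : ℝⁿ → ℂ}
    (hf : AEStronglyMeasurable f (surfaceMeasure Ω)) (h : sobolevEnergy Ω α f < ∞) :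
    MemBoundarySobolev Ω α f := by
  refine ⟨memLp_two_of_lintegral_sq_lt_top hf (lt_of_le_of_lt le_self_add h),
    memLp_two_of_lintegral_sq_lt_top ?_ ((lintegral_weightedDiff_sq_le f).trans_lt
      (lt_of_le_of_lt le_add_self h))⟩
  refine AEStronglyMeasurable.mul (Measurable.aestronglyMeasurable (by fun_prop)) (.sub ?_ ?_)
  · exact hf.comp_quasiMeasurePreserving Measure.quasiMeasurePreserving_fst
  · exact hf.comp_quasiMeasurePreserving Measure.quasiMeasurePreserving_snd

/-- The energy is an iterated integral, which for integrands without any measurability is only an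
upper bound for the integral over the product that defines the norm. -/
theorem BoundarySobolev.enorm_mk_sq_le {f : ℝⁿ → ℂ} (hf : MemBoundarySobolev Ω α f) :
    ‖BoundarySobolev.mk hf‖ₑ ^ 2 ≤ sobolevEnergy Ω α f := by
  have h1 : (BoundarySobolev.toL2 Ω α (BoundarySobolev.mk hf) : ℝⁿ → ℂ) =ᵐ[surfaceMeasure Ω] f :=
    hf.1.coeFn_toLp
  rw [← ofReal_norm, ← ENNReal.ofReal_pow (norm_nonneg _), BoundarySobolev.norm_sq_eq,
    ENNReal.ofReal_add (by positivity) (by positivity), ENNReal.ofReal_pow (norm_nonneg _),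
    ENNReal.ofReal_pow (norm_nonneg _), Lp.norm_def, Lp.norm_def,
    ENNReal.ofReal_toReal (Lp.eLpNorm_ne_top _), ENNReal.ofReal_toReal (Lp.eLpNorm_ne_top _),
    ← lintegral_enorm_sq_eq_eLpNorm_sq, eLpNorm_congr_ae (MemLp.coeFn_toLp _),
    ← lintegral_enorm_sq_eq_eLpNorm_sq]
  refine add_le_add (le_of_eq (lintegral_congr_ae (h1.mono fun x hx => ?_)))
    (le_trans (le_of_eq (lintegral_congr_ae ((weightedDiff_congr_ae α h1).mono fun x hx => ?_)))
      (lintegral_weightedDiff_sq_le f))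
  · simp only [hx]
  · simp only [hx]

/-- A function that is bounded by `M` and `L`-Lipschitz on `∂Ω` has Sobolev energy
`O(M ^ 2 + L ^ 2)`. -/
theorem IsBoundedLipschitzDomain.sobolevEnergy_le (hΩ : IsBoundedLipschitzDomain Ω)
    (hα : 0 ≤ α) (hα1 : α < 1 / 2) (hn : 2 ≤ (n : ℝ)) :
    ∃ C : ℝ≥0, ∀ (f : ℝⁿ → ℂ) (M L : ℝ≥0), (∀ P ∈ frontier Ω, ‖f P‖ₑ ≤ M) →
      (∀ P ∈ frontier Ω, ∀ Q ∈ frontier Ω, ‖f P - f Q‖ₑ ≤ L * ‖P - Q‖ₑ) →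
      sobolevEnergy Ω α f ≤ C * (M ^ 2 + L ^ 2) := by
  have hfin := hΩ.isFiniteMeasure
  obtain ⟨K, hK⟩ := hΩ.upperRegular.lintegral_near (b := n - 2 + 2 * α) (by linarith) (by linarith)
  obtain ⟨R, hR, hsub⟩ := hΩ.isCompact_frontier.isBounded.subset_closedBall_lt 0 0
  set σ := surfaceMeasure Ω with hσ
  set D : ℝ := R + R with hD
  have hdist : ∀ P ∈ frontier Ω, ∀ Q ∈ frontier Ω, ‖P - Q‖ ≤ D := fun P hP Q hQ => by
    have h1 := mem_closedBall_zero_iff.1 (hsub hP)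
    have h2 := mem_closedBall_zero_iff.1 (hsub hQ)
    exact (norm_sub_le _ _).trans (add_le_add h1 h2)
  set c : ℝ≥0∞ := ENNReal.ofReal D * (K * ENNReal.ofReal (D ^ ((n : ℝ) - 1 - (n - 2 + 2 * α)))) *
    σ Set.univ with hc
  have hct : c ≠ ∞ := by
    rw [hc]
    exact ENNReal.mul_ne_top (ENNReal.mul_ne_top ENNReal.ofReal_ne_top (ENNReal.mul_ne_top
      ENNReal.coe_ne_top ENNReal.ofReal_ne_top)) (measure_ne_top _ _)
  refine ⟨(σ Set.univ).toNNReal + c.toNNReal, fun f M L hM hL => ?_⟩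
  rw [ENNReal.coe_add, ENNReal.coe_toNNReal hct, ENNReal.coe_toNNReal (measure_ne_top _ _)]
  have hae := ae_mem_frontier_surfaceMeasure Ω
  have h1 : ∫⁻ P, ‖f P‖ₑ ^ 2 ∂σ ≤ σ Set.univ * M ^ 2 := by
    calc _ ≤ ∫⁻ _, (M : ℝ≥0∞) ^ 2 ∂σ := lintegral_mono_ae (hae.mono fun P hP => by
          gcongr
          exact hM P hP)
      _ = _ := by rw [lintegral_const, mul_comm]
  have h2 : ∫⁻ P, ∫⁻ Q, ‖P - Q‖ₑ ^ (-(n - 1 + 2 * α)) * ‖f P - f Q‖ₑ ^ 2 ∂σ ∂σ ≤ c * L ^ 2 := by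
    calc _ ≤ ∫⁻ _, (L : ℝ≥0∞) ^ 2 * (ENNReal.ofReal D *
          (K * ENNReal.ofReal (D ^ ((n : ℝ) - 1 - (n - 2 + 2 * α))))) ∂σ := by
          refine lintegral_mono_ae (hae.mono fun P hP => ?_)
          -- One of the two factors `‖P - Q‖` is bounded by `D`; the other makes the singularity
          -- integrable, as `α < 1 / 2`.
          calc _ ≤ ∫⁻ Q, (Metric.closedBall P D).indicator (fun Q => (L : ℝ≥0∞) ^ 2 *
                ENNReal.ofReal D * ‖P - Q‖ₑ ^ (-(n - 2 + 2 * α))) Q ∂σ := by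
                refine lintegral_mono_ae (hae.mono fun Q hQ => ?_)
                have hPQ := hdist P hP Q hQ
                rw [Set.indicator_of_mem (by rwa [Metric.mem_closedBall, dist_comm, dist_eq_norm])]
                rcases eq_or_ne P Q with rfl | hne
                · simp
                have h0 : ‖P - Q‖ₑ ≠ 0 := enorm_ne_zero.2 (sub_ne_zero.2 hne)
                calc _ ≤ ‖P - Q‖ₑ ^ (-(n - 1 + 2 * α)) * (L * ‖P - Q‖ₑ) ^ 2 := by
                      gcongr
                      exact hL P hP Q hQ
                  _ = L ^ 2 * ‖P - Q‖ₑ * (‖P - Q‖ₑ ^ (-(n - 1 + 2 * α)) * ‖P - Q‖ₑ ^ (1 : ℝ)) := by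
                      rw [ENNReal.rpow_one]
                      ring
                  _ = L ^ 2 * ‖P - Q‖ₑ * ‖P - Q‖ₑ ^ (-(n - 2 + 2 * α)) := by
                      rw [← ENNReal.rpow_add _ _ h0 enorm_ne_top]
                      congr 2
                      ring
                  _ ≤ _ := by
                      gcongr
                      rw [← ofReal_norm]
                      exact ENNReal.ofReal_le_ofReal hPQ
            _ ≤ _ := by
                rw [lintegral_indicator Metric.isClosed_closedBall.measurableSet,
                  lintegral_const_mul _ (by fun_prop), mul_assoc]
                gcongr
                exact hK P D (by positivity)
      _ = _ := by
          rw [lintegral_const, hc]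
          ring
  calc _ ≤ σ Set.univ * M ^ 2 + c * L ^ 2 := add_le_add h1 h2
    _ ≤ (σ Set.univ * M ^ 2 + c * L ^ 2) + (c * M ^ 2 + σ Set.univ * L ^ 2) := le_self_add
    _ = _ := by ring

end SobolevEnergy

/-! ### Riesz potentials of square integrable functions -/

section RieszPotential

variable {n : ℕ}

local notation "ℝⁿ" => EuclideanSpace ℝ (Fin n)

/-- The (unnormalised) Riesz potential `∫ |P - x| ^ (-m) h x dx`. -/
noncomputable def rieszPotential (m : ℝ) (h : ℝⁿ → ℂ) (P : ℝⁿ) : ℂ :=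
  ∫ x, ((‖P - x‖ ^ (-m) : ℝ) : ℂ) * h x

theorem enorm_norm_rpow_neg_le {m : ℝ} (hm : 0 < m) (z : ℝⁿ) : ‖‖z‖ ^ (-m)‖ₑ ≤ ‖z‖ₑ ^ (-m) := by
  rcases eq_or_ne z 0 with rfl | hz
  · simp [ENNReal.zero_rpow_of_neg, hm]
  · rw [enorm_rpow_eq_ofReal hz, Real.enorm_of_nonneg (by positivity)]

theorem enorm_ofReal_complex (a : ℝ) : ‖(a : ℂ)‖ₑ = ‖a‖ₑ := by
  rw [← ofReal_norm, Complex.norm_real, ofReal_norm]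

theorem enorm_rieszPotential_le {m : ℝ} (hm : 0 < m) (h : ℝⁿ → ℂ) (P : ℝⁿ) :
    ‖rieszPotential m h P‖ₑ ≤ ∫⁻ x, ‖P - x‖ₑ ^ (-m) * ‖h x‖ₑ := by
  refine (enorm_integral_le_lintegral_enorm _).trans (lintegral_mono fun x => ?_)
  rw [enorm_mul, enorm_ofReal_complex]
  gcongr
  exact enorm_norm_rpow_neg_le hm _

theorem stronglyMeasurable_rieszPotential (m : ℝ) {h : ℝⁿ → ℂ} (hh : StronglyMeasurable h) :
    StronglyMeasurable (rieszPotential m h) := by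
  have : StronglyMeasurable fun p : ℝⁿ × ℝⁿ => ((‖p.1 - p.2‖ ^ (-m) : ℝ) : ℂ) * h p.2 :=
    (Measurable.stronglyMeasurable (by fun_prop)).mul (hh.comp_measurable measurable_snd)
  exact this.integral_prod_right

theorem integrable_riesz_of_lintegral_lt_top {m : ℝ} (hm : 0 < m) {h : ℝⁿ → ℂ}
    (hh : StronglyMeasurable h) {P : ℝⁿ} (hP : ∫⁻ x, ‖P - x‖ₑ ^ (-m) * ‖h x‖ₑ < ∞) :
    Integrable fun x => ((‖P - x‖ ^ (-m) : ℝ) : ℂ) * h x := by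
  refine ⟨((Measurable.stronglyMeasurable (by fun_prop)).mul hh).aestronglyMeasurable,
    lt_of_le_of_lt (lintegral_mono fun x => ?_) hP⟩
  rw [enorm_mul, enorm_ofReal_complex]
  gcongr
  exact enorm_norm_rpow_neg_le hm _

/-- The Riesz potential of a square integrable function converges absolutely at almost every point.
-/
theorem UpperRegular.ae_integrable_riesz {σ : Measure ℝⁿ} [IsFiniteMeasure σ] {d m : ℝ}
    (hσ : UpperRegular σ d) (hm : n < 2 * m) (hmn : m < n) (hd : 2 * m - n < d) {h : ℝⁿ → ℂ}
    (hh : StronglyMeasurable h) (hfin : ∫⁻ x, ‖h x‖ₑ ^ 2 < ∞) :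
    ∀ᵐ P ∂σ, Integrable fun x => ((‖P - x‖ ^ (-m) : ℝ) : ℂ) * h x := by
  obtain ⟨K, hK⟩ := hσ.lintegral_riesz_sq_le hm hmn hd
  have hn0 : (0 : ℝ) ≤ n := n.cast_nonneg
  have h1 := (hK _ hh.enorm).trans_lt (ENNReal.mul_lt_top ENNReal.coe_lt_top hfin)
  have hmeas : Measurable fun P : ℝⁿ => ∫⁻ x, ‖P - x‖ₑ ^ (-m) * ‖h x‖ₑ :=
    Measurable.lintegral_prod_right' (f := fun p : ℝⁿ × ℝⁿ => ‖p.1 - p.2‖ₑ ^ (-m) * ‖h p.2‖ₑ)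
      (Measurable.mul (by fun_prop) (hh.enorm.comp measurable_snd))
  filter_upwards [ae_lt_top (hmeas.pow_const 2) h1.ne] with P hP
  refine integrable_riesz_of_lintegral_lt_top (by linarith) hh ?_
  exact (ENNReal.pow_lt_top_iff (n := 2)).1 hP |>.resolve_right (by norm_num)

end RieszPotential

/-! ### Functionals on the boundary Sobolev space as functions in `L²(ℝⁿ)` -/

section Duality

variable {n : ℕ} {Ω : Set (EuclideanSpace ℝ (Fin n))} {α : ℝ}

local notation "ℝⁿ" => EuclideanSpace ℝ (Fin n)

/-- The trace estimate in terms of the norm of `H^α(∂Ω)`. -/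
theorem IsBoundedLipschitzDomain.sobolevEnergy_rieszPotential_le
    (hΩ : IsBoundedLipschitzDomain Ω) (hα : 0 < α) (hα1 : α < 1 / 2) (hn : 2 ≤ (n : ℝ)) :
    ∃ K : ℝ≥0, ∀ h : ℝⁿ → ℂ, StronglyMeasurable h → ∫⁻ x, ‖h x‖ₑ ^ 2 < ∞ →
      sobolevEnergy Ω α (rieszPotential (n - 1 / 2 - α) h) ≤ K * ∫⁻ x, ‖h x‖ₑ ^ 2 := by
  have hfin := hΩ.isFiniteMeasure
  obtain ⟨K₁, hK₁⟩ := hΩ.upperRegular.lintegral_riesz_sq_le (m := n - 1 / 2 - α) (by linarith)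
    (by linarith) (by linarith)
  obtain ⟨K₂, hK₂⟩ := hΩ.upperRegular.trace_seminorm_le hα hα1 hn
  refine ⟨K₁ + K₂, fun h hh hf => ?_⟩
  have hae := hΩ.upperRegular.ae_integrable_riesz (m := n - 1 / 2 - α) (by linarith)
    (by linarith) (by linarith) hh hf
  rw [ENNReal.coe_add, add_mul]
  refine add_le_add (le_trans (lintegral_mono fun P => ?_) (hK₁ _ hh.enorm))
    (le_trans (lintegral_mono_ae (hae.mono fun P hP => lintegral_mono_ae
      (hae.mono fun Q hQ => ?_))) (hK₂ _ hh.enorm))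
  · gcongr
    exact enorm_rieszPotential_le (by linarith) h P
  · gcongr
    rw [rieszPotential, rieszPotential, ← integral_sub hP hQ]
    refine (enorm_integral_le_lintegral_enorm _).trans (lintegral_mono fun x => ?_)
    rw [← sub_mul, ← Complex.ofReal_sub, enorm_mul, enorm_ofReal_complex]

theorem BoundarySobolev.mk_congr {f g : ℝⁿ → ℂ} (hf : MemBoundarySobolev Ω α f)
    (hg : MemBoundarySobolev Ω α g) (e : f =ᵐ[surfaceMeasure Ω] g) :
    BoundarySobolev.mk hf = BoundarySobolev.mk hg :=
  Subtype.ext ((MemLp.toLp_eq_toLp_iff hf.1 hg.1).2 e)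

theorem BoundarySobolev.mk_eq_add {f g h : ℝⁿ → ℂ} (hf : MemBoundarySobolev Ω α f)
    (hg : MemBoundarySobolev Ω α g) (hh : MemBoundarySobolev Ω α h)
    (e : h =ᵐ[surfaceMeasure Ω] f + g) :
    BoundarySobolev.mk hh = BoundarySobolev.mk hf + BoundarySobolev.mk hg := by
  refine Subtype.ext ?_
  change hh.1.toLp h = hf.1.toLp f + hg.1.toLp g
  rw [← MemLp.toLp_add]
  exact (MemLp.toLp_eq_toLp_iff _ _).2 e

theorem BoundarySobolev.mk_eq_smul {f g : ℝⁿ → ℂ} {c : ℂ} (hf : MemBoundarySobolev Ω α f)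
    (hg : MemBoundarySobolev Ω α g) (e : g =ᵐ[surfaceMeasure Ω] c • f) :
    BoundarySobolev.mk hg = c • BoundarySobolev.mk hf := by
  refine Subtype.ext ?_
  change hg.1.toLp g = c • hf.1.toLp f
  rw [← MemLp.toLp_const_smul]
  exact (MemLp.toLp_eq_toLp_iff _ _).2 e

theorem lintegral_enorm_sq_lp {X : Type*} [MeasurableSpace X] {μ : Measure X} (f : Lp ℂ 2 μ) :
    ∫⁻ x, ‖f x‖ₑ ^ 2 ∂μ = ENNReal.ofReal (‖f‖ ^ 2) := by
  rw [lintegral_enorm_sq_eq_eLpNorm_sq, ENNReal.ofReal_pow (norm_nonneg _), Lp.norm_def,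
    ENNReal.ofReal_toReal (Lp.eLpNorm_ne_top _)]

theorem memBoundarySobolev_rieszPotential (hΩ : IsBoundedLipschitzDomain Ω) (hα : 0 < α)
    (hα1 : α < 1 / 2) (hn : 2 ≤ (n : ℝ)) {h : ℝⁿ → ℂ} (hh : StronglyMeasurable h)
    (hf : ∫⁻ x, ‖h x‖ₑ ^ 2 < ∞) :
    MemBoundarySobolev Ω α (rieszPotential (n - 1 / 2 - α) h) := by
  have hfin := hΩ.isFiniteMeasure
  obtain ⟨K, hK⟩ := hΩ.sobolevEnergy_rieszPotential_le hα hα1 hn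
  exact memBoundarySobolev_of_sobolevEnergy_lt_top
    (stronglyMeasurable_rieszPotential _ hh).aestronglyMeasurable
    ((hK h hh hf).trans_lt (ENNReal.mul_lt_top ENNReal.coe_lt_top hf))

/-- The adjoint of the trace of the Riesz potential: a functional `φ` on `H^α(∂Ω)` is represented
by a function `f ∈ L²(ℝⁿ)` whose norm is controlled by that of `φ`. -/
theorem IsBoundedLipschitzDomain.exists_density (hΩ : IsBoundedLipschitzDomain Ω) (hα : 0 < α)
    (hα1 : α < 1 / 2) (hn : 2 ≤ (n : ℝ)) :
    ∃ K : ℝ, 0 ≤ K ∧ ∀ φ : BoundarySobolevDual Ω α, ∃ f : Lp ℂ 2 (volume : Measure ℝⁿ),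
      ‖f‖ ≤ K * ‖φ‖ ∧ ∀ (h : ℝⁿ → ℂ) (hh : StronglyMeasurable h) (hf : ∫⁻ x, ‖h x‖ₑ ^ 2 < ∞),
        φ (BoundarySobolev.mk (memBoundarySobolev_rieszPotential hΩ hα hα1 hn hh hf)) =
          ∫ x, f x * h x := by
  have hfinσ := hΩ.isFiniteMeasure
  obtain ⟨K, hK⟩ := hΩ.sobolevEnergy_rieszPotential_le hα hα1 hn
  refine ⟨√K, Real.sqrt_nonneg _, fun φ => ?_⟩
  have hsm : ∀ h : Lp ℂ 2 (volume : Measure ℝⁿ), StronglyMeasurable h := Lp.stronglyMeasurable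
  have hfin : ∀ h : Lp ℂ 2 (volume : Measure ℝⁿ), ∫⁻ x, ‖h x‖ₑ ^ 2 < ∞ := fun h => by
    rw [lintegral_enorm_sq_lp]
    exact ENNReal.ofReal_lt_top
  have hint : ∀ h : Lp ℂ 2 (volume : Measure ℝⁿ), ∀ᵐ P ∂(surfaceMeasure Ω),
      Integrable fun x => ((‖P - x‖ ^ (-(n - 1 / 2 - α) : ℝ) : ℝ) : ℂ) * h x := fun h =>
    hΩ.upperRegular.ae_integrable_riesz (by linarith) (by linarith) (by linarith) (hsm h) (hfin h)
  let hmem := fun h : Lp ℂ 2 (volume : Measure ℝⁿ) =>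
    memBoundarySobolev_rieszPotential hΩ hα hα1 hn (hsm h) (hfin h)
  let Λ₀ : Lp ℂ 2 (volume : Measure ℝⁿ) →ₗ[ℂ] ℂ :=
    { toFun := fun h => φ (BoundarySobolev.mk (hmem h))
      map_add' := fun h h' => by
        rw [← map_add]
        congr 1
        refine BoundarySobolev.mk_eq_add _ _ _ ?_
        filter_upwards [hint h, hint h'] with P h1 h2
        rw [Pi.add_apply, rieszPotential, rieszPotential, rieszPotential, ← integral_add h1 h2]
        refine integral_congr_ae ((Lp.coeFn_add h h').mono fun x hx => ?_)
        simp only [hx, Pi.add_apply, mul_add]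
      map_smul' := fun c h => by
        rw [RingHom.id_apply, ← map_smul]
        congr 1
        refine BoundarySobolev.mk_eq_smul _ _ (Filter.Eventually.of_forall fun P => ?_)
        rw [Pi.smul_apply, rieszPotential, rieszPotential, smul_eq_mul, ← integral_const_mul]
        refine integral_congr_ae ((Lp.coeFn_smul c h).mono fun x hx => ?_)
        simp only [hx, Pi.smul_apply, smul_eq_mul]
        ring }
  have hbound : ∀ h, ‖Λ₀ h‖ ≤ √K * ‖φ‖ * ‖h‖ := fun h => by
    refine (φ.le_opNorm _).trans ?_
    rw [mul_comm √_, mul_assoc]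
    gcongr
    have h1 := (BoundarySobolev.enorm_mk_sq_le (hmem h)).trans (hK h (hsm h) (hfin h))
    rw [lintegral_enorm_sq_lp, ← ofReal_norm, ← ENNReal.ofReal_pow (norm_nonneg _),
      ← ENNReal.ofReal_coe_nnreal, ← ENNReal.ofReal_mul K.coe_nonneg,
      ENNReal.ofReal_le_ofReal_iff (by positivity)] at h1
    refine le_of_sq_le_sq ?_ (by positivity)
    rwa [mul_pow, Real.sq_sqrt K.coe_nonneg]
  let Λ : StrongDual ℂ (Lp ℂ 2 (volume : Measure ℝⁿ)) := Λ₀.mkContinuous _ hbound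
  let f₀ := (InnerProductSpace.toDual ℂ (Lp ℂ 2 (volume : Measure ℝⁿ))).symm Λ
  -- The conjugate turns the inner product of the Riesz representation into a bilinear pairing.
  refine ⟨star f₀, ?_, fun h hh hf => ?_⟩
  · have hstar : ‖star f₀‖ = ‖f₀‖ := by
      rw [Lp.norm_def, Lp.norm_def]
      congr 1
      refine eLpNorm_congr_norm_ae ((Lp.coeFn_star f₀).mono fun x hx => ?_)
      rw [hx, Pi.star_apply, norm_star]
    rw [hstar]
    change ‖(InnerProductSpace.toDual ℂ (Lp ℂ 2 (volume : Measure ℝⁿ))).symm Λ‖ ≤ _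
    rw [LinearIsometryEquiv.norm_map]
    exact Λ₀.mkContinuous_norm_le (by positivity) hbound
  · have hL : MemLp h 2 (volume : Measure ℝⁿ) :=
      memLp_two_of_lintegral_sq_lt_top hh.aestronglyMeasurable hf
    have e1 : BoundarySobolev.mk (memBoundarySobolev_rieszPotential hΩ hα hα1 hn hh hf) =
        BoundarySobolev.mk (hmem (hL.toLp h)) := by
      have e2 : rieszPotential (n - 1 / 2 - α) h =
          rieszPotential (n - 1 / 2 - α) (hL.toLp h) := by
        funext P
        exact integral_congr_ae (hL.coeFn_toLp.mono fun x hx => by simp only [hx])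
      exact BoundarySobolev.mk_congr _ _ (by rw [e2])
    have e3 : Λ (hL.toLp h) = inner ℂ f₀ (hL.toLp h) :=
      (InnerProductSpace.toDual_symm_apply).symm
    rw [e1]
    change Λ (hL.toLp h) = _
    rw [e3, L2.inner_def]
    refine integral_congr_ae ?_
    filter_upwards [hL.coeFn_toLp, Lp.coeFn_star f₀] with x h1 h2
    rw [h1, h2, RCLike.inner_apply, Pi.star_apply, mul_comm]
    rfl

end Duality

/-! ### The layer potential off the boundary -/

section Evaluation

variable {n : ℕ} {Ω : Set (EuclideanSpace ℝ (Fin n))} {α : ℝ}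

local notation "ℝⁿ" => EuclideanSpace ℝ (Fin n)

theorem exists_pos_le_norm_sub_of_notMem_frontier {x : ℝⁿ} (hx : x ∉ frontier Ω) :
    ∃ δ : ℝ, 0 < δ ∧ ∀ Q ∈ frontier Ω, δ ≤ ‖x - Q‖ := by
  obtain ⟨δ, hδ, h⟩ := Metric.isOpen_iff.1 isClosed_frontier.isOpen_compl x hx
  refine ⟨δ, hδ, fun Q hQ => ?_⟩
  by_contra! hlt
  exact h (by rwa [Metric.mem_ball, dist_comm, dist_eq_norm]) hQ

theorem enorm_rpow_sub_rpow_le_mul {μ δ : ℝ} (hμ : 0 ≤ μ) (hδ : 0 < δ) {a b : ℝⁿ} (ha : δ ≤ ‖a‖)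
    (hb : δ ≤ ‖b‖) : ‖‖a‖ ^ (-μ) - ‖b‖ ^ (-μ)‖ₑ ≤ (μ * δ ^ (-(μ + 1))).toNNReal * ‖a - b‖ₑ := by
  rw [ofReal_toNNReal_coe, ← ofReal_norm, ← ofReal_norm, ← ENNReal.ofReal_mul (by positivity)]
  refine ENNReal.ofReal_le_ofReal ((abs_rpow_neg_sub_rpow_neg_le hμ hδ ha hb).trans ?_)
  gcongr
  exact abs_norm_sub_norm_le a b

theorem enorm_rpow_neg_le_toNNReal {μ δ : ℝ} (hμ : 0 ≤ μ) (hδ : 0 < δ) {a : ℝⁿ} (ha : δ ≤ ‖a‖) :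
    ‖‖a‖ ^ (-μ)‖ₑ ≤ (δ ^ (-μ)).toNNReal := by
  rw [ofReal_toNNReal_coe, Real.enorm_of_nonneg (by positivity)]
  exact ENNReal.ofReal_le_ofReal (Real.rpow_le_rpow_of_nonpos hδ ha (by linarith))

/-- Powers of the distance to a point `x` off the boundary belong to `H^α(∂Ω)`, being bounded and
Lipschitz there. -/
theorem IsBoundedLipschitzDomain.memBoundarySobolev_kernel (hΩ : IsBoundedLipschitzDomain Ω)
    (hα : 0 ≤ α) (hα1 : α < 1 / 2) (hn : 2 ≤ (n : ℝ)) {x : ℝⁿ} (hx : x ∉ frontier Ω) (c : ℝ) {μ : ℝ}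
    (hμ : 0 ≤ μ) : MemBoundarySobolev Ω α (fun Q => ((c * ‖x - Q‖ ^ (-μ) : ℝ) : ℂ)) := by
  have hfin := hΩ.isFiniteMeasure
  obtain ⟨δ, hδ, hδx⟩ := exists_pos_le_norm_sub_of_notMem_frontier hx
  obtain ⟨C, hC⟩ := hΩ.sobolevEnergy_le hα hα1 hn
  refine memBoundarySobolev_of_sobolevEnergy_lt_top
    (Measurable.aestronglyMeasurable (by fun_prop)) (lt_of_le_of_lt (hC _
    (‖c‖₊ * (δ ^ (-μ)).toNNReal) (‖c‖₊ * (μ * δ ^ (-(μ + 1))).toNNReal) (fun P hP => ?_)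
    (fun P hP Q hQ => ?_)) (by exact_mod_cast ENNReal.coe_lt_top))
  · rw [enorm_ofReal_complex, enorm_mul, ENNReal.coe_mul]
    exact mul_le_mul' le_rfl (enorm_rpow_neg_le_toNNReal hμ hδ (hδx P hP))
  · rw [← Complex.ofReal_sub, ← mul_sub, enorm_ofReal_complex, enorm_mul, ENNReal.coe_mul,
      mul_assoc]
    refine mul_le_mul' le_rfl ((enorm_rpow_sub_rpow_le_mul hμ hδ (hδx P hP) (hδx Q hQ)).trans ?_)
    rw [sub_sub_sub_cancel_left, enorm_sub_rev]

theorem MemBoundarySobolev.sub [SFinite (surfaceMeasure Ω)] {f g : ℝⁿ → ℂ}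
    (hf : MemBoundarySobolev Ω α f) (hg : MemBoundarySobolev Ω α g) :
    MemBoundarySobolev Ω α (f - g) := by
  refine ⟨hf.1.sub hg.1, ?_⟩
  have e : weightedDiff α (f - g) = weightedDiff α f - weightedDiff α g := by
    funext z
    simp only [weightedDiff, Pi.sub_apply]
    ring
  rw [e]
  exact hf.2.sub hg.2

theorem lintegral_truncated_kernel_lt_top {m : ℝ} (hm : n < 2 * m) (x : ℝⁿ) {ε : ℝ} (hε : 0 < ε) :
    ∫⁻ y, ‖(Metric.closedBall x ε)ᶜ.indicator (fun y => ((‖x - y‖ ^ (-m) : ℝ) : ℂ)) y‖ₑ ^ 2 <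
      ∞ := by
  have hn0 : (0 : ℝ) ≤ n := n.cast_nonneg
  obtain ⟨K, hK⟩ := (upperRegular_volume_euclidean (n := n)).lintegral_far (b := 2 * m)
    (by linarith) hm
  refine lt_of_le_of_lt ?_ ((hK x ε hε).trans_lt
    (ENNReal.mul_lt_top ENNReal.coe_lt_top ENNReal.ofReal_lt_top))
  rw [← lintegral_indicator Metric.isClosed_closedBall.measurableSet.compl]
  refine lintegral_mono fun y => ?_
  by_cases hy : y ∈ (Metric.closedBall x ε)ᶜ
  · rw [Set.indicator_of_mem hy, Set.indicator_of_mem hy, enorm_ofReal_complex]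
    calc _ ≤ (‖x - y‖ₑ ^ (-m)) ^ 2 := by
          gcongr
          exact enorm_norm_rpow_neg_le (by linarith) _
      _ = _ := by
          rw [← ENNReal.rpow_mul_natCast]
          congr 1
          push_cast
          ring
  · simp [Set.indicator_of_notMem hy]

theorem stronglyMeasurable_truncated_kernel (m : ℝ) (x : ℝⁿ) (ε : ℝ) : StronglyMeasurable
    ((Metric.closedBall x ε)ᶜ.indicator (fun y => ((‖x - y‖ ^ (-m) : ℝ) : ℂ))) :=
  (Measurable.stronglyMeasurable (by fun_prop)).indicator
    Metric.isClosed_closedBall.measurableSet.compl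

theorem integrable_kernel_mul_kernel {m : ℝ} (hm : n < 2 * m) (hmn : m < n) {P Q : ℝⁿ}
    (hPQ : P ≠ Q) {K : ℝ≥0} (hK : ∫⁻ z, ‖P - z‖ₑ ^ (-m) * ‖z - Q‖ₑ ^ (-m) =
      K * ‖P - Q‖ₑ ^ (-(2 * m - n))) :
    Integrable (fun z => ‖P - z‖ ^ (-m) * ‖Q - z‖ ^ (-m)) ∧
      ∫ z, ‖P - z‖ ^ (-m) * ‖Q - z‖ ^ (-m) = K * ‖P - Q‖ ^ (-(2 * m - n)) := by
  have hn0 : (0 : ℝ) ≤ n := n.cast_nonneg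
  have hn1 : (0 : ℝ) < n := by linarith
  have hPQ' : P - Q ≠ 0 := sub_ne_zero.2 hPQ
  have h1 : ∫⁻ z, ENNReal.ofReal (‖P - z‖ ^ (-m) * ‖Q - z‖ ^ (-m)) =
      K * ‖P - Q‖ₑ ^ (-(2 * m - n)) := by
    rw [← hK]
    have h0 : ∀ R : ℝⁿ, ∀ᵐ z : ℝⁿ, z ≠ R := fun R =>
      measure_eq_zero_iff_ae_notMem.1 (upperRegular_volume_euclidean.measure_singleton hn1 R)
    refine lintegral_congr_ae ?_
    filter_upwards [h0 P, h0 Q] with z hz1 hz2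
    rw [ENNReal.ofReal_mul (by positivity), ← enorm_rpow_eq_ofReal (sub_ne_zero.2 hz1.symm),
      ← enorm_rpow_eq_ofReal (sub_ne_zero.2 hz2.symm), enorm_sub_rev Q z]
  have hmeas : AEStronglyMeasurable (fun z : ℝⁿ => ‖P - z‖ ^ (-m) * ‖Q - z‖ ^ (-m)) volume :=
    Measurable.aestronglyMeasurable (by fun_prop)
  constructor
  · refine (lintegral_ofReal_ne_top_iff_integrable hmeas
      (Filter.Eventually.of_forall fun z => by positivity)).1 ?_
    rw [h1]
    exact ENNReal.mul_ne_top ENNReal.coe_ne_top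
      (ENNReal.rpow_ne_top_of_ne_zero (enorm_ne_zero.2 hPQ') enorm_ne_top)
  · rw [integral_eq_lintegral_of_nonneg_ae
        (Filter.Eventually.of_forall fun z => by positivity) hmeas, h1,
      enorm_rpow_eq_ofReal hPQ', ENNReal.toReal_mul, ENNReal.coe_toReal,
      ENNReal.toReal_ofReal (by positivity)]

/-- Let `F ε` be the value of `φ` at the Riesz potential of the kernel `|x - ·| ^ (-m)` truncated
near `x`. A limit of `F ε` is the value of `φ` at the Riesz potential of the whole kernel, which is
`K |x - ·| ^ (n - 2 m)`. The part that the truncation removes is small in `H^α(∂Ω)`, since only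
values of `|Q - ·| ^ (-m)` away from its pole `Q ∈ ∂Ω` enter. -/
theorem IsBoundedLipschitzDomain.apply_mk_eq_of_tendsto_truncated (hΩ : IsBoundedLipschitzDomain Ω)
    (hα : 0 < α) (hα1 : α < 1 / 2) (hn : 2 ≤ (n : ℝ)) {m : ℝ} (hm : m = n - 1 / 2 - α) {K : ℝ≥0}
    (hK : ∀ P Q : ℝⁿ, P ≠ Q → ∫⁻ z, ‖P - z‖ₑ ^ (-m) * ‖z - Q‖ₑ ^ (-m) =
      K * ‖P - Q‖ₑ ^ (-(2 * m - n))) {x : ℝⁿ} (hx : x ∉ frontier Ω)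
    (hmem : MemBoundarySobolev Ω α (fun Q => ((K * ‖x - Q‖ ^ (-(2 * m - n)) : ℝ) : ℂ)))
    (hmemε : ∀ ε : ℝ, 0 < ε → MemBoundarySobolev Ω α (rieszPotential m
      ((Metric.closedBall x ε)ᶜ.indicator (fun y => ((‖x - y‖ ^ (-m) : ℝ) : ℂ)))))
    (φ : BoundarySobolevDual Ω α) {ℓ : ℂ} {F : ℝ → ℂ}
    (hF : ∀ ε (hε : 0 < ε), φ (BoundarySobolev.mk (hmemε ε hε)) = F ε)
    (hlim : Filter.Tendsto F (nhdsWithin 0 (Set.Ioi 0)) (nhds ℓ)) :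
    φ (BoundarySobolev.mk hmem) = ℓ := by
  have hfin := hΩ.isFiniteMeasure
  obtain ⟨δ, hδ, hδx⟩ := exists_pos_le_norm_sub_of_notMem_frontier hx
  obtain ⟨C, hC⟩ := hΩ.sobolevEnergy_le hα.le hα1 hn
  have hm0 : 0 < m := by linarith
  obtain ⟨K₁, hK₁⟩ := (upperRegular_volume_euclidean (n := n)).lintegral_near hm0.le (by linarith)
  set A : ℝ≥0 := ((δ / 2) ^ (-m)).toNNReal with hA
  set B : ℝ≥0 := (m * (δ / 2) ^ (-(m + 1))).toNNReal with hB
  -- The removed part of the potential, at boundary points.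
  have hrem : ∀ ε, ∀ Q ∈ frontier Ω, ((K * ‖x - Q‖ ^ (-(2 * m - n)) : ℝ) : ℂ) - rieszPotential m
      ((Metric.closedBall x ε)ᶜ.indicator (fun y => ((‖x - y‖ ^ (-m) : ℝ) : ℂ))) Q =
      ((∫ y in Metric.closedBall x ε, ‖Q - y‖ ^ (-m) * ‖x - y‖ ^ (-m) : ℝ) : ℂ) := by
    intro ε Q hQ
    have hQx : Q ≠ x := fun h => hx (h ▸ hQ)
    obtain ⟨hi, he⟩ := integrable_kernel_mul_kernel (by linarith) (by linarith) hQx (hK Q x hQx)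
    have h1 : rieszPotential m
        ((Metric.closedBall x ε)ᶜ.indicator (fun y => ((‖x - y‖ ^ (-m) : ℝ) : ℂ))) Q =
        ((∫ y in (Metric.closedBall x ε)ᶜ, ‖Q - y‖ ^ (-m) * ‖x - y‖ ^ (-m) : ℝ) : ℂ) := by
      rw [rieszPotential, ← integral_indicator Metric.isClosed_closedBall.measurableSet.compl,
        ← integral_complex_ofReal]
      refine integral_congr_ae (Filter.Eventually.of_forall fun y => ?_)
      by_cases hy : y ∈ (Metric.closedBall x ε)ᶜ
      · simp only [Set.indicator_of_mem hy, Complex.ofReal_mul]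
      · simp only [Set.indicator_of_notMem hy, mul_zero, Complex.ofReal_zero]
    rw [h1, norm_sub_rev x Q, ← he, ← Complex.ofReal_sub,
      ← integral_add_compl Metric.isClosed_closedBall.measurableSet hi, add_sub_cancel_right]
  have hbound : ∀ ε (hε : 0 < ε), ε ≤ δ / 2 → ‖BoundarySobolev.mk hmem -
      BoundarySobolev.mk (hmemε ε hε)‖ₑ ^ 2 ≤
        C * (A ^ 2 + B ^ 2) * (K₁ * ENNReal.ofReal (ε ^ (n - m))) ^ 2 := by
    intro ε hε hεδ
    have hI := hK₁ x ε hε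
    set I : ℝ≥0 := K₁ * (ε ^ (n - m)).toNNReal with hIdef
    rw [← ofReal_toNNReal_coe, ← ENNReal.coe_mul, ← hIdef] at hI
    have hfar : ∀ Q ∈ frontier Ω, ∀ y ∈ Metric.closedBall x ε, δ / 2 ≤ ‖Q - y‖ := by
      intro Q hQ y hy
      have h1 := hδx Q hQ
      rw [Metric.mem_closedBall, dist_comm, dist_eq_norm] at hy
      have h2 := norm_sub_le (x - y) (Q - y)
      rw [sub_sub_sub_cancel_right] at h2
      linarith
    have hdiff := (MemBoundarySobolev.sub hmem (hmemε ε hε))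
    have e1 : BoundarySobolev.mk hmem - BoundarySobolev.mk (hmemε ε hε) =
        BoundarySobolev.mk hdiff := by
      rw [sub_eq_iff_eq_add]
      refine BoundarySobolev.mk_eq_add _ _ _ (Filter.Eventually.of_forall fun Q => ?_)
      simp
    rw [e1]
    refine (BoundarySobolev.enorm_mk_sq_le hdiff).trans ((hC _ (A * I) (B * I) (fun Q hQ => ?_)
      (fun P hP Q hQ => ?_)).trans (le_of_eq ?_))
    · rw [Pi.sub_apply, hrem ε Q hQ, enorm_ofReal_complex]
      calc _ ≤ ∫⁻ y in Metric.closedBall x ε, A * ‖x - y‖ₑ ^ (-m) := by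
            refine (enorm_integral_le_lintegral_enorm _).trans
              (setLIntegral_mono' Metric.isClosed_closedBall.measurableSet fun y hy => ?_)
            rw [enorm_mul]
            exact mul_le_mul' (enorm_rpow_neg_le_toNNReal hm0.le (half_pos hδ) (hfar Q hQ y hy))
              (enorm_norm_rpow_neg_le hm0 _)
        _ ≤ _ := by
            rw [lintegral_const_mul' _ _ ENNReal.coe_ne_top, ENNReal.coe_mul]
            gcongr
    · have hi : ∀ P ∈ frontier Ω, IntegrableOn (fun y => ‖P - y‖ ^ (-m) * ‖x - y‖ ^ (-m))
          (Metric.closedBall x ε) := fun P hP => by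
        have hPx : P ≠ x := fun h => hx (h ▸ hP)
        exact (integrable_kernel_mul_kernel (by linarith) (by linarith) hPx
          (hK P x hPx)).1.integrableOn
      rw [Pi.sub_apply, Pi.sub_apply, hrem ε P hP, hrem ε Q hQ, ← Complex.ofReal_sub,
        ← integral_sub (hi P hP) (hi Q hQ), enorm_ofReal_complex]
      calc _ ≤ ∫⁻ y in Metric.closedBall x ε, B * ‖P - Q‖ₑ * ‖x - y‖ₑ ^ (-m) := by
            refine (enorm_integral_le_lintegral_enorm _).trans
              (setLIntegral_mono' Metric.isClosed_closedBall.measurableSet fun y hy => ?_)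
            rw [← sub_mul, enorm_mul]
            refine mul_le_mul' ((enorm_rpow_sub_rpow_le_mul hm0.le (half_pos hδ) (hfar P hP y hy)
              (hfar Q hQ y hy)).trans ?_) (enorm_norm_rpow_neg_le hm0 _)
            rw [sub_sub_sub_cancel_right]
        _ ≤ B * ‖P - Q‖ₑ * I := by
            rw [lintegral_const_mul' _ _ (ENNReal.mul_ne_top ENNReal.coe_ne_top enorm_ne_top)]
            gcongr
        _ = _ := by
            rw [ENNReal.coe_mul B I]
            ring
    · rw [← ofReal_toNNReal_coe, hIdef]
      push_cast
      ring
  have hlim2 : Filter.Tendsto F (nhdsWithin 0 (Set.Ioi 0))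
      (nhds (φ (BoundarySobolev.mk hmem))) := by
    rw [tendsto_iff_norm_sub_tendsto_zero]
    have h0 : Filter.Tendsto (fun ε : ℝ => ‖φ‖ * (√(C * (A ^ 2 + B ^ 2)) * (K₁ * ε ^ (n - m))))
        (nhdsWithin 0 (Set.Ioi 0)) (nhds 0) := by
      have h1 : Filter.Tendsto (fun r : ℝ => r ^ (n - m)) (nhdsWithin 0 (Set.Ioi 0)) (nhds 0) := by
        have := (Real.continuousAt_rpow_const 0 (n - m) (Or.inr (by linarith))).tendsto
        rw [Real.zero_rpow (by linarith)] at this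
        exact this.mono_left nhdsWithin_le_nhds
      have h2 := ((h1.const_mul (K₁ : ℝ)).const_mul √(C * (A ^ 2 + B ^ 2))).const_mul ‖φ‖
      rw [mul_zero, mul_zero, mul_zero] at h2
      exact h2
    refine squeeze_zero' (Filter.Eventually.of_forall fun _ => norm_nonneg _) ?_ h0
    have hev : ∀ᶠ ε : ℝ in nhdsWithin 0 (Set.Ioi 0), ε ≤ δ / 2 :=
      (eventually_le_nhds (half_pos hδ)).filter_mono nhdsWithin_le_nhds
    filter_upwards [self_mem_nhdsWithin, hev] with ε hε hεδ
    have hε' : 0 < ε := hε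
    rw [← hF ε hε, norm_sub_rev, ← map_sub]
    refine (φ.le_opNorm _).trans ?_
    gcongr
    have h2 := hbound ε hε hεδ
    have h3 : (C : ℝ≥0∞) * (A ^ 2 + B ^ 2) * (K₁ * ENNReal.ofReal (ε ^ (n - m))) ^ 2 =
        ENNReal.ofReal (C * (A ^ 2 + B ^ 2) * (K₁ * ε ^ (n - m)) ^ 2) := by
      rw [ENNReal.ofReal_mul (by positivity), ENNReal.ofReal_mul (by positivity),
        ENNReal.ofReal_pow (by positivity), ENNReal.ofReal_mul (by positivity),
        ENNReal.ofReal_add (by positivity) (by positivity), ENNReal.ofReal_pow (by positivity),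
        ENNReal.ofReal_pow (by positivity)]
      simp only [ENNReal.ofReal_coe_nnreal]
    rw [h3, ← ofReal_norm, ← ENNReal.ofReal_pow (norm_nonneg _),
      ENNReal.ofReal_le_ofReal_iff (by positivity)] at h2
    refine le_of_sq_le_sq ?_ (by positivity)
    rwa [mul_pow, Real.sq_sqrt (by positivity)]
  exact tendsto_nhds_unique hlim2 hlim

/-- If `f` represents the functional `φ`, then the layer potential of `φ` is the Riesz potential
of `f`, at every point off the boundary where the latter converges. -/
theorem IsBoundedLipschitzDomain.apply_mk_kernel_eq (hΩ : IsBoundedLipschitzDomain Ω)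
    (hα : 0 < α) (hα1 : α < 1 / 2) (hn : 2 ≤ (n : ℝ)) {m : ℝ} (hm : m = n - 1 / 2 - α) {K : ℝ≥0}
    (hK : ∀ P Q : ℝⁿ, P ≠ Q → ∫⁻ z, ‖P - z‖ₑ ^ (-m) * ‖z - Q‖ₑ ^ (-m) =
      K * ‖P - Q‖ₑ ^ (-(2 * m - n))) {x : ℝⁿ} (hx : x ∉ frontier Ω)
    (hmem : MemBoundarySobolev Ω α (fun Q => ((K * ‖x - Q‖ ^ (-(2 * m - n)) : ℝ) : ℂ)))
    {φ : BoundarySobolevDual Ω α} {f : ℝⁿ → ℂ}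
    (hφ : ∀ (h : ℝⁿ → ℂ) (hh : StronglyMeasurable h) (hf : ∫⁻ x, ‖h x‖ₑ ^ 2 < ∞),
        φ (BoundarySobolev.mk (memBoundarySobolev_rieszPotential hΩ hα hα1 hn hh hf)) =
          ∫ x, f x * h x)
    (hfx : Integrable fun y => ((‖x - y‖ ^ (-m) : ℝ) : ℂ) * f y) :
    φ (BoundarySobolev.mk hmem) = rieszPotential m f x := by
  subst hm
  set m : ℝ := n - 1 / 2 - α with hm
  refine hΩ.apply_mk_eq_of_tendsto_truncated hα hα1 hn hm hK hx hmem (fun ε hε =>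
    memBoundarySobolev_rieszPotential hΩ hα hα1 hn (stronglyMeasurable_truncated_kernel m x ε)
    (lintegral_truncated_kernel_lt_top (by linarith) x hε)) φ
    (F := fun ε => ∫ y, (Metric.closedBall x ε)ᶜ.indicator
      (fun y => ((‖x - y‖ ^ (-m) : ℝ) : ℂ) * f y) y) (fun ε hε => ?_) ?_
  · refine (hφ _ (stronglyMeasurable_truncated_kernel m x ε)
      (lintegral_truncated_kernel_lt_top (by linarith) x hε)).trans ?_
    refine integral_congr_ae (Filter.Eventually.of_forall fun y => ?_)
    by_cases hy : y ∈ (Metric.closedBall x ε)ᶜ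
    · simp only [Set.indicator_of_mem hy, mul_comm]
    · simp only [Set.indicator_of_notMem hy, mul_zero]
  · refine tendsto_integral_filter_of_dominated_convergence
      (fun y => ‖((‖x - y‖ ^ (-m) : ℝ) : ℂ) * f y‖) (Filter.Eventually.of_forall fun ε =>
        hfx.aestronglyMeasurable.indicator Metric.isClosed_closedBall.measurableSet.compl)
      (Filter.Eventually.of_forall fun ε => Filter.Eventually.of_forall fun y =>
        norm_indicator_le_norm_self _ _) hfx.norm ?_
    have h0 : ∀ᵐ y : ℝⁿ, y ≠ x := measure_eq_zero_iff_ae_notMem.1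
      (upperRegular_volume_euclidean.measure_singleton (by linarith) x)
    filter_upwards [h0] with y hy
    refine tendsto_const_nhds.congr' ?_
    have hpos : 0 < dist y x := dist_pos.2 hy
    filter_upwards [(eventually_lt_nhds hpos).filter_mono nhdsWithin_le_nhds] with ε hε
    rw [Set.indicator_of_mem]
    rwa [Set.mem_compl_iff, Metric.mem_closedBall, not_le]

end Evaluation

/-! ### Riesz potentials of Schwartz functions -/

section Subordination

variable {n : ℕ}

local notation "ℝⁿ" => EuclideanSpace ℝ (Fin n)

/-- The constant in the representation of `|v| ^ (-a)` as a superposition of Gaussians. -/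
noncomputable def subordinationConstant (a : ℝ) : ℝ := (1 / Real.pi) ^ (a / 2) * Real.Gamma (a / 2)

theorem subordinationConstant_pos {a : ℝ} (ha : 0 < a) : 0 < subordinationConstant a := by
  have := Real.pi_pos
  have := Real.Gamma_pos_of_pos (half_pos ha)
  unfold subordinationConstant
  positivity

theorem integral_rpow_mul_gaussian {a r : ℝ} (ha : 0 < a) (hr : 0 < r) :
    ∫ u : ℝ in Set.Ioi 0, u ^ (a / 2 - 1) * Real.exp (-(Real.pi * r ^ 2 * u)) =
      subordinationConstant a * r ^ (-a) := by
  have := Real.pi_pos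
  rw [Real.integral_rpow_mul_exp_neg_mul_Ioi (half_pos ha) (by positivity), subordinationConstant,
    one_div, mul_inv, Real.mul_rpow (by positivity) (by positivity), one_div,
    Real.inv_rpow (sq_nonneg r), ← Real.rpow_natCast r 2, ← Real.rpow_mul hr.le,
    Real.rpow_neg hr.le]
  have : ((2 : ℕ) : ℝ) * (a / 2) = a := by push_cast; ring
  rw [this]
  ring

theorem integral_rpow_mul_gaussian_inv {a r : ℝ} (ha : 0 < a) (hr : 0 < r) :
    ∫ u : ℝ in Set.Ioi 0, u ^ (-(a / 2) - 1) * Real.exp (-(Real.pi * r ^ 2 / u)) =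
      subordinationConstant a * r ^ (-a) := by
  rw [← integral_rpow_mul_gaussian ha hr, ← integral_comp_rpow_Ioi _ (p := -1) (by norm_num)]
  refine setIntegral_congr_fun measurableSet_Ioi fun u hu => ?_
  have hu0 : (0 : ℝ) < u := hu
  simp only [smul_eq_mul, abs_neg, abs_one, one_mul]
  rw [Real.rpow_neg_one u, div_inv_eq_mul, ← mul_assoc]
  congr 1
  rw [← Real.rpow_neg_one u, ← Real.rpow_mul hu0.le, ← Real.rpow_add hu0]
  congr 1
  ring

/-- Exchange of the two integrations in `∫ (∫ q (y, t) dt) η y dy`, for `q ≥ 0`. The inner integral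
`Q y` is required to be nonzero because this implies that it converges: a divergent integral has the
value `0`. -/
theorem integral_mul_eq_integral_integral_of_nonneg {X : Type*} [MeasurableSpace X] {μ : Measure X}
    [SFinite μ] {q : X × ℝ → ℝ} (hqm : Measurable q) (hq : ∀ p, 0 < p.2 → 0 ≤ q p) {Q : X → ℝ}
    (hQ : ∀ᵐ y ∂μ, Q y ≠ 0 ∧ ∫ t in Set.Ioi 0, q (y, t) = Q y) {η : X → ℂ}
    (hηm : AEStronglyMeasurable η μ) (hη : Integrable (fun y => (Q y : ℂ) * η y) μ) :
    ∫ y, (Q y : ℂ) * η y ∂μ = ∫ t in Set.Ioi (0 : ℝ), ∫ y, (q (y, t) : ℂ) * η y ∂μ := by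
  have hi : ∀ᵐ y ∂μ, IntegrableOn (fun t => q (y, t)) (Set.Ioi 0) := by
    filter_upwards [hQ] with y hy
    exact .of_integral_ne_zero (by rw [hy.2]; exact hy.1)
  have hi' : ∀ᵐ y ∂μ, ∫ t in Set.Ioi (0 : ℝ), (q (y, t) : ℂ) * η y = (Q y : ℂ) * η y := by
    filter_upwards [hQ] with y hy
    rw [integral_mul_const, integral_complex_ofReal, hy.2]
  rw [← integral_congr_ae hi']
  refine integral_integral_swap (f := fun y t => (q (y, t) : ℂ) * η y)
    ((integrable_prod_iff ?_).2 ⟨?_, ?_⟩)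
  · exact (Complex.measurable_ofReal.comp hqm).aestronglyMeasurable.mul hηm.comp_fst
  · filter_upwards [hi] with y hy
    exact Integrable.mul_const (Integrable.ofReal (𝕜 := ℂ) hy) (η y)
  · refine hη.norm.congr ?_
    filter_upwards [hQ] with y hy
    have hQ0 : 0 ≤ Q y := hy.2 ▸ setIntegral_nonneg measurableSet_Ioi fun t ht => hq (y, t) ht
    have e : ∀ t ∈ Set.Ioi (0 : ℝ), ‖(q (y, t) : ℂ) * η y‖ = q (y, t) * ‖η y‖ := fun t ht => by
      rw [norm_mul, Complex.norm_real, Real.norm_of_nonneg (hq (y, t) ht)]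
    change _ = ∫ t in Set.Ioi (0 : ℝ), ‖(q (y, t) : ℂ) * η y‖
    rw [setIntegral_congr_fun measurableSet_Ioi e, integral_mul_const, hy.2, norm_mul,
      Complex.norm_real, Real.norm_of_nonneg hQ0]

/-- The singularity of `|x - y| ^ (-a)` is integrable against a bounded `η`; elsewhere `η` is
integrable. -/
theorem integrable_norm_rpow_neg_mul {a : ℝ} (ha : 0 < a) (han : a < n) (x : ℝⁿ) {η : ℝⁿ → ℂ}
    (hη : Integrable η) {B : ℝ} (hB : ∀ y, ‖η y‖ ≤ B) :
    Integrable fun y => ((‖x - y‖ ^ (-a) : ℝ) : ℂ) * η y := by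
  obtain ⟨K, hK⟩ := (upperRegular_volume_euclidean (n := n)).lintegral_near ha.le han
  have hm : Measurable fun y : ℝⁿ => ((‖x - y‖ ^ (-a) : ℝ) : ℂ) := by fun_prop
  refine (integrableOn_univ (f := fun y => ((‖x - y‖ ^ (-a) : ℝ) : ℂ) * η y)).1 ?_
  rw [← Set.union_compl_self (Metric.closedBall x 1)]
  refine IntegrableOn.union ?_ ?_
  · refine Integrable.mul_bdd (c := B) ⟨hm.aestronglyMeasurable, ?_⟩ hη.1.restrict
      (Filter.Eventually.of_forall hB)
    refine (lintegral_mono fun y => ?_).trans_lt ((hK x 1 one_pos).trans_lt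
      (ENNReal.mul_lt_top ENNReal.coe_lt_top ENNReal.ofReal_lt_top))
    rw [enorm_ofReal_complex]
    exact enorm_norm_rpow_neg_le ha _
  · refine Integrable.bdd_mul (c := 1) hη.integrableOn hm.aestronglyMeasurable.restrict ?_
    refine (ae_restrict_iff' Metric.isClosed_closedBall.measurableSet.compl).2
      (Filter.Eventually.of_forall fun y hy => ?_)
    rw [Set.mem_compl_iff, Metric.mem_closedBall, not_le, dist_comm, dist_eq_norm] at hy
    rw [Complex.norm_real, Real.norm_of_nonneg (by positivity)]
    exact Real.rpow_le_one_of_one_le_of_nonpos hy.le (by linarith)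

theorem exists_norm_schwartz_le (η : 𝓢(ℝⁿ, ℂ)) : ∃ B : ℝ, 0 < B ∧ ∀ y, ‖η y‖ ≤ B := by
  obtain ⟨B, hB, h⟩ := η.decay 0 0
  exact ⟨B, hB, fun y => by simpa using h y⟩

theorem integral_fourier_mul_eq_of_integrable {f g : ℝⁿ → ℂ} (hf : Integrable f)
    (hg : Integrable g) : ∫ ξ, 𝓕 f ξ * g ξ = ∫ x, f x * 𝓕 g x := by
  simpa using! VectorFourier.integral_bilin_fourierIntegral_eq_flip (.mul ℂ ℂ) (L := innerₗ ℝⁿ)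
    Real.continuous_fourierChar continuous_inner hf hg

theorem integral_fourierInv_mul_eq_of_integrable {f g : ℝⁿ → ℂ} (hf : Integrable f)
    (hg : Integrable g) : ∫ ξ, 𝓕⁻ f ξ * g ξ = ∫ x, f x * 𝓕⁻ g x := by
  have h : 𝓕⁻ g = fun x => 𝓕 g (-x) := funext fun x => Real.fourierInv_eq_fourier_neg g x
  rw [Real.fourierInv_eq_fourier_comp_neg, integral_fourier_mul_eq_of_integrable hf.comp_neg hg, h,
    ← integral_neg_eq_self fun x => f (-x) * 𝓕 g x]
  simp only [neg_neg]

/-- The Fourier transform of the Gaussian, tested against a Schwartz function. -/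
theorem integral_gaussian_mul_schwartz (η : 𝓢(ℝⁿ, ℂ)) (x : ℝⁿ) {u : ℝ} (hu : 0 < u) :
    ∫ y, (Real.exp (-(Real.pi * ‖x - y‖ ^ 2 / u)) : ℂ) * η y =
      (u ^ ((n : ℝ) / 2) : ℝ) * ∫ v, (Real.exp (-(Real.pi * ‖v‖ ^ 2 * u)) : ℂ) *
        (Complex.exp ((2 * Real.pi * inner ℝ v x : ℝ) * Complex.I) * 𝓕 η v) := by
  have hpi := Real.pi_pos
  set b : ℂ := ((Real.pi * u : ℝ) : ℂ) with hb
  have hbre : 0 < b.re := by rw [hb, Complex.ofReal_re]; positivity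
  set g : ℝⁿ → ℂ := fun v => Complex.exp (-b * ‖v‖ ^ 2 + 2 * Real.pi * Complex.I * inner ℝ x v)
    with hg
  have hgi : Integrable g := by
    have := GaussianFourier.integrable_cexp_neg_mul_sq_norm_add hbre (2 * Real.pi * Complex.I) x
    exact this
  have hgF : ∀ y, 𝓕 g y = ((u ^ (-((n : ℝ) / 2)) : ℝ) : ℂ) *
      (Real.exp (-(Real.pi * ‖x - y‖ ^ 2 / u)) : ℂ) := by
    intro y
    have h1 : (Real.pi : ℂ) / b = ((u⁻¹ : ℝ) : ℂ) := by
      rw [hb, ← Complex.ofReal_div]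
      congr 1
      field_simp
    rw [hg, fourier_gaussian_innerProductSpace' hbre x y, h1, finrank_euclideanSpace_fin]
    congr 1
    · rw [Real.rpow_neg hu.le, ← Real.inv_rpow hu.le, Complex.ofReal_cpow (by positivity)]
      push_cast
      rfl
    · rw [hb, Complex.ofReal_exp]
      congr 1
      push_cast
      have : (Real.pi : ℂ) ≠ 0 := by exact_mod_cast hpi.ne'
      have : (u : ℂ) ≠ 0 := by exact_mod_cast hu.ne'
      field_simp
  have hflip : ∫ y, 𝓕 g y * η y = ∫ v, g v * 𝓕 η v :=
    integral_fourier_mul_eq_of_integrable hgi η.integrable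
  have e1 : ∀ y, (Real.exp (-(Real.pi * ‖x - y‖ ^ 2 / u)) : ℂ) * η y =
      ((u ^ ((n : ℝ) / 2) : ℝ) : ℂ) * (𝓕 g y * η y) := fun y => by
    rw [hgF, ← mul_assoc, ← mul_assoc, ← Complex.ofReal_mul, ← Real.rpow_add hu, add_neg_cancel,
      Real.rpow_zero, Complex.ofReal_one, one_mul]
  rw [integral_congr_ae (Filter.Eventually.of_forall e1), integral_const_mul, hflip]
  congr 1
  refine integral_congr_ae (Filter.Eventually.of_forall fun v => ?_)
  simp only [hg, hb]
  rw [← mul_assoc, Complex.ofReal_exp, ← Complex.exp_add, real_inner_comm]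
  congr 2
  push_cast
  ring

/-- The Riesz potential of a Schwartz function is, up to a positive constant, the Fourier multiplier
`|ξ| ^ (-s)`. -/
theorem exists_rieszPotential_schwartz_eq {s : ℝ} (hs : 0 < s) (hsn : s < n) :
    ∃ c : ℝ, 0 < c ∧ ∀ (η : 𝓢(ℝⁿ, ℂ)) (x : ℝⁿ), rieszPotential (n - s) η x =
      c * 𝓕⁻ (fun v : ℝⁿ => ((‖v‖ ^ (-s) : ℝ) : ℂ) * 𝓕 η v) x := by
  have hA := subordinationConstant_pos (a := n - s) (by linarith)
  have hB := subordinationConstant_pos hs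
  set A := subordinationConstant (n - s)
  set B := subordinationConstant s
  refine ⟨A⁻¹ * B, by positivity, fun η x => ?_⟩
  have hn0 : (0 : ℝ) < n := hs.trans hsn
  have hsing : ∀ z : ℝⁿ, ∀ᵐ y : ℝⁿ, y ≠ z := fun z => measure_eq_zero_iff_ae_notMem.1
      (upperRegular_volume_euclidean.measure_singleton hn0 z)
  obtain ⟨C, -, hC⟩ := exists_norm_schwartz_le η
  obtain ⟨D, -, hD⟩ := exists_norm_schwartz_le (𝓕 η)
  have hexp : ∀ v : ℝⁿ, ‖Complex.exp ((2 * Real.pi * inner ℝ v x : ℝ) * Complex.I)‖ = 1 :=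
    fun v => Complex.norm_exp_ofReal_mul_I _
  have hem : Measurable fun v : ℝⁿ =>
    Complex.exp ((2 * Real.pi * inner ℝ v x : ℝ) * Complex.I) := by fun_prop
  set θ : ℝⁿ → ℂ := fun v =>
    Complex.exp ((2 * Real.pi * inner ℝ v x : ℝ) * Complex.I) * 𝓕 η v with hθ
  have hθi : Integrable θ := (𝓕 η).integrable.bdd_mul (c := 1) hem.aestronglyMeasurable
    (Filter.Eventually.of_forall fun v => (hexp v).le)
  have hθb : ∀ v, ‖θ v‖ ≤ D := fun v => by
    rw [hθ, norm_mul, hexp, one_mul]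
    exact hD v
  -- Both sides are superpositions of Gaussians, which `integral_gaussian_mul_schwartz` matches for
  -- each value of the parameter.
  have h1 := integral_mul_eq_integral_integral_of_nonneg (μ := (volume : Measure ℝⁿ))
    (q := fun p => p.2 ^ (-((n - s) / 2) - 1) * Real.exp (-(Real.pi * ‖x - p.1‖ ^ 2 / p.2)))
    (by fun_prop) (fun p hp => by positivity) (Q := fun y => A * ‖x - y‖ ^ (-(n - s)))
    (by
      filter_upwards [hsing x] with y hy
      have hpos : 0 < ‖x - y‖ := norm_pos_iff.2 (sub_ne_zero.2 hy.symm)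
      exact ⟨by positivity, integral_rpow_mul_gaussian_inv (by linarith) hpos⟩)
    η.integrable.1
    (by
      have := (integrable_norm_rpow_neg_mul (a := n - s) (by linarith) (by linarith) x η.integrable
        hC).const_mul (A : ℂ)
      refine this.congr (Filter.Eventually.of_forall fun y => ?_)
      simp only [Complex.ofReal_mul]
      ring)
  have h2 := integral_mul_eq_integral_integral_of_nonneg (μ := (volume : Measure ℝⁿ))
    (q := fun p => p.2 ^ (s / 2 - 1) * Real.exp (-(Real.pi * ‖p.1‖ ^ 2 * p.2)))
    (by fun_prop) (fun p hp => by positivity) (Q := fun y => B * ‖y‖ ^ (-s))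
    (by
      filter_upwards [hsing 0] with y hy
      have hpos : 0 < ‖y‖ := norm_pos_iff.2 hy
      exact ⟨by positivity, integral_rpow_mul_gaussian hs hpos⟩)
    hθi.1
    (by
      have := (integrable_norm_rpow_neg_mul hs hsn 0 hθi hθb).const_mul (B : ℂ)
      refine this.congr (Filter.Eventually.of_forall fun y => ?_)
      simp only [Complex.ofReal_mul, zero_sub, norm_neg]
      ring)
  have h3 : (A : ℂ) * rieszPotential (n - s) η x =
      B * 𝓕⁻ (fun v : ℝⁿ => ((‖v‖ ^ (-s) : ℝ) : ℂ) * 𝓕 η v) x := by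
    rw [rieszPotential, Real.fourierInv_eq', ← integral_const_mul, ← integral_const_mul]
    calc _ = ∫ y, ((A * ‖x - y‖ ^ (-(n - s)) : ℝ) : ℂ) * η y := by
          refine integral_congr_ae (Filter.Eventually.of_forall fun y => ?_)
          simp only [Complex.ofReal_mul]
          ring
      _ = ∫ v, ((B * ‖v‖ ^ (-s) : ℝ) : ℂ) * θ v := by
          rw [h1, h2]
          refine setIntegral_congr_fun measurableSet_Ioi fun u hu => ?_
          have hu0 : (0 : ℝ) < u := hu
          simp only [Complex.ofReal_mul _ (Real.exp _), mul_assoc (Complex.ofReal _)]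
          rw [integral_const_mul, integral_const_mul, integral_gaussian_mul_schwartz η x hu0,
            ← mul_assoc, ← Complex.ofReal_mul, ← Real.rpow_add hu0]
          have e : -((n - s) / 2) - 1 + (n : ℝ) / 2 = s / 2 - 1 := by ring
          rw [e]
      _ = _ := by
          refine integral_congr_ae (Filter.Eventually.of_forall fun y => ?_)
          simp only [hθ, Complex.ofReal_mul, smul_eq_mul]
          ring
  have hA' : (A : ℂ) ≠ 0 := by exact_mod_cast hA.ne'
  push_cast
  rw [mul_assoc, ← h3, ← mul_assoc, inv_mul_cancel₀ hA', one_mul]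

end Subordination

/-! ### Riesz potentials as Fourier multipliers -/

section Multiplier

variable {n : ℕ}

local notation "ℝⁿ" => EuclideanSpace ℝ (Fin n)

theorem UpperRegular.of_le_smul {E : Type*} [NormedAddCommGroup E] [MeasurableSpace E]
    {μ ν : Measure E} {d : ℝ} (h : UpperRegular μ d) {B : ℝ≥0}
    (hν : ∀ S, MeasurableSet S → ν S ≤ B * μ S) [OpensMeasurableSpace E] : UpperRegular ν d := by
  obtain ⟨C, hC⟩ := h
  refine ⟨B * C, fun x r hr => (hν _ Metric.isClosed_closedBall.measurableSet).trans ?_⟩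
  rw [ENNReal.coe_mul, mul_assoc]
  exact mul_le_mul' le_rfl (hC x r hr)

theorem upperRegular_restrict_volume (S : Set ℝⁿ) : UpperRegular (volume.restrict S) n :=
  upperRegular_volume_euclidean.of_le_smul (B := 1) fun T _ => by
    rw [ENNReal.coe_one, one_mul]
    exact Measure.restrict_apply_le _ _

theorem ae_integrable_riesz {m : ℝ} (hm : n < 2 * m) (hmn : m < n) {h : ℝⁿ → ℂ}
    (hh : StronglyMeasurable h) (hfin : ∫⁻ x, ‖h x‖ₑ ^ 2 < ∞) :
    ∀ᵐ P : ℝⁿ, Integrable fun x => ((‖P - x‖ ^ (-m) : ℝ) : ℂ) * h x := by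
  rw [← Measure.restrict_univ (μ := (volume : Measure ℝⁿ)), ← Metric.iUnion_closedBall_nat 0,
    ae_restrict_iUnion_iff]
  intro k
  have : IsFiniteMeasure (volume.restrict (Metric.closedBall (0 : ℝⁿ) k)) :=
    isFiniteMeasure_restrict.2 measure_closedBall_lt_top.ne
  have := (upperRegular_restrict_volume (Metric.closedBall (0 : ℝⁿ) k)).ae_integrable_riesz hm hmn
    (by linarith) hh hfin
  simpa only [Measure.restrict_univ, Metric.iUnion_closedBall_nat] using this

theorem lintegral_enorm_sq_lp_lt_top {X : Type*} [MeasurableSpace X] {μ : Measure X}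
    (f : Lp ℂ 2 μ) : ∫⁻ x, ‖f x‖ₑ ^ 2 ∂μ < ∞ := by
  rw [lintegral_enorm_sq_lp]
  exact ENNReal.ofReal_lt_top

theorem memLp_rieszPotential_restrict {m : ℝ} (hm : n < 2 * m) (hmn : m < n)
    (f : Lp ℂ 2 (volume : Measure ℝⁿ)) {S : Set ℝⁿ} (hS : IsCompact S) :
    MemLp (rieszPotential m f) 2 (volume.restrict S) := by
  have : IsFiniteMeasure (volume.restrict S) := isFiniteMeasure_restrict.2 hS.measure_lt_top.ne
  have hn0 : (0 : ℝ) ≤ n := n.cast_nonneg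
  obtain ⟨K, hK⟩ := (upperRegular_restrict_volume S).lintegral_riesz_sq_le hm hmn (by linarith)
  refine memLp_two_of_lintegral_sq_lt_top
    (stronglyMeasurable_rieszPotential m (Lp.stronglyMeasurable f)).aestronglyMeasurable
    (lt_of_le_of_lt ((lintegral_mono fun P => ?_).trans (hK _ (Lp.stronglyMeasurable f).enorm))
    (ENNReal.mul_lt_top ENNReal.coe_lt_top (lintegral_enorm_sq_lp_lt_top f)))
  gcongr
  exact enorm_rieszPotential_le (by linarith) f P

/-- Riesz potentials are integrable against Schwartz functions: the measure `|η x| dx` is finite and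
upper regular of dimension `n`, so that the bound for square integrals applies to it. -/
theorem exists_sq_lintegral_rieszPotential_mul_le {m : ℝ} (hm : n < 2 * m) (hmn : m < n)
    (η : 𝓢(ℝⁿ, ℂ)) : ∃ K : ℝ≥0, ∀ f : Lp ℂ 2 (volume : Measure ℝⁿ),
      (∫⁻ x, ‖rieszPotential m f x * η x‖ₑ) ^ 2 ≤ K * ENNReal.ofReal (‖f‖ ^ 2) := by
  have hn0 : (0 : ℝ) ≤ n := n.cast_nonneg
  obtain ⟨B, hB0, hB⟩ := exists_norm_schwartz_le η
  have hηm : Measurable fun x => ‖η x‖ₑ := η.continuous.enorm.measurable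
  have hη1 : ∫⁻ x, ‖η x‖ₑ < ∞ := η.integrable.2
  set σ : Measure ℝⁿ := volume.withDensity fun x => ‖η x‖ₑ
  have : IsFiniteMeasure σ := isFiniteMeasure_withDensity hη1.ne
  have hσ : UpperRegular σ n := upperRegular_volume_euclidean.of_le_smul (B := B.toNNReal)
    fun S hS => by
      rw [withDensity_apply _ hS]
      refine (setLIntegral_mono measurable_const fun x _ => ?_).trans_eq
        (setLIntegral_const S (B.toNNReal : ℝ≥0∞))
      rw [← ofReal_norm]
      exact ENNReal.ofReal_le_ofReal (hB x)
  obtain ⟨K, hK⟩ := hσ.lintegral_riesz_sq_le hm hmn (by linarith)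
  refine ⟨K * (∫⁻ x, ‖η x‖ₑ).toNNReal, fun f => ?_⟩
  have hw := stronglyMeasurable_rieszPotential m (Lp.stronglyMeasurable f)
  refine (sq_lintegral_le_of_sq_le (W := fun x => ‖η x‖ₑ * ‖rieszPotential m f x‖ₑ ^ 2)
    (V := fun x => ‖η x‖ₑ) (hηm.mul (hw.enorm.pow_const 2)).aemeasurable hηm.aemeasurable
    (Filter.Eventually.of_forall fun x => ?_)).trans ?_
  · rw [enorm_mul]
    exact le_of_eq (by ring)
  · rw [ENNReal.coe_mul, ENNReal.coe_toNNReal hη1.ne, mul_right_comm, ← lintegral_enorm_sq_lp]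
    gcongr
    have e := lintegral_withDensity_eq_lintegral_mul (volume : Measure ℝⁿ) hηm
      (hw.enorm.pow_const 2)
    simp only [Pi.mul_apply] at e
    rw [← e]
    refine (lintegral_mono fun P => ?_).trans (hK _ (Lp.stronglyMeasurable f).enorm)
    gcongr
    exact enorm_rieszPotential_le (by linarith) f P

theorem integrable_rieszPotential_mul {m : ℝ} (hm : n < 2 * m) (hmn : m < n)
    (η : 𝓢(ℝⁿ, ℂ)) (f : Lp ℂ 2 (volume : Measure ℝⁿ)) :
    Integrable fun x => rieszPotential m f x * η x := by
  obtain ⟨K, hK⟩ := exists_sq_lintegral_rieszPotential_mul_le hm hmn η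
  refine ⟨(stronglyMeasurable_rieszPotential m (Lp.stronglyMeasurable f)).aestronglyMeasurable.mul
    η.continuous.aestronglyMeasurable, ?_⟩
  exact (ENNReal.pow_lt_top_iff.1 ((hK f).trans_lt (ENNReal.mul_lt_top ENNReal.coe_lt_top
    ENNReal.ofReal_lt_top))).resolve_right two_ne_zero

/-- The Riesz potential of a square integrable function, as a distribution, depends continuously
on the function. -/
theorem exists_rieszPotential_pairing {m : ℝ} (hm : n < 2 * m) (hmn : m < n) (η : 𝓢(ℝⁿ, ℂ)) :
    ∃ Λ : Lp ℂ 2 (volume : Measure ℝⁿ) →L[ℂ] ℂ, ∀ f, Λ f = ∫ x, rieszPotential m f x * η x := by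
  obtain ⟨K, hK⟩ := exists_sq_lintegral_rieszPotential_mul_le hm hmn η
  have hint : ∀ h : Lp ℂ 2 (volume : Measure ℝⁿ), ∀ᵐ P : ℝⁿ,
      Integrable fun x => ((‖P - x‖ ^ (-m) : ℝ) : ℂ) * h x := fun h =>
    ae_integrable_riesz hm hmn (Lp.stronglyMeasurable h) (lintegral_enorm_sq_lp_lt_top h)
  let Λ₀ : Lp ℂ 2 (volume : Measure ℝⁿ) →ₗ[ℂ] ℂ :=
    { toFun := fun f => ∫ x, rieszPotential m f x * η x
      map_add' := fun h h' => by
        rw [← integral_add (integrable_rieszPotential_mul hm hmn η h)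
          (integrable_rieszPotential_mul hm hmn η h')]
        refine integral_congr_ae ?_
        filter_upwards [hint h, hint h'] with P h1 h2
        rw [← add_mul, rieszPotential, rieszPotential, rieszPotential, ← integral_add h1 h2]
        congr 1
        refine integral_congr_ae ((Lp.coeFn_add h h').mono fun x hx => ?_)
        simp only [hx, Pi.add_apply, mul_add]
      map_smul' := fun c h => by
        rw [RingHom.id_apply, smul_eq_mul, ← integral_const_mul]
        refine integral_congr_ae (Filter.Eventually.of_forall fun P => ?_)
        simp only
        rw [← mul_assoc, rieszPotential, rieszPotential, ← integral_const_mul]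
        congr 1
        refine integral_congr_ae ((Lp.coeFn_smul c h).mono fun x hx => ?_)
        simp only [hx, Pi.smul_apply, smul_eq_mul]
        ring }
  refine ⟨Λ₀.mkContinuous √K fun f => ?_, fun f => rfl⟩
  have h1 := hK f
  have h2 : ‖Λ₀ f‖ₑ ≤ ∫⁻ x, ‖rieszPotential m f x * η x‖ₑ := enorm_integral_le_lintegral_enorm _
  have h3 : ‖Λ₀ f‖ₑ ^ 2 ≤ K * ENNReal.ofReal (‖f‖ ^ 2) := le_trans (by gcongr) h1
  rw [← ofReal_norm, ← ENNReal.ofReal_pow (norm_nonneg _), ← ENNReal.ofReal_coe_nnreal,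
    ← ENNReal.ofReal_mul K.coe_nonneg, ENNReal.ofReal_le_ofReal_iff (by positivity)] at h3
  refine le_of_sq_le_sq ?_ (by positivity)
  rwa [mul_pow, Real.sq_sqrt K.coe_nonneg]

theorem memLp_norm_rpow_neg_mul_schwartz {s : ℝ} (hs : 0 < s) (hsn : 2 * s < n) (η : 𝓢(ℝⁿ, ℂ)) :
    MemLp (fun v : ℝⁿ => ((‖v‖ ^ (-s) : ℝ) : ℂ) * η v) 2 volume := by
  obtain ⟨B, hB0, hB⟩ := exists_norm_schwartz_le η
  have hm : AEStronglyMeasurable (fun v : ℝⁿ => ((‖v‖ ^ (-s) : ℝ) : ℂ) * η v) volume :=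
    (Measurable.aestronglyMeasurable (by fun_prop)).mul η.continuous.aestronglyMeasurable
  rw [memLp_two_iff_integrable_sq_norm hm]
  have h := (integrable_norm_rpow_neg_mul (a := 2 * s) (by linarith) hsn 0
    (η.integrable.bdd_mul η.continuous.aestronglyMeasurable (Filter.Eventually.of_forall hB))
    (B := B * B) (fun y => by
      rw [norm_mul]
      exact mul_le_mul (hB y) (hB y) (norm_nonneg _) hB0.le)).norm
  refine h.congr (Filter.Eventually.of_forall fun v => ?_)
  simp only [zero_sub, norm_neg, norm_mul, Complex.norm_real]
  rw [Real.norm_of_nonneg (by positivity), Real.norm_of_nonneg (by positivity), mul_pow,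
    ← Real.rpow_natCast (‖v‖ ^ (-s)), ← Real.rpow_mul (norm_nonneg _), sq]
  congr 2
  push_cast
  ring

/-- The Riesz potential of order `s` acts on `L²(ℝⁿ)` as the Fourier multiplier `c |ξ| ^ (-s)`,
in the sense of tempered distributions. -/
theorem exists_integral_rieszPotential_mul_eq {s : ℝ} (hs : 0 < s) (hsn : 2 * s < n) :
    ∃ c : ℝ, 0 < c ∧ ∀ (f : Lp ℂ 2 (volume : Measure ℝⁿ)) (η : 𝓢(ℝⁿ, ℂ)),
      ∫ x, rieszPotential (n - s) f x * η x =
        c * ∫ ξ, (((‖ξ‖ ^ (-s) : ℝ) : ℂ) * 𝓕⁻ η ξ) * (𝓕 f) ξ := by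
  obtain ⟨c, hc, hcη⟩ := exists_rieszPotential_schwartz_eq (n := n) hs (by linarith)
  refine ⟨c, hc, fun f η => ?_⟩
  obtain ⟨Λ, hΛ⟩ := exists_rieszPotential_pairing (n := n) (m := n - s) (by linarith)
    (by linarith) η
  have hM := memLp_norm_rpow_neg_mul_schwartz hs hsn (𝓕⁻ η)
  let Λ' : Lp ℂ 2 (volume : Measure ℝⁿ) →L[ℂ] ℂ :=
    (c : ℂ) • ((ContinuousLinearMap.mul ℂ ℂ).lpPairing volume 2 2 (hM.toLp _) ∘L
      FourierTransform.fourierCLM ℂ (Lp ℂ 2 (volume : Measure ℝⁿ)))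
  have hΛ' : ∀ f, Λ' f = c * ∫ ξ, (((‖ξ‖ ^ (-s) : ℝ) : ℂ) * 𝓕⁻ η ξ) * (𝓕 f) ξ := fun f => by
    change (c : ℂ) * (ContinuousLinearMap.mul ℂ ℂ).lpPairing volume 2 2 (hM.toLp _) (𝓕 f) = _
    rw [ContinuousLinearMap.lpPairing_eq_integral]
    congr 1
    refine integral_congr_ae (hM.coeFn_toLp.mono fun x hx => ?_)
    simp only [ContinuousLinearMap.mul_apply', hx]
  rw [← hΛ, ← hΛ']
  congr 1
  refine ContinuousLinearMap.coeFn_injective ((SchwartzMap.denseRange_toLpCLM (p := 2)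
    ENNReal.ofNat_ne_top).equalizer Λ.continuous Λ'.continuous (funext fun φ => ?_))
  change Λ (φ.toLp 2) = Λ' (φ.toLp 2)
  rw [hΛ, hΛ', SchwartzMap.toLp_fourier_eq]
  have e1 : ∀ x, rieszPotential (n - s) (φ.toLp 2) x =
      c * 𝓕⁻ (fun v : ℝⁿ => ((‖v‖ ^ (-s) : ℝ) : ℂ) * 𝓕 φ v) x := fun x => by
    rw [← hcη]
    exact integral_congr_ae ((φ.coeFn_toLp 2 volume).mono fun y hy => by simp only [hy])
  obtain ⟨D, -, hD⟩ := exists_norm_schwartz_le (𝓕 φ)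
  have hi : Integrable fun v : ℝⁿ => ((‖v‖ ^ (-s) : ℝ) : ℂ) * 𝓕 φ v := by
    simpa only [zero_sub, norm_neg] using
      integrable_norm_rpow_neg_mul hs (by linarith) 0 (𝓕 φ).integrable hD
  simp only [e1, mul_assoc]
  rw [integral_const_mul]
  congr 1
  rw [integral_fourierInv_mul_eq_of_integrable hi η.integrable, ← SchwartzMap.fourierInv_coe]
  refine integral_congr_ae (((𝓕 φ).coeFn_toLp 2 volume).mono fun ξ hξ => ?_)
  simp only [hξ]
  ring

end Multiplier

/-! ### Riesz potentials in the homogeneous Sobolev space -/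

section HomogeneousSobolev

variable {n : ℕ}

local notation "ℝⁿ" => EuclideanSpace ℝ (Fin n)

theorem memLp_norm_rpow_neg_restrict {s : ℝ} (hs : 0 < s) (hsn : 2 * s < n) :
    MemLp (fun v : ℝⁿ => ((‖v‖ ^ (-s) : ℝ) : ℂ)) 2 (volume.restrict (Metric.closedBall 0 1)) := by
  obtain ⟨K, hK⟩ := (upperRegular_volume_euclidean (n := n)).lintegral_near
    (b := 2 * s) (by linarith) hsn
  refine memLp_two_of_lintegral_sq_lt_top (Measurable.aestronglyMeasurable (by fun_prop))
    (lt_of_le_of_lt (lintegral_mono fun v => ?_) ((hK 0 1 one_pos).trans_lt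
      (ENNReal.mul_lt_top ENNReal.coe_lt_top ENNReal.ofReal_lt_top)))
  rw [zero_sub, enorm_neg, enorm_ofReal_complex]
  refine (pow_le_pow_left' (enorm_norm_rpow_neg_le hs v) 2).trans_eq ?_
  rw [← ENNReal.rpow_natCast, ← ENNReal.rpow_mul]
  congr 1
  push_cast
  ring

theorem integrable_norm_rpow_neg_mul_restrict {s : ℝ} (hs : 0 < s) (hsn : 2 * s < n)
    (F : Lp ℂ 2 (volume : Measure ℝⁿ)) :
    IntegrableOn (fun v : ℝⁿ => ((‖v‖ ^ (-s) : ℝ) : ℂ) * F v) (Metric.closedBall 0 1) :=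
  (memLp_norm_rpow_neg_restrict hs hsn).integrable_mul ((Lp.memLp F).restrict _)

theorem memLp_norm_rpow_neg_mul_restrict_compl {s : ℝ} (hs : 0 < s)
    (F : Lp ℂ 2 (volume : Measure ℝⁿ)) :
    MemLp (fun v : ℝⁿ => ((‖v‖ ^ (-s) : ℝ) : ℂ) * F v) 2
      (volume.restrict (Metric.closedBall 0 1)ᶜ) := by
  refine MemLp.of_le_mul (c := 1) ((Lp.memLp F).restrict _)
    ((Measurable.aestronglyMeasurable (by fun_prop)).mul
      (Lp.stronglyMeasurable F).aestronglyMeasurable) ?_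
  refine (ae_restrict_iff' Metric.isClosed_closedBall.measurableSet.compl).2
      (Filter.Eventually.of_forall fun v hv => ?_)
  rw [Set.mem_compl_iff, Metric.mem_closedBall, not_le, dist_zero_right] at hv
  rw [norm_mul, Complex.norm_real, Real.norm_of_nonneg (by positivity)]
  gcongr
  exact Real.rpow_le_one_of_one_le_of_nonpos hv.le (by linarith)

theorem locallyIntegrable_norm_rpow_neg_mul {s : ℝ} (hs : 0 < s) (hsn : 2 * s < n)
    (F : Lp ℂ 2 (volume : Measure ℝⁿ)) :
    LocallyIntegrable (fun v : ℝⁿ => ((‖v‖ ^ (-s) : ℝ) : ℂ) * F v) := by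
  rw [locallyIntegrable_iff]
  intro k hk
  have : IsFiniteMeasure (volume.restrict k) := isFiniteMeasure_restrict.2 hk.measure_lt_top.ne
  have h2 : IntegrableOn (fun v : ℝⁿ => ((‖v‖ ^ (-s) : ℝ) : ℂ) * F v)
      (k ∩ (Metric.closedBall 0 1)ᶜ) := by
    have h := memLp_norm_rpow_neg_mul_restrict_compl hs F
    have : IsFiniteMeasure (volume.restrict (k ∩ (Metric.closedBall (0 : ℝⁿ) 1)ᶜ)) :=
      isFiniteMeasure_restrict.2
        (lt_of_le_of_lt (measure_mono Set.inter_subset_left) hk.measure_lt_top).ne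
    exact (h.mono_measure (Measure.restrict_mono Set.inter_subset_right le_rfl)).integrable
      one_le_two
  rw [← Set.inter_union_compl k (Metric.closedBall (0 : ℝⁿ) 1)]
  exact ((integrable_norm_rpow_neg_mul_restrict hs hsn F).mono_set Set.inter_subset_right).union h2

/-- The function `|ξ| ^ (-s) F`, with `F` square integrable, is a tempered distribution: it is the
sum of an integrable and of a square integrable function. -/
theorem exists_temperedDistribution_norm_rpow_neg_mul {s : ℝ} (hs : 0 < s) (hsn : 2 * s < n)
    (F : Lp ℂ 2 (volume : Measure ℝⁿ)) : ∃ G : 𝓢'(ℝⁿ, ℂ), ∀ η : 𝓢(ℝⁿ, ℂ),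
      G η = ∫ ξ, η ξ * (((‖ξ‖ ^ (-s) : ℝ) : ℂ) * F ξ) := by
  set g : ℝⁿ → ℂ := fun v => ((‖v‖ ^ (-s) : ℝ) : ℂ) * F v with hg
  set B : Set ℝⁿ := Metric.closedBall 0 1
  have hB : MeasurableSet B := Metric.isClosed_closedBall.measurableSet
  have h1 : MemLp (B.indicator g) 1 volume :=
    memLp_one_iff_integrable.2
      ((integrable_indicator_iff hB).2 (integrable_norm_rpow_neg_mul_restrict hs hsn F))
  have h2 : MemLp (Bᶜ.indicator g) 2 volume :=
    (memLp_indicator_iff_restrict hB.compl).2 (memLp_norm_rpow_neg_mul_restrict_compl hs F)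
  refine ⟨Lp.toTemperedDistribution (h1.toLp _) + Lp.toTemperedDistribution (h2.toLp _),
    fun η => ?_⟩
  obtain ⟨C, -, hC⟩ := exists_norm_schwartz_le η
  have i1 : Integrable fun ξ => η ξ * B.indicator g ξ :=
    (memLp_one_iff_integrable.1 h1).bdd_mul η.continuous.aestronglyMeasurable
      (Filter.Eventually.of_forall hC)
  have i2 : Integrable fun ξ => η ξ * Bᶜ.indicator g ξ := (η.memLp 2).integrable_mul h2
  have e1 : Lp.toTemperedDistribution (h1.toLp _) η = ∫ ξ, η ξ * B.indicator g ξ := by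
    rw [Lp.toTemperedDistribution_apply]
    exact integral_congr_ae (h1.coeFn_toLp.mono fun x hx => by simp only [hx, smul_eq_mul])
  have e2 : Lp.toTemperedDistribution (h2.toLp _) η = ∫ ξ, η ξ * Bᶜ.indicator g ξ := by
    rw [Lp.toTemperedDistribution_apply]
    exact integral_congr_ae (h2.coeFn_toLp.mono fun x hx => by simp only [hx, smul_eq_mul])
  change Lp.toTemperedDistribution (h1.toLp _) η + Lp.toTemperedDistribution (h2.toLp _) η = _
  rw [e1, e2, ← integral_add i1 i2]
  refine integral_congr_ae (Filter.Eventually.of_forall fun ξ => ?_)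
  simp only
  rw [← mul_add, Set.indicator_self_add_compl_apply]

/-- The Riesz potential of order `s` of `f ∈ L²(ℝⁿ)` lies in the homogeneous Sobolev space of order
`s`, with Fourier transform `c |ξ| ^ (-s) 𝓕 f`. -/
theorem memHomogeneousSobolev_rieszPotential {s : ℝ} (hs : 0 < s) (hsn : 2 * s < n)
    (f : Lp ℂ 2 (volume : Measure ℝⁿ)) :
    MemHomogeneousSobolev s (rieszPotential (n - s) f) := by
  refine ⟨fun S hS => memLp_rieszPotential_restrict (by linarith) (by linarith) f hS, ?_⟩
  obtain ⟨c, hc, hcf⟩ := exists_integral_rieszPotential_mul_eq (n := n) hs hsn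
  obtain ⟨G, hG⟩ := exists_temperedDistribution_norm_rpow_neg_mul hs hsn (𝓕 f)
  refine ⟨(c : ℂ) • 𝓕⁻ G, fun η _ => ?_,
    fun ξ => c * (((‖ξ‖ ^ (-s) : ℝ) : ℂ) * (𝓕 f) ξ), ?_, fun η _ => ?_, ?_⟩
  · change (c : ℂ) * G (𝓕⁻ η) = _
    rw [hG]
    have h := hcf f η
    simp only [mul_comm (rieszPotential _ _ _)] at h
    rw [h]
    congr 1
    refine integral_congr_ae (Filter.Eventually.of_forall fun ξ => ?_)
    simp only
    ring
  · exact (locallyIntegrable_norm_rpow_neg_mul hs hsn (𝓕 f)).smul (c : ℂ)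
  · rw [FourierTransform.fourier_smul, FourierTransform.fourier_fourierInv_eq]
    change (c : ℂ) * G η = _
    rw [hG, ← integral_const_mul]
    refine integral_congr_ae (Filter.Eventually.of_forall fun ξ => ?_)
    simp only
    ring
  · have hle : ∀ (ξ : ℝⁿ) (z : ℂ), ENNReal.ofReal (‖ξ‖ ^ (2 * s) *
        ‖(c : ℂ) * (((‖ξ‖ ^ (-s) : ℝ) : ℂ) * z)‖ ^ 2) ≤
        ENNReal.ofReal (c ^ 2) * ‖z‖ₑ ^ 2 := fun ξ z => by
      rw [← ofReal_norm z, ← ENNReal.ofReal_pow (norm_nonneg _),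
        ← ENNReal.ofReal_mul (by positivity)]
      refine ENNReal.ofReal_le_ofReal ?_
      have h1 : ‖ξ‖ ^ (2 * s) * (‖ξ‖ ^ (-s)) ^ 2 ≤ 1 := by
        rcases eq_or_ne ξ 0 with rfl | h0
        · rw [norm_zero, Real.zero_rpow (by positivity), zero_mul]
          exact zero_le_one
        · have hpos : 0 < ‖ξ‖ := norm_pos_iff.2 h0
          rw [← Real.rpow_natCast (‖ξ‖ ^ (-s)), ← Real.rpow_mul hpos.le, ← Real.rpow_add hpos]
          refine le_of_eq ?_
          rw [← Real.rpow_zero ‖ξ‖]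
          congr 1
          push_cast
          ring
      rw [norm_mul, norm_mul, Complex.norm_real, Complex.norm_real, Real.norm_of_nonneg hc.le,
        Real.norm_of_nonneg (by positivity), mul_pow, mul_pow]
      calc _ = (‖ξ‖ ^ (2 * s) * (‖ξ‖ ^ (-s)) ^ 2) * (c ^ 2 * ‖z‖ ^ 2) := by ring
        _ ≤ 1 * (c ^ 2 * ‖z‖ ^ 2) := by gcongr
        _ = _ := one_mul _
    refine (lintegral_mono fun ξ => hle ξ _).trans_lt ?_
    rw [lintegral_const_mul' _ _ ENNReal.ofReal_ne_top]
    exact ENNReal.mul_lt_top ENNReal.ofReal_lt_top (lintegral_enorm_sq_lp_lt_top (𝓕 f))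

end HomogeneousSobolev

/-! ### The Gagliardo seminorm of a Riesz potential -/

section Gagliardo

variable {n : ℕ}

local notation "ℝⁿ" => EuclideanSpace ℝ (Fin n)

/-- The symbol `exp (2πi ⟪ξ, h⟫) - 1` of the difference operator `w ↦ w (· + h) - w`. -/
noncomputable def differenceSymbol (h ξ : ℝⁿ) : ℂ :=
  Complex.exp ((2 * Real.pi * inner ℝ ξ h : ℝ) * Complex.I) - 1

theorem norm_differenceSymbol_le_two (h ξ : ℝⁿ) : ‖differenceSymbol h ξ‖ ≤ 2 := by
  refine (norm_sub_le _ _).trans ?_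
  rw [Complex.norm_exp_ofReal_mul_I, norm_one]
  norm_num

theorem norm_differenceSymbol_le (h ξ : ℝⁿ) :
    ‖differenceSymbol h ξ‖ ≤ 2 * Real.pi * (‖h‖ * ‖ξ‖) := by
  have hpi := Real.pi_pos
  rw [differenceSymbol, mul_comm _ Complex.I]
  refine Real.norm_exp_I_mul_ofReal_sub_one_le.trans ?_
  rw [norm_mul, Real.norm_of_nonneg (by positivity), mul_comm ‖h‖]
  gcongr
  exact norm_inner_le_norm ξ h

theorem continuous_differenceSymbol :
    Continuous fun p : ℝⁿ × ℝⁿ => differenceSymbol p.1 p.2 := by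
  unfold differenceSymbol
  fun_prop

theorem continuous_differenceSymbol_right (h : ℝⁿ) : Continuous (differenceSymbol h) := by
  unfold differenceSymbol
  fun_prop

theorem continuous_differenceSymbol_left (ξ : ℝⁿ) :
    Continuous fun h => differenceSymbol h ξ := by
  unfold differenceSymbol
  fun_prop

/-- On the Fourier side, the difference operator is multiplication by its symbol. -/
theorem fourierInv_compSubConst_sub (η : 𝓢(ℝⁿ, ℂ)) (h ξ : ℝⁿ) :
    𝓕⁻ (η.compSubConstCLM ℂ h - η) ξ = differenceSymbol h ξ * 𝓕⁻ η ξ := by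
  have e : 𝓕⁻ (η.compSubConstCLM ℂ h - η) = 𝓕⁻ (η.compSubConstCLM ℂ h) - 𝓕⁻ η :=
    map_sub (FourierTransform.fourierInvCLM ℂ 𝓢(ℝⁿ, ℂ)) _ _
  rw [e, sub_apply, differenceSymbol, sub_mul, one_mul]
  congr 1
  rw [SchwartzMap.fourierInv_coe, SchwartzMap.fourierInv_coe, Real.fourierInv_eq',
    Real.fourierInv_eq', ← integral_const_mul,
    ← integral_sub_right_eq_self (fun v => Complex.exp ((2 * Real.pi * inner ℝ ξ h : ℝ) *
      Complex.I) * Complex.exp ((2 * Real.pi * inner ℝ v ξ : ℝ) * Complex.I) • η v) h]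
  refine integral_congr_ae (Filter.Eventually.of_forall fun v => ?_)
  simp only [SchwartzMap.compSubConstCLM_apply, smul_eq_mul]
  rw [← mul_assoc, ← Complex.exp_add, inner_sub_left, real_inner_comm h ξ]
  congr 2
  push_cast
  ring

/-- The symbol is `O(|ξ|)` near `ξ = 0`, which compensates for the singularity of `|ξ| ^ (-s)`, as
`s < 1`. -/
theorem memLp_differenceSymbol_mul {s : ℝ} (hs : 0 < s) (hs1 : s < 1) (h : ℝⁿ)
    (F : Lp ℂ 2 (volume : Measure ℝⁿ)) :
    MemLp (fun ξ => differenceSymbol h ξ * (((‖ξ‖ ^ (-s) : ℝ) : ℂ) * F ξ)) 2 volume := by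
  have hpi := Real.pi_pos
  refine MemLp.of_le_mul (c := 2 * Real.pi * ‖h‖ + 2) (Lp.memLp F)
    ((continuous_differenceSymbol_right h).aestronglyMeasurable.mul
      ((Measurable.aestronglyMeasurable (by fun_prop)).mul
        (Lp.stronglyMeasurable F).aestronglyMeasurable)) (Filter.Eventually.of_forall fun ξ => ?_)
  rw [norm_mul, norm_mul, ← mul_assoc, Complex.norm_real, Real.norm_of_nonneg (by positivity)]
  gcongr
  rcases le_total 1 ‖ξ‖ with h1 | h1
  · calc _ ≤ 2 * 1 := mul_le_mul (norm_differenceSymbol_le_two h ξ)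
          (Real.rpow_le_one_of_one_le_of_nonpos h1 (by linarith)) (by positivity) (by norm_num)
      _ ≤ _ := by linarith [show 0 ≤ 2 * Real.pi * ‖h‖ by positivity]
  · rcases eq_or_ne ξ 0 with rfl | h0
    · rw [norm_zero, Real.zero_rpow (by linarith), mul_zero]
      positivity
    have hpos : 0 < ‖ξ‖ := norm_pos_iff.2 h0
    calc _ ≤ 2 * Real.pi * (‖h‖ * ‖ξ‖) * ‖ξ‖ ^ (-s) := by
          gcongr
          exact norm_differenceSymbol_le h ξ
      _ = 2 * Real.pi * ‖h‖ * ‖ξ‖ ^ (1 - s) := by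
          rw [sub_eq_add_neg, Real.rpow_add hpos, Real.rpow_one]
          ring
      _ ≤ 2 * Real.pi * ‖h‖ * 1 := by
          gcongr
          exact Real.rpow_le_one hpos.le h1 (by linarith)
      _ ≤ _ := by linarith

/-- The difference operator is moved to the test function. -/
theorem integral_rieszPotential_sub_mul {m : ℝ} (hm : n < 2 * m) (hmn : m < n)
    (f : Lp ℂ 2 (volume : Measure ℝⁿ)) (h : ℝⁿ) (η : 𝓢(ℝⁿ, ℂ)) :
    ∫ x, (rieszPotential m f (x + h) - rieszPotential m f x) * η x =
      ∫ x, rieszPotential m f x * (η.compSubConstCLM ℂ h - η) x := by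
  have i1 := integrable_rieszPotential_mul hm hmn (η.compSubConstCLM ℂ h) f
  have i2 := integrable_rieszPotential_mul hm hmn η f
  have i1' := i1.comp_add_right h
  simp only [SchwartzMap.compSubConstCLM_apply, add_sub_cancel_right] at i1'
  simp only [sub_mul, sub_apply, mul_sub]
  rw [integral_sub i1' i2, integral_sub i1 i2,
    ← integral_add_right_eq_self (fun x => rieszPotential m f x * η.compSubConstCLM ℂ h x) h]
  simp only [SchwartzMap.compSubConstCLM_apply, add_sub_cancel_right]

/-- Plancherel's theorem for the differences of a Riesz potential. -/
theorem exists_lintegral_rieszPotential_difference_eq {s : ℝ} (hs : 0 < s) (hs1 : s < 1)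
    (hsn : 2 * s < n) : ∃ c : ℝ≥0, ∀ (f : Lp ℂ 2 (volume : Measure ℝⁿ)) (h : ℝⁿ),
      ∫⁻ x, ‖rieszPotential (n - s) f (x + h) - rieszPotential (n - s) f x‖ₑ ^ 2 =
        c * ∫⁻ ξ, ‖differenceSymbol h ξ * (((‖ξ‖ ^ (-s) : ℝ) : ℂ) * (𝓕 f) ξ)‖ₑ ^ 2 := by
  obtain ⟨c, hc, hcf⟩ := exists_integral_rieszPotential_mul_eq (n := n) hs hsn
  refine ⟨(c ^ 2).toNNReal, fun f h => ?_⟩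
  have hD := memLp_differenceSymbol_mul hs hs1 h (𝓕 f)
  -- `N` is the square integrable function that has the expected Fourier transform. It agrees with
  -- the difference of the potentials as a distribution, hence almost everywhere.
  set N : Lp ℂ 2 (volume : Measure ℝⁿ) := (c : ℂ) • 𝓕⁻ (hD.toLp _) with hN
  have hNη : ∀ η : 𝓢(ℝⁿ, ℂ), ∫ x, η x * N x =
      ∫ x, η x * (rieszPotential (n - s) f (x + h) - rieszPotential (n - s) f x) := fun η => by
    have e1 : ∫ x, η x * N x = c * (Lp.toTemperedDistribution (𝓕⁻ (hD.toLp _))) η := by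
      rw [Lp.toTemperedDistribution_apply, ← integral_const_mul]
      refine integral_congr_ae ((Lp.coeFn_smul (c : ℂ) (𝓕⁻ (hD.toLp _))).mono fun x hx => ?_)
      simp only [hN, hx, Pi.smul_apply, smul_eq_mul]
      ring
    rw [e1, ← Lp.fourierInv_toTemperedDistribution_eq, TemperedDistribution.fourierInv_apply,
      Lp.toTemperedDistribution_apply]
    simp only [mul_comm (η _)]
    rw [integral_rieszPotential_sub_mul (by linarith) (by linarith) f h η, hcf]
    congr 1
    refine integral_congr_ae (hD.coeFn_toLp.mono fun ξ hξ => ?_)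
    simp only [hξ, smul_eq_mul, fourierInv_compSubConst_sub]
    ring
  have hloc : LocallyIntegrable (rieszPotential (n - s) f) (volume : Measure ℝⁿ) := by
    rw [locallyIntegrable_iff]
    intro k hk
    have : IsFiniteMeasure (volume.restrict k) := isFiniteMeasure_restrict.2 hk.measure_lt_top.ne
    exact (memLp_rieszPotential_restrict (by linarith) (by linarith) f hk).integrable one_le_two
  have hloc' : LocallyIntegrable (fun x => rieszPotential (n - s) f (x + h))
      (volume : Measure ℝⁿ) := by
    rw [locallyIntegrable_iff] at hloc ⊢
    intro k hk
    have h1 := hloc _ (hk.image (f := (· + h)) (by fun_prop))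
    rw [← (measurePreserving_add_right volume h).integrableOn_comp_preimage
      (measurableEmbedding_addRight h), Set.preimage_image_eq _ (add_left_injective h)] at h1
    exact h1
  have hae : ∀ᵐ x : ℝⁿ, N x =
      rieszPotential (n - s) f (x + h) - rieszPotential (n - s) f x := by
    refine ae_eq_of_integral_contDiff_smul_eq ((Lp.memLp N).locallyIntegrable one_le_two)
      (hloc'.sub hloc) fun g hg hgc => ?_
    have hg₁ : HasCompactSupport (Complex.ofRealCLM ∘ g) := hgc.comp_left rfl
    have hg₂ : ContDiff ℝ ((⊤ : ℕ∞) : WithTop ℕ∞) (Complex.ofRealCLM ∘ g) :=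
      Complex.ofRealCLM.contDiff.comp hg
    exact hNη (hg₁.toSchwartzMap hg₂)
  rw [lintegral_congr_ae (hae.mono fun x hx => by rw [← hx]), lintegral_enorm_sq_lp, hN, norm_smul]
  have e2 : ‖𝓕⁻ (hD.toLp _)‖ = ‖hD.toLp _‖ := by
    rw [← Lp.norm_fourier_eq, FourierTransform.fourier_fourierInv_eq]
  rw [e2, mul_pow, ENNReal.ofReal_mul (by positivity), ← lintegral_enorm_sq_lp, Complex.norm_real,
    Real.norm_of_nonneg hc.le]
  congr 1
  exact lintegral_congr_ae (hD.coeFn_toLp.mono fun x hx => by simp only [hx])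

/-- The integral of the squared symbol of the differences, against the Gagliardo weight. It
converges at `h = 0` as `s < 1`, and at infinity as `s > 0`. -/
theorem exists_lintegral_differenceSymbol_le {s : ℝ} (hs : 0 < s) (hs1 : s < 1)
    (hn : 2 ≤ (n : ℝ)) : ∃ K : ℝ≥0, ∀ ξ : ℝⁿ, ξ ≠ 0 →
      ∫⁻ h, ‖differenceSymbol h ξ‖ₑ ^ 2 * ‖h‖ₑ ^ (-(n + 2 * s)) ≤ K * ‖ξ‖ₑ ^ (2 * s) := by
  obtain ⟨K₁, hK₁⟩ := (upperRegular_volume_euclidean (n := n)).lintegral_near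
    (b := n + 2 * s - 2) (by linarith) (by linarith)
  obtain ⟨K₂, hK₂⟩ := (upperRegular_volume_euclidean (n := n)).lintegral_far
    (b := n + 2 * s) (by linarith) (by linarith)
  refine ⟨((2 * Real.pi) ^ 2).toNNReal * K₁ + 4 * K₂, fun ξ hξ => ?_⟩
  have hpi := Real.pi_pos
  have hξ0 : ‖ξ‖ₑ ≠ 0 := enorm_ne_zero.2 hξ
  have hpos : 0 < ‖ξ‖ := norm_pos_iff.2 hξ
  have hr : ∀ a : ℝ, ENNReal.ofReal (‖ξ‖⁻¹ ^ a) = ‖ξ‖ₑ ^ (-a) := fun a => by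
    rw [enorm_rpow_eq_ofReal hξ, Real.inv_rpow hpos.le, Real.rpow_neg hpos.le]
  have hB : MeasurableSet (Metric.closedBall (0 : ℝⁿ) ‖ξ‖⁻¹) :=
    Metric.isClosed_closedBall.measurableSet
  -- The two bounds on the symbol balance at `‖h‖ = ‖ξ‖⁻¹`.
  rw [← lintegral_add_compl _ hB, ENNReal.coe_add, add_mul]
  refine add_le_add ?_ ?_
  · have hle : ∀ h : ℝⁿ, ‖differenceSymbol h ξ‖ₑ ^ 2 * ‖h‖ₑ ^ (-(n + 2 * s)) ≤
        ENNReal.ofReal ((2 * Real.pi) ^ 2) * ‖ξ‖ₑ ^ 2 * ‖0 - h‖ₑ ^ (-(n + 2 * s - 2)) := fun h => by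
      have h1 : ‖differenceSymbol h ξ‖ₑ ≤ ENNReal.ofReal (2 * Real.pi) * (‖h‖ₑ * ‖ξ‖ₑ) := by
        rw [← ofReal_norm, ← ofReal_norm, ← ofReal_norm, ← ENNReal.ofReal_mul (norm_nonneg _),
          ← ENNReal.ofReal_mul (by positivity)]
        exact ENNReal.ofReal_le_ofReal (norm_differenceSymbol_le h ξ)
      rcases eq_or_ne h 0 with rfl | h0
      · have : ‖differenceSymbol 0 ξ‖ₑ = 0 := by simpa using h1
        rw [this]
        simp
      · have h2 : ‖h‖ₑ ^ 2 * ‖h‖ₑ ^ (-(n + 2 * s)) = ‖h‖ₑ ^ (-(n + 2 * s - 2)) := by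
          rw [← ENNReal.rpow_natCast, ← ENNReal.rpow_add _ _ (enorm_ne_zero.2 h0) enorm_ne_top]
          congr 1
          push_cast
          ring
        rw [zero_sub, enorm_neg, ← h2, ENNReal.ofReal_pow (by positivity)]
        calc _ ≤ (ENNReal.ofReal (2 * Real.pi) * (‖h‖ₑ * ‖ξ‖ₑ)) ^ 2 * ‖h‖ₑ ^ (-(n + 2 * s)) := by
              gcongr
          _ = _ := by ring
    refine (lintegral_mono hle).trans ?_
    rw [lintegral_const_mul' _ _ (by finiteness)]
    refine (mul_le_mul' le_rfl (hK₁ 0 _ (inv_pos.2 hpos))).trans_eq ?_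
    rw [hr, ENNReal.coe_mul, ofReal_toNNReal_coe]
    have h3 : ‖ξ‖ₑ ^ 2 * ‖ξ‖ₑ ^ (-((n : ℝ) - (n + 2 * s - 2))) = ‖ξ‖ₑ ^ (2 * s) := by
      rw [← ENNReal.rpow_natCast, ← ENNReal.rpow_add _ _ hξ0 enorm_ne_top]
      congr 1
      push_cast
      ring
    rw [← h3]
    ring
  · have hle : ∀ h : ℝⁿ, ‖differenceSymbol h ξ‖ₑ ^ 2 * ‖h‖ₑ ^ (-(n + 2 * s)) ≤
        4 * ‖0 - h‖ₑ ^ (-(n + 2 * s)) := fun h => by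
      rw [zero_sub, enorm_neg]
      gcongr
      have h1 : ‖differenceSymbol h ξ‖ₑ ≤ 2 := by
        rw [← ofReal_norm]
        exact (ENNReal.ofReal_le_ofReal (norm_differenceSymbol_le_two h ξ)).trans_eq (by simp)
      exact (pow_le_pow_left' h1 2).trans_eq (by norm_num)
    refine (lintegral_mono hle).trans ?_
    rw [lintegral_const_mul' _ _ (by finiteness)]
    refine (mul_le_mul' le_rfl (hK₂ 0 _ (inv_pos.2 hpos))).trans_eq ?_
    rw [hr, ENNReal.coe_mul, mul_assoc]
    congr 3
    ring

/-- At `h = 0` the left-hand side is `0 / 0 = 0` and the right-hand side `0 * ∞ = 0`. -/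
theorem ofReal_sq_div_rpow_le (b : ℝ) (z : ℂ) (h : ℝⁿ) (hz : h = 0 → z = 0) :
    ENNReal.ofReal (‖z‖ ^ 2 / ‖h‖ ^ b) ≤ ‖z‖ₑ ^ 2 * ‖h‖ₑ ^ (-b) := by
  rcases eq_or_ne h 0 with rfl | h0
  · simp [hz rfl]
  · rw [enorm_rpow_eq_ofReal h0, ← ofReal_norm, ← ENNReal.ofReal_pow (norm_nonneg _),
      ← ENNReal.ofReal_mul (by positivity), Real.rpow_neg (norm_nonneg _), div_eq_mul_inv]

theorem enorm_rpow_neg_mul_sq_mul_le {s : ℝ} (hs : 0 < s) {ξ : ℝⁿ} (hξ : ξ ≠ 0) (z : ℂ) :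
    ‖((‖ξ‖ ^ (-s) : ℝ) : ℂ) * z‖ₑ ^ 2 * ‖ξ‖ₑ ^ (2 * s) ≤ ‖z‖ₑ ^ 2 := by
  have h1 : ‖ξ‖ₑ ≠ 0 := enorm_ne_zero.2 hξ
  rw [enorm_mul, enorm_ofReal_complex, mul_pow]
  calc _ ≤ (‖ξ‖ₑ ^ (-s)) ^ 2 * ‖z‖ₑ ^ 2 * ‖ξ‖ₑ ^ (2 * s) := by
        gcongr
        exact enorm_norm_rpow_neg_le hs ξ
    _ = ((‖ξ‖ₑ ^ (-s)) ^ 2 * ‖ξ‖ₑ ^ (2 * s)) * ‖z‖ₑ ^ 2 := by ring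
    _ = 1 * ‖z‖ₑ ^ 2 := by
        rw [← ENNReal.rpow_natCast, ← ENNReal.rpow_mul, ← ENNReal.rpow_add _ _ h1 enorm_ne_top]
        congr 1
        rw [← ENNReal.rpow_zero (x := ‖ξ‖ₑ)]
        congr 1
        push_cast
        ring
    _ ≤ _ := (one_mul _).le

/-- With the substitution `y = x + h`, the Gagliardo integral is the integral in `h` of the squared
norms of the differences. These are given by Plancherel's theorem, and integrating in `h` first
leaves the bound for the symbol. -/
theorem gagliardoIntegral_le_of_difference {s : ℝ} (hs : 0 < s) (hn : 0 < (n : ℝ)) {c K : ℝ≥0}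
    (hK : ∀ ξ : ℝⁿ, ξ ≠ 0 →
      ∫⁻ h, ‖differenceSymbol h ξ‖ₑ ^ 2 * ‖h‖ₑ ^ (-(n + 2 * s)) ≤ K * ‖ξ‖ₑ ^ (2 * s))
    {w F : ℝⁿ → ℂ} (hw : Measurable w) (hF : Measurable F)
    (hc : ∀ h, ∫⁻ x, ‖w (x + h) - w x‖ₑ ^ 2 =
      c * ∫⁻ ξ, ‖differenceSymbol h ξ * (((‖ξ‖ ^ (-s) : ℝ) : ℂ) * F ξ)‖ₑ ^ 2) :
    gagliardoIntegral s w ≤ c * K * ∫⁻ ξ, ‖F ξ‖ₑ ^ 2 := by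
  have hw' : Measurable fun p : ℝⁿ × ℝⁿ => ‖w (p.1 + p.2) - w p.1‖ₑ ^ 2 :=
    ((hw.comp (by fun_prop : Measurable fun p : ℝⁿ × ℝⁿ => p.1 + p.2)).sub
      (hw.comp measurable_fst)).enorm.pow_const 2
  set b : ℝ := n + 2 * s
  set A : ℝⁿ → ℝ≥0∞ := fun ξ => ‖((‖ξ‖ ^ (-s) : ℝ) : ℂ) * F ξ‖ₑ ^ 2 with hA
  have hAm : Measurable A := (Measurable.mul (by fun_prop) hF).enorm.pow_const 2
  have hS : Measurable fun p : ℝⁿ × ℝⁿ => ‖differenceSymbol p.1 p.2‖ₑ ^ 2 :=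
    continuous_differenceSymbol.measurable.enorm.pow_const 2
  have h1 : gagliardoIntegral s w ≤ ∫⁻ x, ∫⁻ h, ‖w (x + h) - w x‖ₑ ^ 2 * ‖h‖ₑ ^ (-b) := by
    unfold gagliardoIntegral
    refine lintegral_mono fun x => ?_
    have e := lintegral_add_left_eq_self (μ := (volume : Measure ℝⁿ))
      (fun y => ENNReal.ofReal (‖w x - w y‖ ^ 2 / ‖x - y‖ ^ b)) x
    rw [← e]
    refine lintegral_mono fun h => ?_
    rw [norm_sub_rev (w x), sub_add_cancel_left, norm_neg]
    refine ofReal_sq_div_rpow_le b _ h fun h0 => ?_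
    rw [h0, add_zero, sub_self]
  have hAs : ∀ (h ξ : ℝⁿ), ‖differenceSymbol h ξ * (((‖ξ‖ ^ (-s) : ℝ) : ℂ) * F ξ)‖ₑ ^ 2 =
      A ξ * ‖differenceSymbol h ξ‖ₑ ^ 2 := fun h ξ => by
    rw [enorm_mul, mul_pow, mul_comm]
  have hA' : ∀ ξ : ℝⁿ, ξ ≠ 0 → A ξ * ‖ξ‖ₑ ^ (2 * s) ≤ ‖F ξ‖ₑ ^ 2 := fun ξ hξ =>
    enorm_rpow_neg_mul_sq_mul_le hs hξ _
  clear_value A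
  have h2 : ∀ h : ℝⁿ, ∫⁻ x, ‖w (x + h) - w x‖ₑ ^ 2 * ‖h‖ₑ ^ (-b) =
      ∫⁻ ξ, c * (A ξ * (‖differenceSymbol h ξ‖ₑ ^ 2 * ‖h‖ₑ ^ (-b))) := fun h => by
    have hwh : Measurable fun x : ℝⁿ => ‖w (x + h) - w x‖ₑ ^ 2 :=
      ((hw.comp (measurable_add_const h)).sub hw).enorm.pow_const 2
    have hSh : Measurable fun ξ : ℝⁿ => ‖differenceSymbol h ξ‖ₑ ^ 2 :=
      (continuous_differenceSymbol_right h).measurable.enorm.pow_const 2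
    have e : ∫⁻ ξ, A ξ * ‖differenceSymbol h ξ‖ₑ ^ 2 * ‖h‖ₑ ^ (-b) =
        (∫⁻ ξ, A ξ * ‖differenceSymbol h ξ‖ₑ ^ 2) * ‖h‖ₑ ^ (-b) :=
      lintegral_mul_const _ (hAm.mul hSh)
    rw [lintegral_mul_const _ hwh, hc, lintegral_const_mul' _ _ ENNReal.coe_ne_top, mul_assoc,
      lintegral_congr (hAs h), ← e]
    simp only [mul_assoc]
  have h3 : ∀ ξ : ℝⁿ, ξ ≠ 0 → ∫⁻ h, c * (A ξ * (‖differenceSymbol h ξ‖ₑ ^ 2 * ‖h‖ₑ ^ (-b))) ≤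
      c * K * ‖F ξ‖ₑ ^ 2 := fun ξ hξ => by
    have hSξ : Measurable fun h : ℝⁿ => ‖differenceSymbol h ξ‖ₑ ^ 2 * ‖h‖ₑ ^ (-b) :=
      ((continuous_differenceSymbol_left ξ).measurable.enorm.pow_const 2).mul (by fun_prop)
    rw [lintegral_const_mul' _ _ ENNReal.coe_ne_top, lintegral_const_mul _ hSξ, mul_assoc]
    refine mul_le_mul' le_rfl ((mul_le_mul' le_rfl (hK ξ hξ)).trans ?_)
    rw [mul_left_comm]
    exact mul_le_mul' le_rfl (hA' ξ hξ)
  have h0 : ∀ᵐ ξ : ℝⁿ, ξ ≠ 0 := measure_eq_zero_iff_ae_notMem.1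
    (upperRegular_volume_euclidean.measure_singleton hn 0)
  rw [lintegral_lintegral_swap (hw'.mul (by fun_prop)).aemeasurable, lintegral_congr h2,
    lintegral_lintegral_swap (Measurable.aemeasurable (Measurable.const_mul
      ((hAm.comp measurable_snd).mul (hS.mul (by fun_prop))) _))] at h1
  refine h1.trans ((lintegral_mono_ae (h0.mono h3)).trans_eq ?_)
  exact lintegral_const_mul' _ _ (by finiteness)

/-- The Gagliardo seminorm of the Riesz potential of `f` is controlled by the norm of `f` in
`L²(ℝⁿ)`. -/
theorem exists_gagliardoIntegral_rieszPotential_le {s : ℝ} (hs : 0 < s) (hs1 : s < 1)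
    (hsn : 2 * s < n) (hn : 2 ≤ (n : ℝ)) : ∃ K : ℝ≥0, ∀ f : Lp ℂ 2 (volume : Measure ℝⁿ),
      gagliardoIntegral s (rieszPotential (n - s) f) ≤ K * ENNReal.ofReal (‖f‖ ^ 2) := by
  obtain ⟨c, hc⟩ := exists_lintegral_rieszPotential_difference_eq (n := n) hs hs1 hsn
  obtain ⟨K, hK⟩ := exists_lintegral_differenceSymbol_le (n := n) hs hs1 hn
  refine ⟨c * K, fun f => ?_⟩
  have h := gagliardoIntegral_le_of_difference hs (by linarith) hK
    (stronglyMeasurable_rieszPotential (n - s) (Lp.stronglyMeasurable f)).measurable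
    (Lp.stronglyMeasurable (𝓕 f)).measurable (hc f)
  rwa [lintegral_enorm_sq_lp, Lp.norm_fourier_eq, ← ENNReal.coe_mul] at h

end Gagliardo

/-! ### The layer potential as a Riesz potential -/

section LayerPotential

variable {n : ℕ} {Ω : Set (EuclideanSpace ℝ (Fin n))}

local notation "ℝⁿ" => EuclideanSpace ℝ (Fin n)

theorem MemHomogeneousSobolev.congr_ae {s : ℝ} {u v : ℝⁿ → ℂ} (hu : MemHomogeneousSobolev s u)
    (h : u =ᵐ[volume] v) : MemHomogeneousSobolev s v := by
  obtain ⟨h1, T, hT, h2⟩ := hu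
  refine ⟨fun S hS => (memLp_congr_ae (ae_restrict_of_ae h)).1 (h1 S hS), T, fun ψ hψ => ?_, h2⟩
  rw [hT ψ hψ]
  exact integral_congr_ae (h.mono fun x hx => by simp only [hx])

theorem gagliardoIntegral_congr_ae {s : ℝ} {u v : ℝⁿ → ℂ} (h : u =ᵐ[volume] v) :
    gagliardoIntegral s u = gagliardoIntegral s v := by
  unfold gagliardoIntegral
  refine lintegral_congr_ae (h.mono fun x hx => lintegral_congr_ae (h.mono fun y hy => ?_))
  simp only [hx, hy]

theorem rieszKernel_eq {β : ℝ} (x : ℝⁿ) :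
    rieszKernel β x = rieszConstant n β * ‖x‖ ^ (-((n : ℝ) - β)) := by
  rw [rieszKernel, one_div, Real.rpow_neg (norm_nonneg _)]

/-- The Riesz kernel of order `n - m` composed with itself. With `m = n - s` the resulting exponent
is that of the kernel `Γ_{2s}`. -/
theorem exists_riesz_composition {m : ℝ} (hm : n < 2 * m) (hmn : m < n) :
    ∃ K : ℝ≥0, 0 < K ∧ ∀ P Q : ℝⁿ, P ≠ Q → ∫⁻ z, ‖P - z‖ₑ ^ (-m) * ‖z - Q‖ₑ ^ (-m) =
      K * ‖P - Q‖ₑ ^ (-(2 * m - n)) := by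
  have hn0 : (0 : ℝ) ≤ n := n.cast_nonneg
  obtain ⟨K, hK0, hK⟩ := exists_lintegral_rpow_mul_rpow_eq (E := ℝⁿ) (a := m) (b := m)
    (by linarith) (by rwa [finrank_euclideanSpace_fin]) (by linarith)
    (by rwa [finrank_euclideanSpace_fin]) (by rw [finrank_euclideanSpace_fin]; linarith)
  refine ⟨K, hK0, fun P Q h => ?_⟩
  rw [hK P Q h, finrank_euclideanSpace_fin, two_mul]

/-- The layer potential of a functional agrees almost everywhere with the Riesz potential of order
`s` of a square integrable function whose norm is controlled by that of the functional. -/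
theorem IsBoundedLipschitzDomain.exists_layerPotential_ae_eq (hΩ : IsBoundedLipschitzDomain Ω)
    {s : ℝ} (hs : 1 / 2 < s) (hs1 : s < 1) (hn : 2 ≤ (n : ℝ)) :
    ∃ K : ℝ, 0 ≤ K ∧ ∀ φ : BoundarySobolevDual Ω (s - 1 / 2),
      ∃ f : Lp ℂ 2 (volume : Measure ℝⁿ), ‖f‖ ≤ K * ‖φ‖ ∧
        rieszPotential (n - s) f =ᵐ[volume] layerPotential s φ := by
  have hα : 0 < s - 1 / 2 := by linarith
  have hα1 : s - 1 / 2 < 1 / 2 := by linarith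
  obtain ⟨K, hK0, hK⟩ := exists_riesz_composition (n := n) (m := n - s) (by linarith) (by linarith)
  obtain ⟨K₀, hK₀, hφ⟩ := hΩ.exists_density hα hα1 hn
  -- The factor by which `Γ_{2s}` differs from the composition of the unnormalised kernels.
  set t : ℝ := rieszConstant n (2 * s) / K with ht
  have hKne : (K : ℝ) ≠ 0 := by exact_mod_cast hK0.ne'
  refine ⟨|t| * K₀, by positivity, fun φ => ?_⟩
  obtain ⟨f, hf, hfφ⟩ := hφ φ
  refine ⟨(t : ℂ) • f, ?_, ?_⟩
  · rw [norm_smul, Complex.norm_real, Real.norm_eq_abs, mul_assoc]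
    gcongr
  have h1 : ∀ᵐ x : ℝⁿ, x ∉ frontier Ω := measure_eq_zero_iff_ae_notMem.1
    (hΩ.volume_frontier (by exact_mod_cast (by linarith : (1 : ℝ) ≤ n)))
  have h2 := ae_integrable_riesz (m := n - s) (by linarith) (by linarith)
    (Lp.stronglyMeasurable f) (lintegral_enorm_sq_lp_lt_top f)
  filter_upwards [h1, h2] with x hx hfx
  have hmem := hΩ.memBoundarySobolev_kernel hα.le hα1 hn hx K (μ := 2 * (n - s) - n) (by linarith)
  have hker : (fun Q => (rieszKernel (2 * s) (x - Q) : ℂ)) =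
      (t : ℂ) • fun Q => ((K * ‖x - Q‖ ^ (-(2 * (n - s) - n : ℝ)) : ℝ) : ℂ) := by
    funext Q
    have e : -(2 * (n - s) - n : ℝ) = -(n - 2 * s) := by ring
    rw [Pi.smul_apply, smul_eq_mul, rieszKernel_eq, e, ← Complex.ofReal_mul, ← mul_assoc, ht,
      div_mul_cancel₀ _ hKne]
  have hmem' : MemBoundarySobolev Ω (s - 1 / 2) (fun Q => (rieszKernel (2 * s) (x - Q) : ℂ)) := by
    have := hΩ.memBoundarySobolev_kernel hα.le hα1 hn hx (rieszConstant n (2 * s))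
      (μ := n - 2 * s) (by linarith)
    simpa only [rieszKernel_eq] using this
  have h3 := hΩ.apply_mk_kernel_eq hα hα1 hn (m := n - s) (by ring) hK hx hmem hfφ hfx
  have h4 : layerPotential s φ x = φ (BoundarySobolev.mk hmem') := dif_pos hmem'
  rw [h4, BoundarySobolev.mk_eq_smul hmem hmem' (Filter.EventuallyEq.of_eq hker), map_smul, h3,
    smul_eq_mul, rieszPotential, rieszPotential, ← integral_const_mul]
  refine integral_congr_ae ((Lp.coeFn_smul (t : ℂ) f).mono fun y hy => ?_)
  simp only [hy, Pi.smul_apply, smul_eq_mul]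
  ring

end LayerPotential

theorem mainTheorem3 {n : ℕ} {s : ℝ} (hs : 1 / 2 < s) (hs1 : s < 1) (hn : 2 * s < n)
    (Ω : Set (EuclideanSpace ℝ (Fin n))) (hΩ : IsBoundedLipschitzDomain Ω) :
    (∀ x ∉ frontier Ω,
      MemBoundarySobolev Ω (s - 1 / 2) (fun Q => (rieszKernel (2 * s) (x - Q) : ℂ))) ∧
    ∃ c : ℝ, 0 < c ∧ ∀ φ : BoundarySobolevDual Ω (s - 1 / 2),
      MemHomogeneousSobolev s (layerPotential s φ) ∧
      gagliardoIntegral s (layerPotential s φ) ≤ ENNReal.ofReal (c * ‖φ‖ ^ 2) := by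
  have hn1 : 1 < n := by exact_mod_cast (show (1 : ℝ) < n by linarith)
  have hn2 : (2 : ℝ) ≤ n := by exact_mod_cast hn1
  refine ⟨fun x hx => ?_, ?_⟩
  · have := hΩ.memBoundarySobolev_kernel (α := s - 1 / 2) (by linarith) (by linarith) hn2 hx
      (rieszConstant n (2 * s)) (μ := n - 2 * s) (by linarith)
    simpa only [rieszKernel_eq] using this
  obtain ⟨K, hK, hu⟩ := hΩ.exists_layerPotential_ae_eq hs hs1 hn2
  obtain ⟨G, hG⟩ := exists_gagliardoIntegral_rieszPotential_le (n := n) (s := s) (by linarith) hs1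
    hn hn2
  -- The summand `1` makes the constant positive.
  refine ⟨G * K ^ 2 + 1, by positivity, fun φ => ?_⟩
  obtain ⟨f, hf, hfu⟩ := hu φ
  refine ⟨(memHomogeneousSobolev_rieszPotential (by linarith) hn f).congr_ae hfu, ?_⟩
  rw [← gagliardoIntegral_congr_ae hfu]
  refine (hG f).trans ?_
  rw [← ENNReal.ofReal_coe_nnreal, ← ENNReal.ofReal_mul G.coe_nonneg]
  refine ENNReal.ofReal_le_ofReal ?_
  calc (G : ℝ) * ‖f‖ ^ 2 ≤ G * (K * ‖φ‖) ^ 2 := by gcongr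
    _ ≤ (G * K ^ 2 + 1) * ‖φ‖ ^ 2 := by nlinarith [sq_nonneg ‖φ‖]
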